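/- Let $n,k\ge 1$, $m_0\le m_1$, $0<\rho\le 1$. Let $a\in H\Gamma_\rho^{m_1,m_0}(\mathbb R^{2n})$, i.e. $a\in C^\infty(\mathbb R^{2n})$ and there are $C_0,C_1>0$ and $C_\alpha\ge 0$ with $C_0|z|^{m_0}\le|a(z)|\le C_1|z|^{m_1}$ and $|\partial^\alpha a(z)|\le C_\alpha|a(z)||z|^{-\rho|\alpha|}$ for all multi-indices $\alpha$ and all sufficiently large $|z|$. Let $A:\mathcal S(\mathbb R^n)\to\mathcal S'(\mathbb R^n)$ be the Weyl operator with symbol $a$. Let $s\in\mathrm{Sp}(2(n+k),\mathbb R)$ and let $\widetilde A:\mathcal S(\mathbb R^{n+k})\to\mathcal S'(\mathbb R^{n+k})$ be the symplectic dimensional extension of $A$, i.e. the Weyl operator with symbol $\widetilde a=(a\otimes 1_{2k})\circ s$, where $(a\otimes 1_{2k})(x,y;\xi,\eta)=a(x,\xi)$. (Thus $\widetilde A$ is an arbitrary element of the extended Shubin class $\widetilde{HG}_\rho^{m_1,m_0}(\mathbb R^{2(n+k)})$ with $k\ge1$ extra dimensions.) Then $\widetilde A$ extends uniquely to a continuous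 linear map $\widetilde A':\mathcal S'(\mathbb R^{n+k})\to\mathcal S'(\mathbb R^{n+k})$ (where $\mathcal S'$ carries the weak-$*$ topology). If $\operatorname{Ker}\widetilde A'\ne\{0\}$, then $\widetilde A'$ is not globally hypoelliptic, i.e. there is $u\in\mathcal S'(\mathbb R^{n+k})\setminus\mathcal S(\mathbb R^{n+k})$ with $\widetilde A'u\in\mathcal S(\mathbb R^{n+k})$. More precisely, if $\operatorname{Ker}\widetilde A'\neq\{0\}$, then there is $\phi\in\mathcal S(\mathbb R^n)\setminus\{0\}$ with $A\phi=0$; there are a metaplectic operator $\widetilde S$ projecting onto $s$ and a $\chi\in\mathcal S'(\mathbb R^k)\setminus\mathcal S(\mathbb R^k)$; and for every such $\phi$, $\widetilde S$ and $\chi$ the distribution $T_{\widetilde S,\chi}\phi:=\widetilde S^{-1}(\phi\otimes\chi)$ satisfies $$\widetilde A'\,T_{\widetilde S,\chi}\phi=0,\qquad T_{\widetilde S,\chi}\phi\in\mathcal S'(\mathbb R^{n+k})\setminus\mathcal S(\mathbb R^{n+k}).$$ -/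

import Mathlib

open SchwartzMap MeasureTheory
open scoped FourierTransform ContDiff ComplexConjugate RealInnerProductSpace

noncomputable section

namespace SympExt

/-! ### Euclidean spaces and their splittings -/

/-- The Euclidean space `ℝ^ι`. With `ι = Fin n` this is `ℝⁿ`; the product `ℝⁿ × ℝᵏ` is
`Rn (Fin n ⊕ Fin k)`, and the phase space `ℝⁿ_x × ℝⁿ_ξ` is `Rn (Fin n ⊕ Fin n)`. -/
abbrev Rn (ι : Type) := EuclideanSpace ℝ ι

variable {ι κ μ : Type} [Fintype ι] [Fintype κ] [Fintype μ]

/-- The point `(x, y)` of `ℝ^ι × ℝ^κ`. -/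
def join (x : Rn ι) (y : Rn κ) : Rn (ι ⊕ κ) := WithLp.toLp 2 (Sum.elim x y)

/-- The first component of a point of `ℝ^ι × ℝ^κ`. -/
def leftPart (z : Rn (ι ⊕ κ)) : Rn ι := WithLp.toLp 2 fun i => z (Sum.inl i)

/-- The second component of a point of `ℝ^ι × ℝ^κ`. -/
def rightPart (z : Rn (ι ⊕ κ)) : Rn κ := WithLp.toLp 2 fun i => z (Sum.inr i)

/-! ### Tempered distributions -/

/-- The canonical embedding `𝓢 ⊂ 𝓢'`, `⟨f, g⟩ = ∫ f g`. -/
def emb (f : 𝓢(Rn ι, ℂ)) : 𝓢'(Rn ι, ℂ) := toTemperedDistributionCLM (Rn ι) ℂ volume f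

/-- A tempered distribution that is (given by) a Schwartz function. -/
def IsSchwartz (u : 𝓢'(Rn ι, ℂ)) : Prop := ∃ f : 𝓢(Rn ι, ℂ), u = emb f

/-- `B : 𝓢' → 𝓢'` is a continuous extension of `A : 𝓢 → 𝓢'`, i.e. `B` restricts to `A` on
`𝓢 ⊂ 𝓢'`. Since `𝓢` is dense in `𝓢'` there is at most one such `B`: the dual extension of `A`. -/
def IsDualExtension (A : 𝓢(Rn ι, ℂ) →L[ℂ] 𝓢'(Rn ι, ℂ))
    (B : 𝓢'(Rn ι, ℂ) →L[ℂ] 𝓢'(Rn ι, ℂ)) : Prop :=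
  ∀ f, B (emb f) = A f

/-- Global hypoellipticity: `B u ∈ 𝓢` implies `u ∈ 𝓢`, for all `u ∈ 𝓢'`. -/
def GloballyHypoelliptic (B : 𝓢'(Rn ι, ℂ) →L[ℂ] 𝓢'(Rn ι, ℂ)) : Prop :=
  ∀ u, IsSchwartz (B u) → IsSchwartz u

/-! ### Weyl operators -/

/-- The cross-Wigner transform
`W(f, g)(x, ξ) = (2π)^{-n} ∫ e^{-i ξ·y} f(x + y/2) conj (g(x - y/2)) dy`. -/
def crossWigner (f g : Rn ι → ℂ) (z : Rn (ι ⊕ ι)) : ℂ :=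
  ((2 * Real.pi : ℝ) : ℂ)⁻¹ ^ Fintype.card ι *
    ∫ y : Rn ι, Complex.exp (-Complex.I * (⟪rightPart z, y⟫ : ℝ)) *
      f (leftPart z + (1 / 2 : ℝ) • y) * conj (g (leftPart z - (1 / 2 : ℝ) • y))

/-- `A = Op^w(a)` for a function `a` on phase space, via
`⟨A f, conj g⟩ = ∫ a(z) W(f, g)(z) dz` for all Schwartz functions `f`, `g`
(here written with `conj g` in place of `g`). For smooth `a` of polynomial growth, as in the symbol
classes below, the integral converges absolutely. -/
def HasWeylSymbol (A : 𝓢(Rn ι, ℂ) →L[ℂ] 𝓢'(Rn ι, ℂ)) (a : Rn (ι ⊕ ι) → ℂ) : Prop :=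
  ∀ f g : 𝓢(Rn ι, ℂ), A f g = ∫ z, a z * crossWigner f (fun x => conj (g x)) z

/-- The symbol class `HΓ_ρ^{m₁,m₀}(ℝ²ⁿ)` (`m₀ ≤ m₁`, `0 < ρ ≤ 1`): smooth functions `a` with
`C₀ |z|^{m₀} ≤ |a(z)| ≤ C₁ |z|^{m₁}` and `|∂^α a(z)| ≤ C_α |a(z)| |z|^{-ρ|α|}` for large `|z|`;
the partial derivatives of order `j` are bounded jointly, through the `j`-th Fréchet derivative. -/
structure ShubinSymbol (ρ m₁ m₀ : ℝ) (a : Rn (ι ⊕ ι) → ℂ) : Prop where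
  smooth : ContDiff ℝ ∞ a
  growth : ∃ R > 0, ∃ C₀ > 0, ∃ C₁ > 0, ∀ z, R ≤ ‖z‖ →
    C₀ * ‖z‖ ^ m₀ ≤ ‖a z‖ ∧ ‖a z‖ ≤ C₁ * ‖z‖ ^ m₁
  deriv_bound : ∃ R > 0, ∀ j : ℕ, ∃ C ≥ 0, ∀ z, R ≤ ‖z‖ →
    ‖iteratedFDeriv ℝ j a z‖ ≤ C * ‖a z‖ * ‖z‖ ^ (-ρ * j)

/-! ### Symplectic maps and dimensional extensions of symbols -/

/-- The standard symplectic form `σ((x, ξ), (x', ξ')) = ξ·x' - ξ'·x`. -/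
def sympForm (z w : Rn (μ ⊕ μ)) : ℝ := ⟪rightPart z, leftPart w⟫ - ⟪rightPart w, leftPart z⟫

/-- Linear symplectomorphisms, i.e. elements of `Sp(2d, ℝ)`. -/
def IsSymplectic (s : Rn (μ ⊕ μ) ≃ₗ[ℝ] Rn (μ ⊕ μ)) : Prop :=
  ∀ z w, sympForm (s z) (s w) = sympForm z w

/-- The extended symbol `E_s[a] = (a ⊗ 1) ∘ s`, where `(a ⊗ 1)(x, y; ξ, η) = a(x, ξ)`. -/
def extSymbol (s : Rn ((ι ⊕ κ) ⊕ (ι ⊕ κ)) ≃ₗ[ℝ] Rn ((ι ⊕ κ) ⊕ (ι ⊕ κ)))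
    (a : Rn (ι ⊕ ι) → ℂ) : Rn ((ι ⊕ κ) ⊕ (ι ⊕ κ)) → ℂ :=
  fun z => a (join (leftPart (leftPart (s z))) (leftPart (rightPart (s z))))

/-! ### The metaplectic group -/

/-- The quadratic form `W(x, x') = ½ Px·x - Lx·x' + ½ Qx'·x'`. -/
def genFun (P L Q : Rn μ →ₗ[ℝ] Rn μ) (x x' : Rn μ) : ℝ :=
  1 / 2 * ⟪P x, x⟫ - ⟪L x, x'⟫ + 1 / 2 * ⟪Q x', x'⟫

/-- `IsMetaplectic S s`: the operator `S` on Schwartz functions belongs to the metaplectic group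
and projects onto the symplectic map `s`. The metaplectic group is generated by the operators
`S_{W,m} f(x) = (1/(2πi))^{d/2} i^m |det L|^{1/2} ∫ e^{i W(x,x')} f(x') dx'`, with `P`, `Q` symmetric,
`det L ≠ 0` and `m π` an argument of `det L`; such an operator projects onto the map
`s : (x', ξ') ↦ (x, ξ)` with `ξ = ∂ₓW(x, x') = P x - Lᵀ x'` and `ξ' = -∂ₓ'W(x, x') = L x - Q x'`.
(The inverse of an `S_{W,m}` is again of this form, so products suffice.) -/
inductive IsMetaplectic :
    (𝓢(Rn μ, ℂ) ≃L[ℂ] 𝓢(Rn μ, ℂ)) → (Rn (μ ⊕ μ) ≃ₗ[ℝ] Rn (μ ⊕ μ)) → Prop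
  | generator (P L Q : Rn μ →ₗ[ℝ] Rn μ) (m : ℤ) (hP : P.IsSymmetric) (hQ : Q.IsSymmetric)
      (hL : 0 < (-1 : ℝ) ^ m * LinearMap.det L)
      (S : 𝓢(Rn μ, ℂ) ≃L[ℂ] 𝓢(Rn μ, ℂ)) (s : Rn (μ ⊕ μ) ≃ₗ[ℝ] Rn (μ ⊕ μ))
      (hS : ∀ (f : 𝓢(Rn μ, ℂ)) (x : Rn μ), S f x =
        (1 / (2 * Real.pi * Complex.I) : ℂ) ^ ((Fintype.card μ : ℂ) / 2) *
          (Complex.I ^ m * (Real.sqrt |LinearMap.det L| : ℝ)) *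
          ∫ x' : Rn μ, Complex.exp (Complex.I * (genFun P L Q x x' : ℝ)) * f x')
      (hs : ∀ x ξ x' ξ' : Rn μ, join x ξ = s (join x' ξ') ↔
        ξ = P x - LinearMap.adjoint L x' ∧ ξ' = L x - Q x') : IsMetaplectic S s
  | mul {S₁ S₂ : 𝓢(Rn μ, ℂ) ≃L[ℂ] 𝓢(Rn μ, ℂ)} {s₁ s₂ : Rn (μ ⊕ μ) ≃ₗ[ℝ] Rn (μ ⊕ μ)}
      (h₁ : IsMetaplectic S₁ s₁) (h₂ : IsMetaplectic S₂ s₂) :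
      IsMetaplectic (S₂.trans S₁) (s₂.trans s₁)

/-- Complex conjugation on the Schwartz space. -/
def conjSchwartz : 𝓢(Rn μ, ℂ) →L[ℝ] 𝓢(Rn μ, ℂ) :=
  postcompCLM (𝕜 := ℝ) (Complex.conjCLE : ℂ →L[ℝ] ℂ)

theorem conjSchwartz_apply (f : 𝓢(Rn μ, ℂ)) (x : Rn μ) : conjSchwartz f x = conj (f x) := rfl

/-- The operator `f ↦ conj (U (conj f))`. -/
def conjOp (U : 𝓢(Rn μ, ℂ) →L[ℂ] 𝓢(Rn μ, ℂ)) : 𝓢(Rn μ, ℂ) →L[ℂ] 𝓢(Rn μ, ℂ) where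
  toFun f := conjSchwartz (U (conjSchwartz f))
  map_add' f g := by simp
  map_smul' c f := by
    have h : conjSchwartz (c • f) = conj c • conjSchwartz f := by
      ext x; simp [conjSchwartz_apply]
    rw [h, map_smul]
    ext x; simp [conjSchwartz_apply]
  cont := by fun_prop

/-- The inverse of a metaplectic operator `S`, acting on tempered distributions. As `S` is unitary on
`L²`, it is given by `⟨S⁻¹ u, g⟩ = ⟨u, conj (S (conj g))⟩`. -/
def metaInv (S : 𝓢(Rn μ, ℂ) ≃L[ℂ] 𝓢(Rn μ, ℂ)) : 𝓢'(Rn μ, ℂ) →L[ℂ] 𝓢'(Rn μ, ℂ) :=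
  PointwiseConvergenceCLM.precomp ℂ (conjOp (S : 𝓢(Rn μ, ℂ) →L[ℂ] 𝓢(Rn μ, ℂ)))

/-! ### Tensor products and the intertwiners -/

/-- `leftPart` as a continuous linear map. -/
def leftCLM : Rn (ι ⊕ κ) →L[ℝ] Rn ι :=
  LinearMap.toContinuousLinearMap
    { toFun := leftPart, map_add' := fun _ _ => rfl, map_smul' := fun _ _ => rfl }

/-- The inclusion `y ↦ (0, y)`, as a continuous linear map. -/
def inclCLM : Rn κ →L[ℝ] Rn (ι ⊕ κ) :=
  LinearMap.toContinuousLinearMap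
    { toFun := fun y => join 0 y
      map_add' := fun y z => by ext i; cases i <;> simp [join]
      map_smul' := fun c y => by ext i; cases i <;> simp [join] }

theorem norm_join_zero (y : Rn κ) : ‖(join 0 y : Rn (ι ⊕ κ))‖ = ‖y‖ := by
  simp [EuclideanSpace.norm_eq, join]

theorem inclCLM_antilipschitz : AntilipschitzWith 1 (inclCLM : Rn κ →L[ℝ] Rn (ι ⊕ κ)) :=
  ContinuousLinearMap.antilipschitz_of_bound _ fun y => by
    rw [NNReal.coe_one, one_mul]; exact (norm_join_zero (ι := ι) y).ge

theorem measurePreserving_join :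
    MeasurePreserving (fun p : Rn ι × Rn κ => join p.1 p.2) := by
  have h1 := WithLp.volume_preserving_toLp (Rn ι) (Rn κ)
  have h2 := (PiLp.sumPiLpEquivProdLpPiLp (𝕜 := ℝ) 2
    (fun _ : ι ⊕ κ => ℝ)).symm.measurePreserving
  exact h2.comp h1

/-- The partial pairing `Φ ↦ (y ↦ ∫ φ(x) Φ(x, y) dx)`; see `partialPairing_apply`. It is built
as the inverse Fourier transform of the restriction to `{0} × ℝ^κ` of the Fourier transform
of `φ(x) Φ(x, y)`. -/
def partialPairing (φ : 𝓢(Rn ι, ℂ)) : 𝓢(Rn (ι ⊕ κ), ℂ) →L[ℂ] 𝓢(Rn κ, ℂ) :=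
  (FourierTransform.fourierInvCLM ℂ 𝓢(Rn κ, ℂ)) ∘L
    (compCLMOfAntilipschitz ℂ (inclCLM (ι := ι) (κ := κ)).hasTemperateGrowth
      (inclCLM_antilipschitz (ι := ι) (κ := κ))) ∘L
    (FourierTransform.fourierCLM ℂ 𝓢(Rn (ι ⊕ κ), ℂ)) ∘L
    (SchwartzMap.smulLeftCLM ℂ fun z : Rn (ι ⊕ κ) => φ (leftCLM z))

theorem partialPairing_apply (φ : 𝓢(Rn ι, ℂ)) (Φ : 𝓢(Rn (ι ⊕ κ), ℂ)) (y : Rn κ) :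
    partialPairing φ Φ y = ∫ x : Rn ι, φ x * Φ (join x y) := by
  have hφ : Function.HasTemperateGrowth fun z : Rn (ι ⊕ κ) => φ (leftCLM z) :=
    φ.hasTemperateGrowth.comp (leftCLM (ι := ι) (κ := κ)).hasTemperateGrowth
  have hjl : ∀ (x : Rn ι) (y : Rn κ), leftCLM (join x y) = x := fun _ _ => rfl
  set Ψ : 𝓢(Rn (ι ⊕ κ), ℂ) := SchwartzMap.smulLeftCLM ℂ (fun z => φ (leftCLM z)) Φ with hΨ
  have hΨa : ∀ x y, Ψ (join x y) = φ x * Φ (join x y) := fun x y => by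
    rw [hΨ, smulLeftCLM_apply_apply hφ, hjl, smul_eq_mul]
  set g : Rn κ → ℂ := fun y => ∫ x : Rn ι, φ x * Φ (join x y) with hg
  have hmp := measurePreserving_join (ι := ι) (κ := κ)
  have hjc : Continuous fun p : Rn ι × Rn κ => join p.1 p.2 := by
    unfold join
    refine (PiLp.continuous_toLp 2 _).comp (continuous_pi fun i => ?_)
    cases i <;> simp <;> fun_prop
  have hemb : MeasurableEmbedding fun p : Rn ι × Rn κ => join p.1 p.2 := by
    refine hjc.measurableEmbedding fun p q h => ?_
    refine Prod.ext ?_ ?_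
    · exact congrArg leftPart h
    · exact congrArg rightPart h
  have hint : Integrable fun p : Rn ι × Rn κ => Ψ (join p.1 p.2) :=
    hmp.integrable_comp_of_integrable Ψ.integrable
  have hgint : Integrable g := by
    have := hint.integral_prod_right
    simpa only [hΨa] using this
  obtain ⟨C, hC⟩ : ∃ C, ∀ z, ‖Φ z‖ ≤ C := ⟨_, Φ.norm_le_seminorm ℂ⟩
  have hgcont : Continuous g := by
    refine continuous_of_dominated (bound := fun x => ‖φ x‖ * C) (fun y => ?_) (fun y => ?_) ?_ ?_
    · exact (φ.continuous.mul (Φ.continuous.comp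
        (hjc.comp (by fun_prop : Continuous fun x : Rn ι => (x, y))))).aestronglyMeasurable
    · refine Filter.Eventually.of_forall fun x => ?_
      rw [norm_mul]
      gcongr
      exact hC _
    · exact φ.integrable.norm.mul_const C
    · refine Filter.Eventually.of_forall fun x => ?_
      exact continuous_const.mul (Φ.continuous.comp
        (hjc.comp (by fun_prop : Continuous fun y : Rn κ => (x, y))))
  have hF : 𝓕 g = fun η => 𝓕 Ψ (inclCLM η) := by
    funext η
    rw [fourier_coe, Real.fourier_eq, Real.fourier_eq, ← hmp.integral_comp hemb]
    have hin : ∀ p : Rn ι × Rn κ,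
        ⟪join p.1 p.2, (inclCLM η : Rn (ι ⊕ κ))⟫ = ⟪p.2, η⟫ := fun p => by
      simp [inclCLM, join, PiLp.inner_apply]
    simp only [hin]
    rw [Measure.volume_eq_prod, integral_prod_symm]
    · refine integral_congr_ae (Filter.Eventually.of_forall fun y => ?_)
      simp only [hΨa, Circle.smul_def, smul_eq_mul, hg]
      exact (integral_const_mul _ _).symm
    · refine hint.mono (Continuous.aestronglyMeasurable ?_)
        (Filter.Eventually.of_forall fun p => (Circle.norm_smul _ _).le)
      have hc : Continuous fun p : Rn ι × Rn κ => Real.fourierChar (-⟪p.2, η⟫) :=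
        Real.continuous_fourierChar.comp (by fun_prop)
      exact hc.smul (Ψ.continuous.comp hjc)
  have hFi : Integrable (𝓕 g) := by
    have h := (compCLMOfAntilipschitz ℂ (inclCLM (ι := ι) (κ := κ)).hasTemperateGrowth
      (inclCLM_antilipschitz (ι := ι) (κ := κ)) (𝓕 Ψ)).integrable (μ := volume)
    rw [compCLMOfAntilipschitz_apply] at h
    rw [hF]
    exact h
  have key := hgcont.fourierInv_fourier_eq hgint hFi
  change _ = g y
  rw [← key, hF]
  change (𝓕⁻ (compCLMOfAntilipschitz ℂ (inclCLM (ι := ι) (κ := κ)).hasTemperateGrowth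
      (inclCLM_antilipschitz (ι := ι) (κ := κ)) (𝓕 Ψ))) y = _
  rw [fourierInv_coe]
  rfl

/-- The tensor product `φ ⊗ χ` of a Schwartz function and a tempered distribution:
`⟨φ ⊗ χ, Φ⟩ = ⟨χ, y ↦ ∫ φ(x) Φ(x, y) dx⟩`. -/
def tensor (φ : 𝓢(Rn ι, ℂ)) (χ : 𝓢'(Rn κ, ℂ)) : 𝓢'(Rn (ι ⊕ κ), ℂ) :=
  PointwiseConvergenceCLM.precomp ℂ (partialPairing φ) χ

/-- The intertwiner `T_{S,χ} φ = S⁻¹ (φ ⊗ χ)`, for a tempered distribution `χ`. -/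
def intertwiner (S : 𝓢(Rn (ι ⊕ κ), ℂ) ≃L[ℂ] 𝓢(Rn (ι ⊕ κ), ℂ)) (χ : 𝓢'(Rn κ, ℂ))
    (φ : 𝓢(Rn ι, ℂ)) : 𝓢'(Rn (ι ⊕ κ), ℂ) :=
  metaInv S (tensor φ χ)

end SympExt

end

open SympExt

/-!
# Kernels of dimensional extensions of hypoelliptic Weyl operators

A Weyl operator is studied through its transpose `T` for the bilinear pairing `∫ f g`, an operator on
the Schwartz space (`exists_transpose`). Weak-* continuous functionals on `𝓢'` are evaluations at
Schwartz functions, so the dual of `T` is the unique continuous extension of the Weyl operator to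
`𝓢'` (`IsTranspose.existsUnique_dualExtension`), and its kernel consists of the distributions `u` with
`u ∘ T = 0`. The tool behind the existence and the bounds of `T` is the short-time Fourier transform:
a distribution `u` is a Schwartz function as soon as `u (shift z h)` decays rapidly in the phase space
variable `z`, for a single window `h ≠ 0` (`exists_schwartz_of_decay`).

The theorem rests on three facts.

* *Hypoellipticity in the original dimension.* If `a` is in `HΓ` and `u ∘ T = 0`, then `u` is a Schwartz
  function (`ShubinSymbol.exists_schwartz_of_ker`). No parametrix is needed. Conjugation with the
  phase-space shift by `z` moves the symbol to `a(· + z) = a(z) (1 + r_z)`, where `r_z` is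
  `O(|z|^{-ρ})` in a fixed space of symbols of polynomial growth
  (`ShubinSymbol.exists_relVar_bound`); the equation then reads `u (shift z g) = -u (shift z (T' g))`
  with `T'` of size `O(|z|^{-ρ})`, and iterating it gives rapid decay.
* *Tensor products.* The operator with symbol `a ⊗ 1` acts on the first variable only
  (`IsTranspose.apply_stensor`). If a distribution `v ≠ 0` lies in its kernel, then `v(ψ ⊗ χ) ≠ 0`
  for some Schwartz functions, tensor products being total, and `v(· ⊗ χ)` is a nonzero element of
  the kernel of the operator with symbol `a`, hence a Schwartz function
  (`exists_ker_of_ker_tensorOne`). Conversely `φ ⊗ χ` is in the kernel for every `φ` in the kernel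
  of the latter and every distribution `χ` (`partialPairing_transpose_eq_zero`).
* *Symplectic covariance.* A metaplectic operator above `s` intertwines the Wigner transform with `s`
  (`IsMetaplectic.wignerCovariant`), since chirps, dilations and the Fourier transform do. It therefore
  carries the operator with symbol `(a ⊗ 1) ∘ s` to the one with symbol `a ⊗ 1`
  (`WignerCovariant.intertwines`). Such operators exist over every `s`
  (`IsSymplectic.exists_isMetaplectic`): composing `s` with a suitable shear makes it the map of a
  quadratic generating function.

Finally `S⁻¹ (φ ⊗ χ)` is a Schwartz function only if `χ` is one (`isSchwartz_of_intertwiner`), and in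
positive dimension the Dirac distribution is not (`not_isSchwartz_delta`).
-/

namespace SympExt

variable {ι κ : Type} [Fintype ι] [Fintype κ]

/-! ### Seminorms and weak integrals in the Schwartz space -/

section SchwartzIntegral

variable {E F : Type*} [NormedAddCommGroup E] [NormedSpace ℝ E]
  [NormedAddCommGroup F] [NormedSpace ℝ F]

/-- An increasing sequence of seminorms defining the topology of the Schwartz space. -/
noncomputable def snorm (N : ℕ) : Seminorm ℂ 𝓢(E, ℂ) :=
  (Finset.Iic (N, N)).sup (schwartzSeminormFamily ℂ E ℂ)

theorem seminorm_le_snorm {k l N : ℕ} (hk : k ≤ N) (hl : l ≤ N) (f : 𝓢(E, ℂ)) :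
    SchwartzMap.seminorm ℂ k l f ≤ snorm N f := by
  have h : (k, l) ∈ Finset.Iic (N, N) := Finset.mem_Iic.2 ⟨hk, hl⟩
  exact Seminorm.le_finset_sup_apply (p := schwartzSeminormFamily ℂ E ℂ) h

theorem snorm_le_of_seminorm_le {N : ℕ} {f : 𝓢(E, ℂ)} {B : ℝ} (hB : 0 ≤ B)
    (h : ∀ k ≤ N, ∀ l ≤ N, SchwartzMap.seminorm ℂ k l f ≤ B) : snorm N f ≤ B := by
  refine Seminorm.finset_sup_apply_le hB fun i hi => ?_
  obtain ⟨h1, h2⟩ := Finset.mem_Iic.1 hi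
  exact h _ h1 _ h2

theorem snorm_le {N : ℕ} {f : 𝓢(E, ℂ)} {B : ℝ} (hB : 0 ≤ B)
    (h : ∀ k ≤ N, ∀ l ≤ N, ∀ x, ‖x‖ ^ k * ‖iteratedFDeriv ℝ l f x‖ ≤ B) : snorm N f ≤ B :=
  snorm_le_of_seminorm_le hB fun k hk l hl => seminorm_le_bound ℂ k l f hB (h k hk l hl)

theorem snorm_mono {M N : ℕ} (h : M ≤ N) (f : 𝓢(E, ℂ)) : snorm M f ≤ snorm N f :=
  snorm_le_of_seminorm_le (apply_nonneg _ _) fun _ hk _ hl =>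
    seminorm_le_snorm (hk.trans h) (hl.trans h) f

theorem one_add_pow_mul_le_snorm {k l N : ℕ} (hk : k ≤ N) (hl : l ≤ N) (f : 𝓢(E, ℂ)) (x : E) :
    (1 + ‖x‖) ^ k * ‖iteratedFDeriv ℝ l f x‖ ≤ 2 ^ N * snorm N f :=
  one_add_le_sup_seminorm_apply (𝕜 := ℂ) (m := (N, N)) hk hl f x

theorem pow_mul_le_snorm {k l N : ℕ} (hk : k ≤ N) (hl : l ≤ N) (f : 𝓢(E, ℂ)) (x : E) :
    ‖x‖ ^ k * ‖iteratedFDeriv ℝ l f x‖ ≤ snorm N f :=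
  (le_seminorm ℂ k l f x).trans (seminorm_le_snorm hk hl f)

theorem continuous_snorm (N : ℕ) : Continuous (snorm (E := E) N) := by
  exact Seminorm.continuous_finsetSup fun i _ =>
    (schwartz_withSeminorms ℂ E ℂ).continuous_seminorm i

/-- Continuous seminorms on the Schwartz space are dominated by the sequence `snorm`. -/
theorem exists_le_snorm (p : Seminorm ℂ 𝓢(E, ℂ)) (hp : Continuous p) :
    ∃ (N : ℕ) (C : ℝ), 0 ≤ C ∧ ∀ f, p f ≤ C * snorm N f := by
  obtain ⟨s, C, -, h⟩ := Seminorm.bound_of_continuous (schwartz_withSeminorms ℂ E ℂ) p hp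
  refine ⟨s.sup fun i => max i.1 i.2, C, C.2, fun f => (h f).trans ?_⟩
  change (C : ℝ) * _ ≤ _
  refine mul_le_mul_of_nonneg_left ?_ C.2
  refine Seminorm.finset_sup_apply_le (apply_nonneg _ _) fun i hi => ?_
  have hi' := Finset.le_sup (f := fun i : ℕ × ℕ => max i.1 i.2) hi
  exact seminorm_le_snorm ((le_max_left _ _).trans hi') ((le_max_right _ _).trans hi') f

theorem exists_functional_le_snorm (u : 𝓢(E, ℂ) →L[ℂ] ℂ) :
    ∃ (N : ℕ) (C : ℝ), 0 ≤ C ∧ ∀ f, ‖u f‖ ≤ C * snorm N f :=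
  exists_le_snorm ((normSeminorm ℂ ℂ).comp (u : 𝓢(E, ℂ) →ₗ[ℂ] ℂ)) (u.continuous.norm)

theorem exists_map_snorm_le (T : 𝓢(E, ℂ) →L[ℂ] 𝓢(F, ℂ)) (N : ℕ) :
    ∃ (N' : ℕ) (C : ℝ), 0 ≤ C ∧ ∀ f, snorm N (T f) ≤ C * snorm N' f :=
  exists_le_snorm ((snorm N).comp (T : 𝓢(E, ℂ) →ₗ[ℂ] 𝓢(F, ℂ)))
    ((continuous_snorm N).comp T.continuous)

theorem continuous_of_snorm_le (T : 𝓢(E, ℂ) →ₗ[ℂ] 𝓢(F, ℂ))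
    (h : ∀ N, ∃ (N' : ℕ) (C : ℝ), 0 ≤ C ∧ ∀ f, snorm N (T f) ≤ C * snorm N' f) :
    Continuous T := by
  refine WithSeminorms.continuous_of_isBounded (schwartz_withSeminorms ℂ E ℂ)
    (schwartz_withSeminorms ℂ F ℂ) T fun i => ?_
  obtain ⟨N', C, hC, hf⟩ := h (max i.1 i.2)
  refine ⟨Finset.Iic (N', N'), ⟨C, hC⟩, fun f => ?_⟩
  exact (seminorm_le_snorm (le_max_left _ _) (le_max_right _ _) (T f)).trans (hf f)

theorem continuous_functional_of_snorm_le (u : 𝓢(E, ℂ) →ₗ[ℂ] ℂ)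
    (h : ∃ (N : ℕ) (C : ℝ), 0 ≤ C ∧ ∀ f, ‖u f‖ ≤ C * snorm N f) : Continuous u := by
  obtain ⟨N, C, hC, hf⟩ := h
  refine WithSeminorms.continuous_normedSpace_rng ℂ (schwartz_withSeminorms ℂ E ℂ) u
    ⟨Finset.Iic (N, N), ⟨C, hC⟩, fun f => hf f⟩

/-- The map `f ↦ D^l f(t)` as a continuous linear map. -/
noncomputable def derivEval (l : ℕ) (t : E) : 𝓢(E, ℂ) →L[ℂ] (E [×l]→L[ℝ] ℂ) :=
  mkCLMtoNormedSpace (𝕜 := ℂ) (fun f => iteratedFDeriv ℝ l f t)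
    (fun f g => iteratedFDeriv_add_apply (f.smooth l).contDiffAt (g.smooth l).contDiffAt)
    (fun c f => iteratedFDeriv_const_smul_apply (f.smooth l).contDiffAt)
    ⟨{(0, l)}, 1, zero_le_one, fun f => by
      simpa using norm_iteratedFDeriv_le_seminorm ℂ f l t⟩

theorem derivEval_apply (l : ℕ) (t : E) (f : 𝓢(E, ℂ)) :
    derivEval l t f = iteratedFDeriv ℝ l f t := rfl

/-- The map `f ↦ |·|^k D^l f` into bounded continuous functions. -/
noncomputable def weightedDeriv (k l : ℕ) :
    𝓢(E, ℂ) →L[ℂ] BoundedContinuousFunction E (E [×l]→L[ℝ] ℂ) :=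
  mkCLMtoNormedSpace (𝕜 := ℂ)
    (fun f : 𝓢(E, ℂ) => BoundedContinuousFunction.ofNormedAddCommGroup
      (fun t : E => ((‖t‖ ^ k : ℝ) : ℂ) • iteratedFDeriv ℝ l f t)
      (by
        have := (f.smooth l).continuous_iteratedFDeriv (m := l) le_rfl
        fun_prop)
      (SchwartzMap.seminorm ℂ k l f) (fun t => by
        rw [norm_smul, Complex.norm_real, norm_pow, norm_norm]
        exact le_seminorm ℂ k l f t))
    (fun f g => by
      ext1 t
      change ((‖t‖ ^ k : ℝ) : ℂ) • derivEval l t (f + g) =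
        ((‖t‖ ^ k : ℝ) : ℂ) • derivEval l t f + ((‖t‖ ^ k : ℝ) : ℂ) • derivEval l t g
      rw [map_add, smul_add])
    (fun c f => by
      ext1 t
      change ((‖t‖ ^ k : ℝ) : ℂ) • derivEval l t (c • f) =
        c • ((‖t‖ ^ k : ℝ) : ℂ) • derivEval l t f
      rw [map_smul, smul_comm])
    ⟨{(k, l)}, 1, zero_le_one, fun f => by
      rw [one_mul, Finset.sup_singleton]
      exact BoundedContinuousFunction.norm_ofNormedAddCommGroup_le _ (apply_nonneg _ _) _⟩

theorem weightedDeriv_apply (k l : ℕ) (f : 𝓢(E, ℂ)) (t : E) :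
    weightedDeriv k l f t = ((‖t‖ ^ k : ℝ) : ℂ) • derivEval l t f := rfl

/-- By the Hahn–Banach theorem, a functional bounded by the norm of `J f` factors through `J`. -/
theorem exists_functional_factor {X : Type*} [NormedAddCommGroup X] [NormedSpace ℂ X]
    (J : 𝓢(E, ℂ) →L[ℂ] X) (u : 𝓢(E, ℂ) →L[ℂ] ℂ) {C : ℝ}
    (hu : ∀ f, ‖u f‖ ≤ C * ‖J f‖) : ∃ v : X →L[ℂ] ℂ, ∀ f, u f = v (J f) := by
  have hker : LinearMap.ker (J : 𝓢(E, ℂ) →ₗ[ℂ] X) ≤ LinearMap.ker (u : 𝓢(E, ℂ) →ₗ[ℂ] ℂ) := by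
    intro f hf
    have hf' : J f = 0 := hf
    have := hu f
    rw [hf', norm_zero, mul_zero] at this
    exact norm_le_zero_iff.1 this
  let w : LinearMap.range (J : 𝓢(E, ℂ) →ₗ[ℂ] X) →ₗ[ℂ] ℂ :=
    ((LinearMap.ker (J : 𝓢(E, ℂ) →ₗ[ℂ] X)).liftQ (u : 𝓢(E, ℂ) →ₗ[ℂ] ℂ) hker) ∘ₗ
      (J : 𝓢(E, ℂ) →ₗ[ℂ] X).quotKerEquivRange.symm.toLinearMap
  have hw : ∀ f (h : J f ∈ LinearMap.range (J : 𝓢(E, ℂ) →ₗ[ℂ] X)), w ⟨J f, h⟩ = u f := by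
    intro f h
    have h1 : (J : 𝓢(E, ℂ) →ₗ[ℂ] X).quotKerEquivRange.symm ⟨J f, h⟩ = Submodule.Quotient.mk f := by
      rw [LinearEquiv.symm_apply_eq]
      rfl
    change (LinearMap.ker (J : 𝓢(E, ℂ) →ₗ[ℂ] X)).liftQ (u : 𝓢(E, ℂ) →ₗ[ℂ] ℂ) hker _ = _
    rw [LinearEquiv.coe_coe, h1]
    rfl
  obtain ⟨v, hv, -⟩ := exists_extension_norm_eq _ (LinearMap.mkContinuous w C (by
    rintro ⟨_, f, rfl⟩
    exact (congrArg norm (hw f ⟨f, rfl⟩)).trans_le (hu f)))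
  exact ⟨v, fun f => ((hv ⟨J f, ⟨f, rfl⟩⟩).trans (hw f _)).symm⟩

variable {Z : Type*} [TopologicalSpace Z] [SecondCountableTopology Z] [MeasurableSpace Z]
  [OpensMeasurableSpace Z] {μ : Measure Z} {γ : Z → 𝓢(E, ℂ)}

theorem integrable_clm_comp {G : Type*} [NormedAddCommGroup G] [NormedSpace ℂ G]
    (L : 𝓢(E, ℂ) →L[ℂ] G)
    (hγ : Continuous γ) (hb : ∀ N, Integrable (fun z => snorm N (γ z)) μ) :
    Integrable (fun z => L (γ z)) μ := by
  obtain ⟨N, C, hC, h⟩ := exists_le_snorm ((normSeminorm ℂ G).comp (L : 𝓢(E, ℂ) →ₗ[ℂ] G))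
    L.continuous.norm
  exact ((hb N).const_mul C).mono' (L.continuous.comp hγ).aestronglyMeasurable
    (Filter.Eventually.of_forall fun z => h (γ z))

/-- Differentiation under the integral sign to all orders, for integrable families of Schwartz
functions. -/
theorem hasFTaylorSeries_integral
    (hγ : Continuous γ) (hb : ∀ N, Integrable (fun z => snorm N (γ z)) μ) :
    HasFTaylorSeriesUpTo ∞ (fun t => ∫ z, γ z t ∂μ)
      (fun t l => ∫ z, derivEval l t (γ z) ∂μ) := by
  have hder : ∀ (m : ℕ) (t : E), HasFDerivAt (fun t => ∫ z, derivEval m t (γ z) ∂μ)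
      ((∫ z, derivEval (m + 1) t (γ z) ∂μ).curryLeft) t := by
    intro m t
    let e : (E [×(m + 1)]→L[ℝ] ℂ) ≃ₗᵢ[ℝ] (E →L[ℝ] (E [×m]→L[ℝ] ℂ)) :=
      continuousMultilinearCurryLeftEquiv ℝ (fun _ : Fin (m + 1) => E) ℂ
    have hint : ∀ l t, Integrable (fun z => derivEval l t (γ z)) μ := fun l t =>
      integrable_clm_comp _ hγ hb
    have h1 : (∫ z, derivEval (m + 1) t (γ z) ∂μ).curryLeft
        = ∫ z, e (derivEval (m + 1) t (γ z)) ∂μ := by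
      have h := ContinuousLinearMap.integral_comp_comm (𝕜 := ℝ)
        (E := E [×(m + 1)]→L[ℝ] ℂ) (Fₗ := E →L[ℝ] (E [×m]→L[ℝ] ℂ))
        e.toContinuousLinearEquiv.toContinuousLinearMap (hint (m + 1) t)
      exact h.symm
    rw [h1]
    refine hasFDerivAt_integral_of_dominated_of_fderiv_le
      (F' := fun t z => e (derivEval (m + 1) t (γ z)))
      (bound := fun z => snorm (m + 1) (γ z)) Filter.univ_mem
      (Filter.Eventually.of_forall fun t => (hint m t).aestronglyMeasurable) (hint m t)
      (e.continuous.comp_aestronglyMeasurable (hint (m + 1) t).aestronglyMeasurable) ?_ (hb _) ?_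
    · refine Filter.Eventually.of_forall fun z t _ => ?_
      rw [LinearIsometryEquiv.norm_map, derivEval_apply]
      exact (norm_iteratedFDeriv_le_seminorm ℂ (γ z) (m + 1) t).trans
        (seminorm_le_snorm (Nat.zero_le _) le_rfl _)
    · refine Filter.Eventually.of_forall fun z t _ => ?_
      have h2 := (((γ z).smooth (m + 1)).differentiable_iteratedFDeriv (m := m)
        (by exact_mod_cast Nat.lt_succ_self m) t).hasFDerivAt
      have h3 : e (derivEval (m + 1) t (γ z)) = fderiv ℝ (iteratedFDeriv ℝ m (γ z)) t := by
        rw [derivEval_apply, iteratedFDeriv_succ_eq_comp_left]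
        exact e.apply_symm_apply _
      rw [h3]
      exact h2
  refine hasFTaylorSeriesUpToOn_univ_iff.1 ⟨fun t _ => ?_, fun m _ t _ =>
    (hder m t).hasFDerivWithinAt, fun m _ =>
      (continuous_iff_continuousAt.2 fun t => (hder m t).continuousAt).continuousOn⟩
  have hint : Integrable (fun z => derivEval 0 t (γ z)) μ := integrable_clm_comp _ hγ hb
  let e := (continuousMultilinearCurryFin0 ℝ E ℂ)
  exact (e.toContinuousLinearEquiv.toContinuousLinearMap.integral_comp_comm hint).symm

/-- Integration of a continuous family in the Schwartz space all of whose seminorms are integrable: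
the pointwise integral is a Schwartz function, and continuous functionals commute with the
integral. -/
theorem exists_schwartz_integral
    (hγ : Continuous γ) (hb : ∀ N, Integrable (fun z => snorm N (γ z)) μ) :
    ∃ g : 𝓢(E, ℂ), (∀ t, g t = ∫ z, γ z t ∂μ) ∧
      (∀ u : 𝓢(E, ℂ) →L[ℂ] ℂ, u g = ∫ z, u (γ z) ∂μ) ∧
      ∀ N, snorm N g ≤ ∫ z, snorm N (γ z) ∂μ := by
  have hT := hasFTaylorSeries_integral hγ hb
  have hint : ∀ l t, Integrable (fun z => derivEval l t (γ z)) μ := fun l t =>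
      integrable_clm_comp _ hγ hb
  have hD : ∀ l t, iteratedFDeriv ℝ l (fun t => ∫ z, γ z t ∂μ) t = ∫ z, derivEval l t (γ z) ∂μ :=
    fun l t => (hT.eq_iteratedFDeriv (m := l) (by exact_mod_cast le_top) t).symm
  have hbd : ∀ k l N, k ≤ N → l ≤ N → ∀ t,
      ‖t‖ ^ k * ‖iteratedFDeriv ℝ l (fun t => ∫ z, γ z t ∂μ) t‖ ≤ ∫ z, snorm N (γ z) ∂μ := by
    intro k l N hk hl t
    rw [hD, ← norm_norm t, ← norm_pow, ← norm_smul, ← integral_smul]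
    refine norm_integral_le_of_norm_le (hb N) (Filter.Eventually.of_forall fun z => ?_)
    rw [norm_smul, norm_pow, norm_norm]
    exact pow_mul_le_snorm hk hl (γ z) t
  let g : 𝓢(E, ℂ) := ⟨fun t => ∫ z, γ z t ∂μ, hT.contDiff, fun k l =>
    ⟨_, hbd k l (max k l) (le_max_left _ _) (le_max_right _ _)⟩⟩
  have hgD : ∀ l t, derivEval l t g = ∫ z, derivEval l t (γ z) ∂μ := hD
  refine ⟨g, fun t => rfl, fun u => ?_, fun N => snorm_le
    (integral_nonneg fun z => apply_nonneg _ _) fun k hk l hl t => hbd k l N hk hl t⟩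
  obtain ⟨N, C, hC, hu⟩ := exists_functional_le_snorm u
  -- The functional `u` factors through the embedding `J` of the Schwartz space into a Banach space
  -- of tuples of bounded continuous functions, where the Bochner integral is available.
  let s := Finset.Iic (N, N)
  let J : 𝓢(E, ℂ) →L[ℂ] (∀ i : s, BoundedContinuousFunction E (E [×i.1.2]→L[ℝ] ℂ)) :=
    ContinuousLinearMap.pi fun i => weightedDeriv i.1.1 i.1.2
  have hJ : ∀ f, snorm N f ≤ ‖J f‖ := fun f =>
    snorm_le (norm_nonneg _) fun k hk l hl t => by
      have h1 : (k, l) ∈ s := Finset.mem_Iic.2 ⟨hk, hl⟩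
      refine le_trans (le_of_eq ?_) (((J f ⟨(k, l), h1⟩).norm_coe_le_norm t).trans
        (norm_le_pi_norm (J f) _))
      change _ = ‖weightedDeriv k l f t‖
      rw [weightedDeriv_apply, norm_smul, Complex.norm_real, norm_pow, norm_norm, derivEval_apply]
  have huJ : ∀ f, ‖u f‖ ≤ C * ‖J f‖ := fun f =>
    (hu f).trans (mul_le_mul_of_nonneg_left (hJ f) hC)
  obtain ⟨v, hv⟩ := exists_functional_factor
    (X := ∀ i : s, BoundedContinuousFunction E (E [×i.1.2]→L[ℝ] ℂ)) J u huJ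
  have hJint := integrable_clm_comp (μ := μ)
    (G := ∀ i : s, BoundedContinuousFunction E (E [×i.1.2]→L[ℝ] ℂ)) J hγ hb
  have hJg : J g = ∫ z, J (γ z) ∂μ := by
    funext i
    ext1 t
    let ev : (∀ i : s, BoundedContinuousFunction E (E [×i.1.2]→L[ℝ] ℂ)) →L[ℂ]
        (E [×i.1.2]→L[ℝ] ℂ) := (BoundedContinuousFunction.evalCLM ℂ t).comp
      (ContinuousLinearMap.proj (R := ℂ) (φ := fun i : s =>
        BoundedContinuousFunction E (E [×i.1.2]→L[ℝ] ℂ)) i)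
    have h1 := ContinuousLinearMap.integral_comp_comm (𝕜 := ℂ)
      (E := ∀ i : s, BoundedContinuousFunction E (E [×i.1.2]→L[ℝ] ℂ))
      (Fₗ := E [×i.1.2]→L[ℝ] ℂ) ev hJint
    change _ = ev (∫ z, J (γ z) ∂μ)
    rw [← h1]
    change weightedDeriv i.1.1 i.1.2 g t = ∫ z, weightedDeriv i.1.1 i.1.2 (γ z) t ∂μ
    simp only [weightedDeriv_apply]
    rw [hgD, integral_smul]
  rw [hv, hJg, ← v.integral_comp_comm hJint]
  simp only [hv]

end SchwartzIntegral

/-! ### Bounds for products and compositions with linear maps -/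

section Bounds

variable {E F : Type*} [NormedAddCommGroup E] [NormedSpace ℝ E]
  [NormedAddCommGroup F] [NormedSpace ℝ F]

theorem norm_iteratedFDeriv_comp_clm_le {f : F → ℂ} (hf : ContDiff ℝ ∞ f) (L : E →L[ℝ] F)
    (n : ℕ) (x : E) :
    ‖iteratedFDeriv ℝ n (fun y => f (L y)) x‖ ≤ ‖L‖ ^ n * ‖iteratedFDeriv ℝ n f (L x)‖ := by
  have h := L.iteratedFDeriv_comp_right hf x (i := n) (by exact_mod_cast le_top)
  change ‖iteratedFDeriv ℝ n (f ∘ L) x‖ ≤ _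
  rw [h]
  refine (ContinuousMultilinearMap.norm_compContinuousLinearMap_le _ _).trans (le_of_eq ?_)
  simp [mul_comm]

/-- A Leibniz estimate with uniform bounds on the factors. -/
theorem norm_iteratedFDeriv_mul_le_of_le {f g : E → ℂ} (hf : ContDiff ℝ ∞ f) (hg : ContDiff ℝ ∞ g)
    (x : E) {n : ℕ} {A B : ℝ} (hA : 0 ≤ A)
    (h1 : ∀ i ≤ n, ‖iteratedFDeriv ℝ i f x‖ ≤ A) (h2 : ∀ i ≤ n, ‖iteratedFDeriv ℝ i g x‖ ≤ B) :
    ‖iteratedFDeriv ℝ n (fun y => f y * g y) x‖ ≤ 2 ^ n * (A * B) := by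
  refine (norm_iteratedFDeriv_mul_le hf hg x (n := n) (by exact_mod_cast le_top)).trans ?_
  calc ∑ i ∈ Finset.range (n + 1), (n.choose i : ℝ) * ‖iteratedFDeriv ℝ i f x‖ *
        ‖iteratedFDeriv ℝ (n - i) g x‖
      ≤ ∑ i ∈ Finset.range (n + 1), (n.choose i : ℝ) * (A * B) := by
        refine Finset.sum_le_sum fun i hi => ?_
        rw [mul_assoc]
        refine mul_le_mul_of_nonneg_left ?_ (Nat.cast_nonneg _)
        exact mul_le_mul (h1 i (Nat.lt_succ_iff.1 (Finset.mem_range.1 hi))) (h2 _ (Nat.sub_le _ _))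
          (norm_nonneg _) hA
    _ = 2 ^ n * (A * B) := by
        rw [← Finset.sum_mul, ← Nat.cast_sum, Nat.sum_range_choose]
        push_cast
        rfl

theorem hasTemperateGrowth_cexp_mul_I :
    Function.HasTemperateGrowth fun s : ℝ => Complex.exp (s * Complex.I) := by
  refine ⟨(Complex.ofRealCLM.contDiff.mul contDiff_const).cexp, fun n => ⟨0, 1, fun s => ?_⟩⟩
  have h : ∀ n : ℕ, iteratedDeriv n (fun s : ℝ => Complex.exp (s * Complex.I)) =
      fun s : ℝ => Complex.I ^ n * Complex.exp (s * Complex.I) := by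
    intro n
    induction n with
    | zero => simp
    | succ n ih =>
      rw [iteratedDeriv_succ, ih]
      funext s
      have h1 : HasDerivAt (fun s : ℝ => Complex.exp (s * Complex.I))
          (Complex.exp (s * Complex.I) * (1 * Complex.I)) s :=
        ((Complex.ofRealCLM.hasDerivAt (x := s)).mul_const Complex.I).cexp
      rw [(h1.const_mul (Complex.I ^ n)).deriv]
      ring
  rw [norm_iteratedFDeriv_eq_norm_iteratedDeriv, h]
  simp [Complex.norm_exp_ofReal_mul_I]

theorem iteratedFDeriv_slice {Z : Type*} [NormedAddCommGroup Z] [NormedSpace ℝ Z]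
    {G : Z × E → ℂ} (hG : ContDiff ℝ ∞ G) (z : Z) (t : E) (n : ℕ) :
    iteratedFDeriv ℝ n (fun t => G (z, t)) t =
      (iteratedFDeriv ℝ n G (z, t)).compContinuousLinearMap
        fun _ => ContinuousLinearMap.inr ℝ Z E := by
  have h1 : (fun t => G (z, t)) =
      (fun w => G ((z, 0) + w)) ∘ (ContinuousLinearMap.inr ℝ Z E) := by
    funext t; simp
  have h2 : ContDiff ℝ ∞ fun w => G ((z, 0) + w) := hG.comp (contDiff_const.add contDiff_id)
  rw [h1, (ContinuousLinearMap.inr ℝ Z E).iteratedFDeriv_comp_right h2 t (i := n)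
    (by exact_mod_cast le_top), iteratedFDeriv_comp_add_left]
  simp

theorem norm_compContinuousLinearMap_inr_le {Z : Type*} [NormedAddCommGroup Z] [NormedSpace ℝ Z]
    {n : ℕ} (m : (Z × E) [×n]→L[ℝ] ℂ) :
    ‖m.compContinuousLinearMap fun _ => ContinuousLinearMap.inr ℝ Z E‖ ≤ ‖m‖ := by
  refine (ContinuousMultilinearMap.norm_compContinuousLinearMap_le _ _).trans ?_
  refine mul_le_of_le_one_right (norm_nonneg _) (Finset.prod_le_one (fun _ _ => norm_nonneg _)
    fun _ _ => ContinuousLinearMap.norm_inr_le_one ℝ Z E)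

/-- A smooth family of Schwartz functions with locally uniform decay of all joint derivatives is
continuous as a map into the Schwartz space. -/
theorem continuous_of_joint_bound {Z : Type*} [NormedAddCommGroup Z] [NormedSpace ℝ Z]
    {G : Z × E → ℂ} (hG : ContDiff ℝ ∞ G) (γ : Z → 𝓢(E, ℂ)) (hγ : ∀ z t, γ z t = G (z, t))
    (hb : ∀ k l : ℕ, ∃ (N : ℕ) (C : ℝ), ∀ z t,
      ‖t‖ ^ k * ‖iteratedFDeriv ℝ l G (z, t)‖ ≤ C * (1 + ‖z‖) ^ N) : Continuous γ := by
  choose N C hNC using hb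
  have hC : ∀ k l, 0 ≤ C k l := fun k l => by
    have h := hNC k l 0 0
    simp only [norm_zero, add_zero, one_pow, mul_one] at h
    exact le_trans (by positivity) h
  have key : ∀ z₀ z k l, ‖z - z₀‖ ≤ 1 → SchwartzMap.seminorm ℂ k l (γ z - γ z₀) ≤
      C k (l + 1) * (2 + ‖z₀‖) ^ N k (l + 1) * ‖z - z₀‖ := by
    intro z₀ z k l hz
    have hCk := hC k (l + 1)
    refine seminorm_le_bound ℂ k l _ (by positivity) fun t => ?_
    have e1 : iteratedFDeriv ℝ l (⇑(γ z - γ z₀)) t =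
        (iteratedFDeriv ℝ l G (z, t) - iteratedFDeriv ℝ l G (z₀, t)).compContinuousLinearMap
          fun _ => ContinuousLinearMap.inr ℝ Z E := by
      have h1 : iteratedFDeriv ℝ l (⇑(γ z - γ z₀)) t =
          iteratedFDeriv ℝ l (γ z) t - iteratedFDeriv ℝ l (γ z₀) t := by
        have := map_sub (derivEval l t) (γ z) (γ z₀)
        simpa only [derivEval_apply] using this
      have h2 : ∀ z, iteratedFDeriv ℝ l (γ z) t = (iteratedFDeriv ℝ l G (z, t)).compContinuousLinearMap
          fun _ => ContinuousLinearMap.inr ℝ Z E := fun z => by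
        rw [← iteratedFDeriv_slice hG]
        congr 1
        funext t
        exact hγ z t
      rw [h1, h2, h2]
      rfl
    -- the mean value inequality in the parameter `z`, at the cost of one more joint derivative
    have e2 : ‖‖t‖ ^ k • (iteratedFDeriv ℝ l G (z, t) - iteratedFDeriv ℝ l G (z₀, t))‖ ≤
        C k (l + 1) * (2 + ‖z₀‖) ^ N k (l + 1) * ‖z - z₀‖ := by
      rw [smul_sub]
      refine Convex.norm_image_sub_le_of_norm_hasFDerivWithin_le
        (f := fun w => ‖t‖ ^ k • iteratedFDeriv ℝ l G (w, t))
        (f' := fun w => ‖t‖ ^ k • (fderiv ℝ (iteratedFDeriv ℝ l G) (w, t)).comp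
          (ContinuousLinearMap.inl ℝ Z E)) (s := Metric.closedBall z₀ 1) (fun w hw => ?_)
        (fun w hw => ?_) (convex_closedBall _ _) (Metric.mem_closedBall_self zero_le_one)
        (by rwa [Metric.mem_closedBall, dist_eq_norm])
      · have h1 : HasFDerivAt (iteratedFDeriv ℝ l G) (fderiv ℝ (iteratedFDeriv ℝ l G) (w, t)) (w, t) :=
          ((hG.differentiable_iteratedFDeriv (m := l) (by exact_mod_cast WithTop.coe_lt_top _)) _).hasFDerivAt
        have h2 : HasFDerivAt (fun w : Z => (w, t)) (ContinuousLinearMap.inl ℝ Z E) w :=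
          hasFDerivAt_prodMk_left w t
        exact ((h1.comp w h2).const_smul (‖t‖ ^ k)).hasFDerivWithinAt
      · have h1 : ‖w‖ ≤ 1 + ‖z₀‖ := by
          have : ‖w - z₀‖ ≤ 1 := by rwa [Metric.mem_closedBall, dist_eq_norm] at hw
          linarith [norm_sub_norm_le w z₀]
        rw [norm_smul, norm_pow, norm_norm]
        calc ‖t‖ ^ k * ‖(fderiv ℝ (iteratedFDeriv ℝ l G) (w, t)).comp (ContinuousLinearMap.inl ℝ Z E)‖
            ≤ ‖t‖ ^ k * ‖iteratedFDeriv ℝ (l + 1) G (w, t)‖ := by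
              gcongr
              rw [← norm_fderiv_iteratedFDeriv]
              refine (ContinuousLinearMap.opNorm_comp_le _ _).trans ?_
              exact mul_le_of_le_one_right (norm_nonneg _) (ContinuousLinearMap.norm_inl_le_one ℝ Z E)
          _ ≤ C k (l + 1) * (1 + ‖w‖) ^ N k (l + 1) := hNC k (l + 1) w t
          _ ≤ C k (l + 1) * (2 + ‖z₀‖) ^ N k (l + 1) :=
              mul_le_mul_of_nonneg_left (pow_le_pow_left₀ (by positivity) (by linarith) _) hCk
    rw [e1]
    refine le_trans ?_ e2
    rw [norm_smul, norm_pow, norm_norm]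
    gcongr
    exact norm_compContinuousLinearMap_inr_le _
  refine continuous_iff_continuousAt.2 fun z₀ => ?_
  refine ((schwartz_withSeminorms ℂ E ℂ).tendsto_nhds _ _).2 fun i ε hε => ?_
  have hlim : Filter.Tendsto (fun z => C i.1 (i.2 + 1) * (2 + ‖z₀‖) ^ N i.1 (i.2 + 1) * ‖z - z₀‖)
      (nhds z₀) (nhds 0) := by
    have : Continuous fun z => C i.1 (i.2 + 1) * (2 + ‖z₀‖) ^ N i.1 (i.2 + 1) * ‖z - z₀‖ := by
      fun_prop
    simpa using this.tendsto z₀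
  filter_upwards [hlim.eventually (gt_mem_nhds hε), Metric.closedBall_mem_nhds z₀ one_pos]
    with z hz hz1
  exact (key z₀ z i.1 i.2 (by rwa [Metric.mem_closedBall, dist_eq_norm] at hz1)).trans_lt hz

end Bounds

/-! ### The splitting of a product space -/

section Join

omit [Fintype ι] [Fintype κ] in
@[simp] theorem leftPart_join (x : Rn ι) (y : Rn κ) : leftPart (join x y) = x := rfl

omit [Fintype ι] [Fintype κ] in
@[simp] theorem rightPart_join (x : Rn ι) (y : Rn κ) : rightPart (join x y) = y := rfl

omit [Fintype ι] [Fintype κ] in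
@[simp] theorem join_left_right (z : Rn (ι ⊕ κ)) : join (leftPart z) (rightPart z) = z := by
  ext i; cases i <;> rfl

theorem norm_join_sq (x : Rn ι) (y : Rn κ) : ‖join x y‖ ^ 2 = ‖x‖ ^ 2 + ‖y‖ ^ 2 := by
  simp [EuclideanSpace.norm_sq_eq, join]

theorem inner_join (x x' : Rn ι) (y y' : Rn κ) : ⟪join x y, join x' y'⟫ = ⟪x, x'⟫ + ⟪y, y'⟫ := by
  simp [PiLp.inner_apply, join]

theorem norm_leftPart_le (z : Rn (ι ⊕ κ)) : ‖leftPart z‖ ≤ ‖z‖ := by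
  have h := norm_join_sq (leftPart z) (rightPart z)
  rw [join_left_right] at h
  exact abs_le_of_sq_le_sq' (by nlinarith [sq_nonneg ‖rightPart z‖]) (norm_nonneg _) |>.2

theorem norm_rightPart_le (z : Rn (ι ⊕ κ)) : ‖rightPart z‖ ≤ ‖z‖ := by
  have h := norm_join_sq (leftPart z) (rightPart z)
  rw [join_left_right] at h
  exact abs_le_of_sq_le_sq' (by nlinarith [sq_nonneg ‖leftPart z‖]) (norm_nonneg _) |>.2

theorem norm_le_add (z : Rn (ι ⊕ κ)) : ‖z‖ ≤ ‖leftPart z‖ + ‖rightPart z‖ := by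
  have h := norm_join_sq (leftPart z) (rightPart z)
  rw [join_left_right] at h
  exact abs_le_of_sq_le_sq' (by nlinarith [norm_nonneg (leftPart z), norm_nonneg (rightPart z)])
    (by positivity) |>.2

theorem one_add_norm_le_mul (z : Rn (ι ⊕ κ)) :
    1 + ‖z‖ ≤ (1 + ‖leftPart z‖) * (1 + ‖rightPart z‖) := by
  nlinarith [norm_le_add z, mul_nonneg (norm_nonneg (leftPart z)) (norm_nonneg (rightPart z))]

/-- `rightPart` as a continuous linear map. -/
noncomputable def rightCLM : Rn (ι ⊕ κ) →L[ℝ] Rn κ :=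
  LinearMap.toContinuousLinearMap
    { toFun := rightPart, map_add' := fun _ _ => rfl, map_smul' := fun _ _ => rfl }

@[simp] theorem leftCLM_apply (z : Rn (ι ⊕ κ)) : leftCLM z = leftPart z := rfl

@[simp] theorem rightCLM_apply (z : Rn (ι ⊕ κ)) : rightCLM z = rightPart z := rfl

theorem norm_leftCLM_le : ‖(leftCLM : Rn (ι ⊕ κ) →L[ℝ] Rn ι)‖ ≤ 1 :=
  ContinuousLinearMap.opNorm_le_bound _ zero_le_one fun z => by
    simpa using norm_leftPart_le z

theorem norm_rightCLM_le : ‖(rightCLM : Rn (ι ⊕ κ) →L[ℝ] Rn κ)‖ ≤ 1 :=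
  ContinuousLinearMap.opNorm_le_bound _ zero_le_one fun z => by
    simpa using norm_rightPart_le z

/-- The map `(x, y) ↦ join x y` as a continuous linear equivalence. -/
noncomputable def joinL : (Rn ι × Rn κ) ≃L[ℝ] Rn (ι ⊕ κ) :=
  LinearEquiv.toContinuousLinearEquiv
    { toFun := fun p => join p.1 p.2
      invFun := fun z => (leftPart z, rightPart z)
      map_add' := fun p q => by ext i; cases i <;> rfl
      map_smul' := fun c p => by ext i; cases i <;> rfl
      left_inv := fun _ => rfl
      right_inv := fun z => join_left_right z }

theorem continuous_join : Continuous fun p : Rn ι × Rn κ => join p.1 p.2 := joinL.continuous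

theorem measurableEmbedding_join :
    MeasurableEmbedding fun p : Rn ι × Rn κ => join p.1 p.2 :=
  joinL.toHomeomorph.measurableEmbedding

theorem integrable_join {F : Rn (ι ⊕ κ) → ℂ} (hF : Integrable F) :
    Integrable fun p : Rn ι × Rn κ => F (join p.1 p.2) :=
  measurePreserving_join.integrable_comp_of_integrable hF

theorem integral_join {F : Rn (ι ⊕ κ) → ℂ} (hF : Integrable F) :
    ∫ z, F z = ∫ x, ∫ y, F (join x y) := by
  rw [← measurePreserving_join.integral_comp measurableEmbedding_join F, Measure.volume_eq_prod,
    integral_prod _ (integrable_join hF)]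

theorem integral_join_symm {F : Rn (ι ⊕ κ) → ℂ} (hF : Integrable F) :
    ∫ z, F z = ∫ y, ∫ x, F (join x y) := by
  rw [← measurePreserving_join.integral_comp measurableEmbedding_join F, Measure.volume_eq_prod,
    integral_prod_symm _ (integrable_join hF)]

end Join

/-! ### Tensor products of Schwartz functions -/

section Tensor

theorem contDiff_comp_leftCLM (f : 𝓢(Rn ι, ℂ)) :
    ContDiff ℝ ∞ fun z : Rn (ι ⊕ κ) => f (leftCLM z) :=
  ContDiff.comp (g := f) (f := leftCLM (ι := ι) (κ := κ)) (f.smooth ⊤)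
    (leftCLM (ι := ι) (κ := κ)).contDiff

theorem contDiff_comp_rightCLM (g : 𝓢(Rn κ, ℂ)) :
    ContDiff ℝ ∞ fun z : Rn (ι ⊕ κ) => g (rightCLM z) :=
  ContDiff.comp (g := g) (f := rightCLM (ι := ι) (κ := κ)) (g.smooth ⊤)
    (rightCLM (ι := ι) (κ := κ)).contDiff

theorem norm_iteratedFDeriv_comp_leftCLM_le (f : 𝓢(Rn ι, ℂ)) (i : ℕ) (z : Rn (ι ⊕ κ)) :
    ‖iteratedFDeriv ℝ i (fun z : Rn (ι ⊕ κ) => f (leftCLM z)) z‖ ≤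
      ‖iteratedFDeriv ℝ i f (leftPart z)‖ :=
  (norm_iteratedFDeriv_comp_clm_le (f.smooth ⊤) (leftCLM (ι := ι) (κ := κ)) i z).trans
    (mul_le_of_le_one_left (norm_nonneg _) (pow_le_one₀ (norm_nonneg _) norm_leftCLM_le))

theorem norm_iteratedFDeriv_comp_rightCLM_le (g : 𝓢(Rn κ, ℂ)) (i : ℕ) (z : Rn (ι ⊕ κ)) :
    ‖iteratedFDeriv ℝ i (fun z : Rn (ι ⊕ κ) => g (rightCLM z)) z‖ ≤
      ‖iteratedFDeriv ℝ i g (rightPart z)‖ :=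
  (norm_iteratedFDeriv_comp_clm_le (g.smooth ⊤) (rightCLM (ι := ι) (κ := κ)) i z).trans
    (mul_le_of_le_one_left (norm_nonneg _) (pow_le_one₀ (norm_nonneg _) norm_rightCLM_le))

/-- The Leibniz estimate for `f ⊗ g`, with `(1 + |x|)(1 + |y|)` absorbing the weight in `(x, y)`. -/
theorem tensor_bound (f : 𝓢(Rn ι, ℂ)) (g : 𝓢(Rn κ, ℂ)) (z : Rn (ι ⊕ κ)) (k l N : ℕ) (hk : k ≤ N)
    (hl : l ≤ N) :
    ‖z‖ ^ k * ‖iteratedFDeriv ℝ l (fun z => f (leftCLM z) * g (rightCLM z)) z‖ ≤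
      8 ^ N * (snorm N f * snorm N g) := by
  have hf : ∀ i ≤ l, ‖iteratedFDeriv ℝ i (fun z : Rn (ι ⊕ κ) => f (leftCLM z)) z‖ ≤
      2 ^ N * snorm N f / (1 + ‖leftPart z‖) ^ k := fun i hi => by
    refine (norm_iteratedFDeriv_comp_leftCLM_le f i z).trans ?_
    rw [le_div_iff₀' (by positivity)]
    exact one_add_pow_mul_le_snorm hk (hi.trans hl) f (leftPart z)
  have hg : ∀ i ≤ l, ‖iteratedFDeriv ℝ i (fun z : Rn (ι ⊕ κ) => g (rightCLM z)) z‖ ≤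
      2 ^ N * snorm N g / (1 + ‖rightPart z‖) ^ k := fun i hi => by
    refine (norm_iteratedFDeriv_comp_rightCLM_le g i z).trans ?_
    rw [le_div_iff₀' (by positivity)]
    exact one_add_pow_mul_le_snorm hk (hi.trans hl) g (rightPart z)
  have h1 := norm_iteratedFDeriv_mul_le_of_le (contDiff_comp_leftCLM f)
    (contDiff_comp_rightCLM g) z (n := l) (by positivity) hf hg
  calc _ ≤ ((1 + ‖leftPart z‖) * (1 + ‖rightPart z‖)) ^ k *
        (2 ^ l * (2 ^ N * snorm N f / (1 + ‖leftPart z‖) ^ k *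
          (2 ^ N * snorm N g / (1 + ‖rightPart z‖) ^ k))) := by
        refine mul_le_mul (pow_le_pow_left₀ (norm_nonneg _) ?_ _) h1 (norm_nonneg _) (by positivity)
        linarith [one_add_norm_le_mul z]
    _ = 2 ^ l * (2 ^ N * 2 ^ N * (snorm N f * snorm N g)) := by
        rw [mul_pow]
        field_simp
    _ ≤ 2 ^ N * (2 ^ N * 2 ^ N * (snorm N f * snorm N g)) := by
        have : (2 : ℝ) ^ l ≤ 2 ^ N := pow_le_pow_right₀ (by norm_num) hl
        gcongr
    _ = 8 ^ N * (snorm N f * snorm N g) := by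
        rw [show (8 : ℝ) = 2 * (2 * 2) by norm_num, mul_pow, mul_pow]
        ring

/-- The tensor product `f ⊗ g` of Schwartz functions. -/
noncomputable def stensor (f : 𝓢(Rn ι, ℂ)) (g : 𝓢(Rn κ, ℂ)) : 𝓢(Rn (ι ⊕ κ), ℂ) :=
  ⟨fun z => f (leftCLM z) * g (rightCLM z),
    (contDiff_comp_leftCLM f).mul (contDiff_comp_rightCLM g),
    fun k l => ⟨_, fun z => tensor_bound f g z k l (max k l) (le_max_left _ _) (le_max_right _ _)⟩⟩

@[simp] theorem stensor_apply (f : 𝓢(Rn ι, ℂ)) (g : 𝓢(Rn κ, ℂ)) (z : Rn (ι ⊕ κ)) :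
    stensor f g z = f (leftPart z) * g (rightPart z) := rfl

theorem snorm_stensor_le (N : ℕ) (f : 𝓢(Rn ι, ℂ)) (g : 𝓢(Rn κ, ℂ)) :
    snorm N (stensor f g) ≤ 8 ^ N * (snorm N f * snorm N g) :=
  snorm_le (by positivity) fun k hk l hl z => tensor_bound f g z k l N hk hl

/-- The map `g ↦ f ⊗ g`. -/
noncomputable def stensorRight (f : 𝓢(Rn ι, ℂ)) : 𝓢(Rn κ, ℂ) →L[ℂ] 𝓢(Rn (ι ⊕ κ), ℂ) :=
  let T : 𝓢(Rn κ, ℂ) →ₗ[ℂ] 𝓢(Rn (ι ⊕ κ), ℂ) :=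
    { toFun := stensor f
      map_add' := fun g h => by ext z; simp [mul_add]
      map_smul' := fun c g => by ext z; simp; ring }
  ⟨T, continuous_of_snorm_le T fun N => ⟨N, 8 ^ N * snorm N f, by positivity, fun g =>
    (snorm_stensor_le N f g).trans (le_of_eq (by ring))⟩⟩

/-- The map `f ↦ f ⊗ g`. -/
noncomputable def stensorLeft (g : 𝓢(Rn κ, ℂ)) : 𝓢(Rn ι, ℂ) →L[ℂ] 𝓢(Rn (ι ⊕ κ), ℂ) :=
  let T : 𝓢(Rn ι, ℂ) →ₗ[ℂ] 𝓢(Rn (ι ⊕ κ), ℂ) :=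
    { toFun := fun f => stensor f g
      map_add' := fun g h => by ext z; simp [add_mul]
      map_smul' := fun c g => by ext z; simp; ring }
  ⟨T, continuous_of_snorm_le T fun N => ⟨N, 8 ^ N * snorm N g, by positivity, fun f =>
    (snorm_stensor_le N f g).trans (le_of_eq (by ring))⟩⟩

end Tensor

/-! ### Phase-space shifts -/

section Shift

/-- The unimodular number `e^{2πis}`. -/
noncomputable def cis (s : ℝ) : ℂ := Complex.exp ((2 * Real.pi * s : ℝ) * Complex.I)

@[simp] theorem norm_cis (s : ℝ) : ‖cis s‖ = 1 := Complex.norm_exp_ofReal_mul_I _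

theorem cis_add (s t : ℝ) : cis (s + t) = cis s * cis t := by
  rw [cis, cis, cis, ← Complex.exp_add]; push_cast; ring_nf

@[simp] theorem cis_zero : cis 0 = 1 := by simp [cis]

theorem cis_eq_fourierChar (s : ℝ) : cis s = Real.fourierChar s := by
  rw [cis, Real.fourierChar_apply]

theorem hasTemperateGrowth_cis : Function.HasTemperateGrowth cis :=
  hasTemperateGrowth_cexp_mul_I.comp (f := fun s : ℝ => 2 * Real.pi * s) (by fun_prop)

theorem continuous_cis : Continuous cis := hasTemperateGrowth_cis.1.continuous

/-- The phase-space shift by `z = (p, q)`, `f ↦ (t ↦ e^{2πi q·t} f(t - p))`. -/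
noncomputable def shift (z : Rn (ι ⊕ ι)) : 𝓢(Rn ι, ℂ) →L[ℂ] 𝓢(Rn ι, ℂ) :=
  (SchwartzMap.smulLeftCLM ℂ fun t => cis ⟪rightPart z, t⟫) ∘L (compSubConstCLM ℂ (leftPart z))

theorem hasTemperateGrowth_cis_inner (q : Rn ι) :
    Function.HasTemperateGrowth fun t : Rn ι => cis ⟪q, t⟫ :=
  hasTemperateGrowth_cis.comp (Function.hasTemperateGrowth_inner_right q)

theorem shift_apply (z : Rn (ι ⊕ ι)) (f : 𝓢(Rn ι, ℂ)) (t : Rn ι) :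
    shift z f t = cis ⟪rightPart z, t⟫ * f (t - leftPart z) := by
  simp [shift, smulLeftCLM_apply_apply (hasTemperateGrowth_cis_inner _)]

/-- The shift as a function of both variables. -/
noncomputable def shiftFun (f : Rn ι → ℂ) (w : Rn (ι ⊕ ι) × Rn ι) : ℂ :=
  cis ⟪rightCLM w.1, w.2⟫ * f (w.2 - leftCLM w.1)

theorem hasTemperateGrowth_cis_phase :
    Function.HasTemperateGrowth fun w : Rn (ι ⊕ ι) × Rn ι => cis ⟪rightCLM w.1, w.2⟫ := by
  refine hasTemperateGrowth_cis.comp (f := fun w : Rn (ι ⊕ ι) × Rn ι => ⟪rightCLM w.1, w.2⟫) ?_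
  exact (innerSL ℝ (E := Rn ι)).bilinear_hasTemperateGrowth
    (f := fun w : Rn (ι ⊕ ι) × Rn ι => rightCLM w.1) (g := fun w => w.2)
    ((rightCLM (ι := ι) (κ := ι)).comp (ContinuousLinearMap.fst ℝ (Rn (ι ⊕ ι)) (Rn ι))).hasTemperateGrowth
    (ContinuousLinearMap.snd ℝ (Rn (ι ⊕ ι)) (Rn ι)).hasTemperateGrowth

theorem contDiff_shiftFun (f : 𝓢(Rn ι, ℂ)) : ContDiff ℝ ∞ (shiftFun f) :=
  hasTemperateGrowth_cis_phase.1.mul ((f.smooth ⊤).comp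
    ((ContinuousLinearMap.snd ℝ (Rn (ι ⊕ ι)) (Rn ι)).contDiff.sub
      (leftCLM.comp (ContinuousLinearMap.fst ℝ (Rn (ι ⊕ ι)) (Rn ι))).contDiff))

/-- Joint bounds for the derivatives of `(z, t) ↦ shift z f t`: the decay of `f` at `t - p` is turned
into decay in `t` by Peetre's inequality `1 + |t| ≤ (1 + |z|)(1 + |t - p|)`, where `p` is the
position part of `z`. -/
theorem shiftFun_bound (k l : ℕ) : ∃ (N : ℕ) (C : ℝ), 0 ≤ C ∧ ∀ (f : 𝓢(Rn ι, ℂ)) z t,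
    ‖t‖ ^ k * ‖iteratedFDeriv ℝ l (shiftFun f) (z, t)‖ ≤ C * (1 + ‖z‖) ^ N * snorm N f := by
  obtain ⟨r, C, hC, h⟩ :=
    (hasTemperateGrowth_cis_phase (ι := ι)).norm_iteratedFDeriv_le_uniform l
  let A : Rn (ι ⊕ ι) × Rn ι →L[ℝ] Rn ι := ContinuousLinearMap.snd ℝ _ _ -
    leftCLM.comp (ContinuousLinearMap.fst ℝ _ _)
  refine ⟨k + r + r + l, 2 ^ l * (C * ((1 + ‖A‖) ^ l * 2 ^ (k + r + r + l))), by positivity,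
    fun f z t => ?_⟩
  set N := k + r + r + l with hN
  have ht1 : 1 + ‖t‖ ≤ (1 + ‖z‖) * (1 + ‖t - leftPart z‖) := by
    have h1 : ‖t‖ ≤ ‖t - leftPart z‖ + ‖leftPart z‖ := by
      simpa using norm_add_le (t - leftPart z) (leftPart z)
    nlinarith [norm_leftPart_le z, norm_nonneg z, norm_nonneg (t - leftPart z),
      mul_nonneg (norm_nonneg z) (norm_nonneg (t - leftPart z))]
  have hzt : 1 + ‖((z, t) : Rn (ι ⊕ ι) × Rn ι)‖ ≤ (1 + ‖z‖) * (1 + ‖t‖) := by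
    have : ‖((z, t) : Rn (ι ⊕ ι) × Rn ι)‖ ≤ ‖z‖ + ‖t‖ := by
      rw [Prod.norm_mk]
      exact max_le_add_of_nonneg (norm_nonneg _) (norm_nonneg _)
    nlinarith [mul_nonneg (norm_nonneg z) (norm_nonneg t)]
  have hf : ∀ i ≤ l, ‖iteratedFDeriv ℝ i (fun w => f (A w)) (z, t)‖ ≤
      (1 + ‖A‖) ^ l * (2 ^ N * snorm N f / (1 + ‖t - leftPart z‖) ^ (k + r)) := fun i hi => by
    refine (norm_iteratedFDeriv_comp_clm_le (f.smooth ⊤) A i (z, t)).trans ?_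
    have e1 : ‖A‖ ^ i ≤ (1 + ‖A‖) ^ l :=
      (pow_le_pow_left₀ (norm_nonneg _) (by linarith) i).trans
        (pow_le_pow_right₀ (by linarith [norm_nonneg A]) hi)
    refine mul_le_mul e1 ?_ (norm_nonneg _) (by positivity)
    rw [le_div_iff₀' (by positivity)]
    exact one_add_pow_mul_le_snorm (by omega) (by omega) f (t - leftPart z)
  have h1 := norm_iteratedFDeriv_mul_le_of_le hasTemperateGrowth_cis_phase.1
    ((f.smooth ⊤).comp A.contDiff) (z, t) (n := l) (by positivity) (fun i hi => h i hi (z, t)) hf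
  have h2 : ‖t‖ ^ k ≤ (1 + ‖t‖) ^ k := pow_le_pow_left₀ (norm_nonneg _) (by linarith) _
  calc _ ≤ (1 + ‖t‖) ^ k * (2 ^ l * (C * ((1 + ‖z‖) * (1 + ‖t‖)) ^ r *
          ((1 + ‖A‖) ^ l * (2 ^ N * snorm N f / (1 + ‖t - leftPart z‖) ^ (k + r))))) := by
        refine mul_le_mul h2 (h1.trans ?_) (norm_nonneg _) (by positivity)
        gcongr
    _ = 2 ^ l * (C * ((1 + ‖A‖) ^ l * 2 ^ N)) * (1 + ‖z‖) ^ r *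
          ((1 + ‖t‖) ^ (k + r) / (1 + ‖t - leftPart z‖) ^ (k + r)) * snorm N f := by
        rw [mul_pow, pow_add]
        ring
    _ ≤ 2 ^ l * (C * ((1 + ‖A‖) ^ l * 2 ^ N)) * (1 + ‖z‖) ^ r * (1 + ‖z‖) ^ (k + r) *
          snorm N f := by
        gcongr
        rw [div_le_iff₀ (by positivity), ← mul_pow]
        gcongr
    _ = 2 ^ l * (C * ((1 + ‖A‖) ^ l * 2 ^ N)) * (1 + ‖z‖) ^ (r + (k + r)) * snorm N f := by
        rw [pow_add (1 + ‖z‖) r]; ring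
    _ ≤ 2 ^ l * (C * ((1 + ‖A‖) ^ l * 2 ^ N)) * (1 + ‖z‖) ^ N * snorm N f := by
        have : (1 + ‖z‖) ^ (r + (k + r)) ≤ (1 + ‖z‖) ^ N :=
          pow_le_pow_right₀ (by linarith [norm_nonneg z]) (by omega)
        gcongr

theorem continuous_shift (f : 𝓢(Rn ι, ℂ)) : Continuous fun z => shift z f := by
  refine continuous_of_joint_bound (contDiff_shiftFun f) _ (fun z t => shift_apply z f t)
    fun k l => ?_
  obtain ⟨N, C, -, h⟩ := shiftFun_bound (ι := ι) k l
  exact ⟨N, C * snorm N f, fun z t => (h f z t).trans (le_of_eq (by ring))⟩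

/-- Phase-space shifts grow at most polynomially in every Schwartz seminorm. -/
theorem snorm_shift_le (N : ℕ) : ∃ (N' : ℕ) (C : ℝ), 0 ≤ C ∧ ∀ (f : 𝓢(Rn ι, ℂ)) z,
    snorm N (shift z f) ≤ C * (1 + ‖z‖) ^ N' * snorm N' f := by
  choose M C hC h using fun p : ℕ × ℕ => shiftFun_bound (ι := ι) p.1 p.2
  let s := Finset.Iic (N, N)
  refine ⟨s.sup M, ∑ p ∈ s, C p, Finset.sum_nonneg fun p _ => hC p, fun f z => ?_⟩
  have hpos : 0 ≤ ∑ p ∈ s, C p := Finset.sum_nonneg fun p _ => hC p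
  refine snorm_le (by positivity) fun k hk l hl t => ?_
  have hmem : (k, l) ∈ s := Finset.mem_Iic.2 ⟨hk, hl⟩
  have e1 : ‖iteratedFDeriv ℝ l (shift z f) t‖ ≤ ‖iteratedFDeriv ℝ l (shiftFun f) (z, t)‖ := by
    have : (⇑(shift z f) : Rn ι → ℂ) = fun t => shiftFun f (z, t) :=
      funext fun t => shift_apply z f t
    rw [this, iteratedFDeriv_slice (contDiff_shiftFun f)]
    exact norm_compContinuousLinearMap_inr_le _
  have hM : M (k, l) ≤ s.sup M := Finset.le_sup hmem
  calc _ ≤ ‖t‖ ^ k * ‖iteratedFDeriv ℝ l (shiftFun f) (z, t)‖ := by gcongr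
    _ ≤ C (k, l) * (1 + ‖z‖) ^ M (k, l) * snorm (M (k, l)) f := h (k, l) f z t
    _ ≤ (∑ p ∈ s, C p) * (1 + ‖z‖) ^ s.sup M * snorm (s.sup M) f := by
        refine mul_le_mul (mul_le_mul (Finset.single_le_sum (fun p _ => hC p) hmem) ?_
          (by positivity) hpos) (snorm_mono hM f) (apply_nonneg _ _) (by positivity)
        exact pow_le_pow_right₀ (by linarith [norm_nonneg z]) hM

end Shift

/-! ### Rapidly decaying functions -/

section Decay

theorem integrable_one_add_norm_pow (ι : Type) [Fintype ι] :
    Integrable fun z : Rn ι => ((1 + ‖z‖) ^ (Fintype.card ι + 1))⁻¹ := by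
  have h := integrable_one_add_norm (E := Rn ι) (μ := volume) (r := (Fintype.card ι + 1 : ℕ))
    (by simp)
  refine h.congr (Filter.Eventually.of_forall fun z => ?_)
  simp only
  rw [Real.rpow_neg (by positivity), Real.rpow_natCast]

/-- The constant bounding the integral of a function by its weighted supremum. -/
noncomputable def decayConst (ι : Type) [Fintype ι] : ℝ :=
  ∫ z : Rn ι, ((1 + ‖z‖) ^ (Fintype.card ι + 1))⁻¹

theorem decayConst_nonneg : 0 ≤ decayConst ι := integral_nonneg fun z => by positivity

variable {G : Type*} [NormedAddCommGroup G]

theorem norm_le_of_weighted {z : Rn ι} {a A : ℝ} {m : ℕ}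
    (h : (1 + ‖z‖) ^ m * a ≤ A) : a ≤ A * ((1 + ‖z‖) ^ m)⁻¹ := by
  rw [← div_eq_mul_inv, le_div_iff₀' (by positivity)]
  exact h

theorem integrable_of_weighted {f : Rn ι → G} (hf : AEStronglyMeasurable f) {A : ℝ}
    (h : ∀ z, (1 + ‖z‖) ^ (Fintype.card ι + 1) * ‖f z‖ ≤ A) : Integrable f :=
  ((integrable_one_add_norm_pow ι).const_mul A).mono' hf
    (Filter.Eventually.of_forall fun z => norm_le_of_weighted (h z))

theorem integral_norm_le_of_weighted {f : Rn ι → G} {A : ℝ}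
    (h : ∀ z, (1 + ‖z‖) ^ (Fintype.card ι + 1) * ‖f z‖ ≤ A) : ∫ z, ‖f z‖ ≤ decayConst ι * A := by
  rw [mul_comm, decayConst, ← integral_const_mul]
  exact integral_mono_of_nonneg (Filter.Eventually.of_forall fun z => norm_nonneg _)
    ((integrable_one_add_norm_pow ι).const_mul A)
    (Filter.Eventually.of_forall fun z => norm_le_of_weighted (h z))

end Decay

/-! ### The short-time Fourier transform -/

section STFT

/-- The reflection `(p, q) ↦ (p, -q)` in the frequency variable. -/
noncomputable def refl (z : Rn (ι ⊕ ι)) : Rn (ι ⊕ ι) := join (leftPart z) (-rightPart z)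

omit [Fintype ι] in
@[simp] theorem leftPart_refl (z : Rn (ι ⊕ ι)) : leftPart (refl z) = leftPart z := rfl

omit [Fintype ι] in
@[simp] theorem rightPart_refl (z : Rn (ι ⊕ ι)) : rightPart (refl z) = -rightPart z := rfl

theorem norm_refl (z : Rn (ι ⊕ ι)) : ‖refl z‖ = ‖z‖ := by
  have h1 := norm_join_sq (leftPart z) (-rightPart z)
  have h2 := norm_join_sq (leftPart z) (rightPart z)
  rw [norm_neg] at h1
  rw [← h1, join_left_right] at h2
  exact (pow_left_injective₀ h2.symm)
where
  pow_left_injective₀ {z : Rn (ι ⊕ ι)} (h : ‖join (leftPart z) (-rightPart z)‖ ^ 2 = ‖z‖ ^ 2) :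
      ‖refl z‖ = ‖z‖ := (sq_eq_sq₀ (norm_nonneg _) (norm_nonneg _)).1 h

omit [Fintype ι] in
theorem continuous_refl : Continuous (refl : Rn (ι ⊕ ι) → Rn (ι ⊕ ι)) := by
  unfold refl join leftPart rightPart
  refine (PiLp.continuous_toLp 2 _).comp (continuous_pi fun i => ?_)
  cases i <;> simp <;> fun_prop

/-- The short-time Fourier transform of `g` with window `k`,
`(p, q) ↦ ∫ g(s) k(s - p) e^{-2πi q·s} ds`. -/
noncomputable def stft (k g : 𝓢(Rn ι, ℂ)) (z : Rn (ι ⊕ ι)) : ℂ := ∫ s, g s * shift (refl z) k s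

theorem emb_apply (f g : 𝓢(Rn ι, ℂ)) : emb f g = ∫ x, f x * g x := by
  have h := toTemperedDistributionCLM_apply_apply (μ := (volume : Measure (Rn ι))) f g
  rw [emb, h]
  simp only [smul_eq_mul, mul_comm]

/-- A tempered distribution, viewed as a continuous functional. -/
noncomputable def toFunctional (u : 𝓢'(Rn ι, ℂ)) : 𝓢(Rn ι, ℂ) →L[ℂ] ℂ := u

/-- The functional `g ↦ ∫ f g`. -/
noncomputable def embF (f : 𝓢(Rn ι, ℂ)) : 𝓢(Rn ι, ℂ) →L[ℂ] ℂ := toFunctional (emb f)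

theorem embF_apply (f g : 𝓢(Rn ι, ℂ)) : embF f g = ∫ x, f x * g x := emb_apply f g

theorem stft_eq_emb (k g : 𝓢(Rn ι, ℂ)) (z : Rn (ι ⊕ ι)) :
    stft k g z = embF g (shift (refl z) k) := (embF_apply _ _).symm

theorem continuous_stft (k g : 𝓢(Rn ι, ℂ)) : Continuous (stft k g) := by
  have h : stft k g = fun z => embF g (shift (refl z) k) := funext (stft_eq_emb k g)
  rw [h]
  exact (embF g).continuous.comp ((continuous_shift k).comp continuous_refl)

/-- The product `s ↦ g(s) k(s - p)`. -/
noncomputable def slicedProd (k g : 𝓢(Rn ι, ℂ)) (p : Rn ι) : 𝓢(Rn ι, ℂ) :=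
  SchwartzMap.pairing (ContinuousLinearMap.mul ℂ ℂ) g (compSubConstCLM ℂ p k)

theorem slicedProd_apply (k g : 𝓢(Rn ι, ℂ)) (p s : Rn ι) :
    slicedProd k g p s = g s * k (s - p) := rfl

theorem stft_eq_fourier (k g : 𝓢(Rn ι, ℂ)) (z : Rn (ι ⊕ ι)) :
    stft k g z = 𝓕 (slicedProd k g (leftPart z)) (rightPart z) := by
  rw [fourier_coe, Real.fourier_eq, stft]
  refine integral_congr_ae (Filter.Eventually.of_forall fun s => ?_)
  simp only [shift_apply, Circle.smul_def, smul_eq_mul, slicedProd_apply, leftPart_refl,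
    rightPart_refl, inner_neg_left, ← cis_eq_fourierChar, real_inner_comm]
  ring

/-- The product `g(s) k(s - p)` decays rapidly in `p`, in every Schwartz seminorm. -/
theorem snorm_slicedProd_le (k g : 𝓢(Rn ι, ℂ)) (p : Rn ι) (M N : ℕ) :
    (1 + ‖p‖) ^ M * snorm N (slicedProd k g p) ≤
      8 ^ (N + M) * snorm (N + M) k * snorm (N + M) g := by
  rw [← le_div_iff₀' (by positivity)]
  refine snorm_le (by positivity) fun a ha l hl s => ?_
  rw [le_div_iff₀' (by positivity)]
  have hk : ∀ i ≤ l, ‖iteratedFDeriv ℝ i (fun s => k (s - p)) s‖ ≤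
      2 ^ (N + M) * snorm (N + M) k / (1 + ‖s - p‖) ^ M := fun i hi => by
    rw [iteratedFDeriv_comp_sub, le_div_iff₀' (by positivity)]
    exact one_add_pow_mul_le_snorm (by omega) (by omega) k (s - p)
  have hg : ∀ i ≤ l, ‖iteratedFDeriv ℝ i g s‖ ≤
      2 ^ (N + M) * snorm (N + M) g / (1 + ‖s‖) ^ (a + M) := fun i hi => by
    rw [le_div_iff₀' (by positivity)]
    exact one_add_pow_mul_le_snorm (by omega) (by omega) g s
  have hks : ContDiff ℝ ∞ fun s => k (s - p) :=
    (k.smooth ⊤).comp (contDiff_id.sub contDiff_const)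
  have h1 := norm_iteratedFDeriv_mul_le_of_le (g.smooth ⊤) hks s (n := l) (by positivity) hg hk
  have hp : 1 + ‖p‖ ≤ (1 + ‖s‖) * (1 + ‖s - p‖) := by
    have : ‖p‖ ≤ ‖s‖ + ‖s - p‖ := by
      have := norm_sub_le s (s - p)
      simpa using this
    nlinarith [mul_nonneg (norm_nonneg s) (norm_nonneg (s - p))]
  have hl2 : (2 : ℝ) ^ l ≤ 2 ^ (N + M) := pow_le_pow_right₀ (by norm_num) (by omega)
  calc _ ≤ ((1 + ‖s‖) * (1 + ‖s - p‖)) ^ M * ((1 + ‖s‖) ^ a *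
        (2 ^ l * (2 ^ (N + M) * snorm (N + M) g / (1 + ‖s‖) ^ (a + M) *
          (2 ^ (N + M) * snorm (N + M) k / (1 + ‖s - p‖) ^ M)))) := by
        refine mul_le_mul (pow_le_pow_left₀ (by positivity) hp _) ?_ (by positivity) (by positivity)
        refine mul_le_mul (pow_le_pow_left₀ (norm_nonneg _) (by linarith) _) h1 (norm_nonneg _)
          (by positivity)
    _ = 2 ^ l * (2 ^ (N + M) * 2 ^ (N + M) * (snorm (N + M) k * snorm (N + M) g)) := by
        rw [mul_pow, pow_add (1 + ‖s‖)]
        field_simp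
    _ ≤ 2 ^ (N + M) * (2 ^ (N + M) * 2 ^ (N + M) * (snorm (N + M) k * snorm (N + M) g)) := by
        gcongr
    _ = 8 ^ (N + M) * snorm (N + M) k * snorm (N + M) g := by
        rw [show (8 : ℝ) = 2 * (2 * 2) by norm_num, mul_pow, mul_pow]
        ring

theorem exists_fourier_decay (N : ℕ) : ∃ (N' : ℕ) (C : ℝ), 0 ≤ C ∧ ∀ (f : 𝓢(Rn ι, ℂ)) q,
    (1 + ‖q‖) ^ N * ‖𝓕 f q‖ ≤ C * snorm N' f := by
  obtain ⟨N', C, hC, h⟩ := exists_map_snorm_le (FourierTransform.fourierCLM ℂ 𝓢(Rn ι, ℂ)) N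
  refine ⟨N', 2 ^ N * C, by positivity, fun f q => ?_⟩
  have h1 := one_add_pow_mul_le_snorm (le_refl N) (Nat.zero_le N) (𝓕 f) q
  rw [norm_iteratedFDeriv_zero] at h1
  have h2 : snorm N (𝓕 f) ≤ C * snorm N' f := h f
  calc _ ≤ _ := h1
    _ ≤ 2 ^ N * (C * snorm N' f) := by gcongr
    _ = _ := by ring

/-- The short-time Fourier transform of a Schwartz function decays rapidly. -/
theorem stft_decay (k : 𝓢(Rn ι, ℂ)) (N : ℕ) : ∃ (N' : ℕ) (C : ℝ), 0 ≤ C ∧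
    ∀ (g : 𝓢(Rn ι, ℂ)) z, (1 + ‖z‖) ^ N * ‖stft k g z‖ ≤ C * snorm N' g := by
  obtain ⟨N', C, hC, h⟩ := exists_fourier_decay (ι := ι) N
  refine ⟨N' + N, C * (8 ^ (N' + N) * snorm (N' + N) k), by positivity, fun g z => ?_⟩
  rw [stft_eq_fourier]
  calc _ ≤ ((1 + ‖leftPart z‖) * (1 + ‖rightPart z‖)) ^ N *
        ‖𝓕 (slicedProd k g (leftPart z)) (rightPart z)‖ := by
        gcongr
        exact one_add_norm_le_mul z
    _ = (1 + ‖leftPart z‖) ^ N * ((1 + ‖rightPart z‖) ^ N *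
        ‖𝓕 (slicedProd k g (leftPart z)) (rightPart z)‖) := by rw [mul_pow]; ring
    _ ≤ (1 + ‖leftPart z‖) ^ N * (C * snorm N' (slicedProd k g (leftPart z))) := by
        exact mul_le_mul_of_nonneg_left (h _ _) (by positivity)
    _ = C * ((1 + ‖leftPart z‖) ^ N * snorm N' (slicedProd k g (leftPart z))) := by ring
    _ ≤ C * (8 ^ (N' + N) * snorm (N' + N) k * snorm (N' + N) g) := by
        exact mul_le_mul_of_nonneg_left (snorm_slicedProd_le k g _ N N') hC
    _ = _ := by ring

theorem snorm_smul_shift_bound (h : 𝓢(Rn ι, ℂ)) (N : ℕ) :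
    ∃ (N' : ℕ) (C : ℝ), 0 ≤ C ∧ ∀ (V : Rn (ι ⊕ ι) → ℂ) (A : ℝ),
      (∀ z, (1 + ‖z‖) ^ N' * ‖V z‖ ≤ A) → ∀ σ : Rn (ι ⊕ ι) → Rn (ι ⊕ ι), (∀ z, ‖σ z‖ ≤ ‖z‖) → ∀ z,
      (1 + ‖z‖) ^ (Fintype.card (ι ⊕ ι) + 1) * snorm N (V z • shift (σ z) h) ≤ C * A := by
  obtain ⟨M, C, hC, hM⟩ := snorm_shift_le (ι := ι) N
  refine ⟨Fintype.card (ι ⊕ ι) + 1 + M, C * snorm M h, by positivity, fun V A hA σ hσ z => ?_⟩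
  rw [map_smul_eq_mul]
  calc _ ≤ (1 + ‖z‖) ^ (Fintype.card (ι ⊕ ι) + 1) * (‖V z‖ *
        (C * (1 + ‖σ z‖) ^ M * snorm M h)) := by gcongr; exact hM h _
    _ ≤ (1 + ‖z‖) ^ (Fintype.card (ι ⊕ ι) + 1) * (‖V z‖ *
        (C * (1 + ‖z‖) ^ M * snorm M h)) := by gcongr; exact hσ z
    _ = C * snorm M h * ((1 + ‖z‖) ^ (Fintype.card (ι ⊕ ι) + 1 + M) * ‖V z‖) := by
        rw [pow_add]; ring
    _ ≤ _ := by gcongr; exact hA z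

/-- The superposition `∫ V(z) shift (σ z) h dz` of phase-space shifts of a Schwartz function, for a
rapidly decaying weight `V`, is a Schwartz function. -/
theorem exists_shift_integral (h : 𝓢(Rn ι, ℂ)) {V : Rn (ι ⊕ ι) → ℂ} (hV : Continuous V)
    (hdec : ∀ N : ℕ, ∃ A, ∀ z, (1 + ‖z‖) ^ N * ‖V z‖ ≤ A)
    {σ : Rn (ι ⊕ ι) → Rn (ι ⊕ ι)} (hσc : Continuous σ) (hσ : ∀ z, ‖σ z‖ ≤ ‖z‖) :
    ∃ g : 𝓢(Rn ι, ℂ), (∀ t, g t = ∫ z, V z * shift (σ z) h t) ∧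
      (∀ u : 𝓢(Rn ι, ℂ) →L[ℂ] ℂ, u g = ∫ z, V z * u (shift (σ z) h)) ∧
      ∀ N, snorm N g ≤ ∫ z, snorm N (V z • shift (σ z) h) := by
  have hc : Continuous fun z => V z • shift (σ z) h := hV.smul ((continuous_shift h).comp hσc)
  obtain ⟨g, h1, h2, h3⟩ := exists_schwartz_integral (μ := volume) hc fun N => by
    obtain ⟨N', C, hC, hb⟩ := snorm_smul_shift_bound h N
    obtain ⟨A, hA⟩ := hdec N'
    refine integrable_of_weighted ((continuous_snorm N).comp hc).aestronglyMeasurable (A := C * A)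
      fun z => ?_
    rw [Real.norm_of_nonneg (apply_nonneg _ _)]
    exact hb V A hA σ hσ z
  refine ⟨g, fun t => h1 t, fun u => ?_, h3⟩
  rw [h2]
  simp only [map_smul, smul_eq_mul]

theorem integrable_stft_mul_shift (k h g : 𝓢(Rn ι, ℂ)) (t : Rn ι) :
    Integrable fun z => stft k g z * shift z h t := by
  obtain ⟨N', C, -, hd⟩ := stft_decay k (Fintype.card (ι ⊕ ι) + 1)
  have hc : Continuous fun z => shift z h t :=
    (toFunctional (TemperedDistribution.delta t)).continuous.comp (continuous_shift h)
  refine integrable_of_weighted ((continuous_stft k g).mul hc).aestronglyMeasurable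
    (A := C * snorm N' g * snorm 0 h) fun z => ?_
  have h1 : ‖shift z h t‖ ≤ snorm 0 h := by
    rw [shift_apply, norm_mul, norm_cis, one_mul]
    simpa using pow_mul_le_snorm (le_refl 0) (le_refl 0) h (t - leftPart z)
  rw [norm_mul, ← mul_assoc]
  exact mul_le_mul (hd g z) h1 (norm_nonneg _) ((by positivity : (0 : ℝ) ≤ _).trans (hd g z))

/-- The inversion formula for the short-time Fourier transform. -/
theorem stft_inversion (k h g : 𝓢(Rn ι, ℂ)) (t : Rn ι) :
    ∫ z, stft k g z * shift z h t = (∫ x, h x * k x) * g t := by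
  rw [integral_join (integrable_stft_mul_shift k h g t)]
  -- for fixed `p`, Fourier inversion applied to `s ↦ g(s) k(s - p)`
  have h1 : ∀ p : Rn ι, ∫ q : Rn ι, stft k g (join p q) * shift (join p q) h t =
      g t * (h (t - p) * k (t - p)) := by
    intro p
    have e1 : 𝓕⁻ (𝓕 (slicedProd k g p)) t = slicedProd k g p t := by
      rw [FourierTransform.fourierInv_fourier_eq]
    rw [fourierInv_coe, Real.fourierInv_eq] at e1
    rw [slicedProd_apply] at e1
    calc _ = ∫ q : Rn ι, (Real.fourierChar ⟪q, t⟫ • 𝓕 (slicedProd k g p) q) * h (t - p) := by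
          refine integral_congr_ae (Filter.Eventually.of_forall fun q => ?_)
          simp only [stft_eq_fourier, shift_apply, leftPart_join, rightPart_join, Circle.smul_def,
            smul_eq_mul, cis_eq_fourierChar]
          ring
      _ = g t * k (t - p) * h (t - p) := by rw [integral_mul_const, e1]
      _ = _ := by ring
  simp only [h1]
  rw [integral_const_mul, mul_comm]
  congr 1
  exact integral_sub_left_eq_self (fun x => h x * k x) volume t

/-- The inversion formula holds weakly: a functional is recovered from its values on the phase-space
shifts of a single window. -/
theorem functional_eq_integral (k h g : 𝓢(Rn ι, ℂ)) (u : 𝓢(Rn ι, ℂ) →L[ℂ] ℂ) :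
    ∫ z, stft k g z * u (shift z h) = (∫ x, h x * k x) * u g := by
  obtain ⟨g', h1, h2, -⟩ := exists_shift_integral h (continuous_stft k g)
    (fun N => by
      obtain ⟨N', C, -, hd⟩ := stft_decay k N
      exact ⟨_, hd g⟩) continuous_id (fun z => le_rfl)
  have : g' = (∫ x, h x * k x) • g := by
    ext t
    rw [h1]
    exact stft_inversion k h g t
  rw [← smul_eq_mul, ← map_smul, ← this, h2]
  rfl

/-- Schwartz functions are determined by their pairings with Schwartz functions. -/
theorem emb_injective {f g : 𝓢(Rn ι, ℂ)} (h : ∀ φ : 𝓢(Rn ι, ℂ), ∫ x, φ x * f x = ∫ x, φ x * g x) :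
    f = g := by
  have h0 : ∀ φ : 𝓢(Rn ι, ℂ), ∫ x, φ x * (f - g) x = 0 := fun φ => by
    rw [← embF_apply, map_sub, embF_apply, embF_apply, h φ, sub_self]
  rw [← sub_eq_zero]
  set d := f - g
  have h1 : ∫ x, ‖d x‖ ^ 2 = 0 := by
    have h2 := h0 (conjSchwartz d)
    have h3 : ∀ x, conjSchwartz d x * d x = ((‖d x‖ ^ 2 : ℝ) : ℂ) := fun x => by
      rw [conjSchwartz_apply, mul_comm, Complex.mul_conj, Complex.normSq_eq_norm_sq]
    simp only [h3] at h2
    rw [integral_complex_ofReal] at h2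
    exact_mod_cast h2
  have hint : Integrable fun x => ‖d x‖ ^ 2 := by
    have := (d.memLp 2 (volume : Measure (Rn ι))).integrable_norm_pow (by norm_num)
    simpa using this
  have h2 := (integral_eq_zero_iff_of_nonneg (fun x => by positivity) hint).1 h1
  have hcont : Continuous fun x => ‖d x‖ ^ 2 := by fun_prop
  have h3 := (hcont.ae_eq_iff_eq volume continuous_const).1 h2
  ext x
  have h4 : ‖d x‖ ^ 2 = 0 := congrFun h3 x
  simpa using h4

theorem exists_schwartz_ne_zero (ι : Type) [Fintype ι] : ∃ f : 𝓢(Rn ι, ℂ), f 0 ≠ 0 := by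
  let b : ContDiffBump (0 : Rn ι) := ⟨1, 2, one_pos, one_lt_two⟩
  have h1 : HasCompactSupport fun x => ((b x : ℝ) : ℂ) :=
    b.hasCompactSupport.comp_left (g := fun r : ℝ => (r : ℂ)) Complex.ofReal_zero
  refine ⟨h1.toSchwartzMap (Complex.ofRealCLM.contDiff.comp b.contDiff), ?_⟩
  change ((b 0 : ℝ) : ℂ) ≠ 0
  rw [b.one_of_mem_closedBall (Metric.mem_closedBall_self zero_le_one)]
  simp

/-- Every window `h ≠ 0` has a dual window `k`, normalizing the inversion formula. -/
theorem exists_dual_window {h : 𝓢(Rn ι, ℂ)} (hh : h ≠ 0) : ∃ k : 𝓢(Rn ι, ℂ), ∫ x, h x * k x = 1 := by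
  by_contra hcon
  push Not at hcon
  refine hh (emb_injective fun φ => ?_)
  simp only [zero_apply, mul_zero, integral_zero]
  by_contra h1
  refine hcon ((∫ x, φ x * h x)⁻¹ • φ) ?_
  calc _ = ∫ x, (∫ x, φ x * h x)⁻¹ * (φ x * h x) := by
        refine integral_congr_ae (Filter.Eventually.of_forall fun x => ?_)
        simp only [smul_apply, smul_eq_mul]
        ring
    _ = 1 := by rw [integral_const_mul, inv_mul_cancel₀ h1]

/-- A tempered distribution whose short-time Fourier transform decays rapidly is a Schwartz
function. -/
theorem exists_schwartz_of_decay {k h : 𝓢(Rn ι, ℂ)} (hk : ∫ x, h x * k x = 1)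
    (u : 𝓢(Rn ι, ℂ) →L[ℂ] ℂ)
    (hdec : ∀ N : ℕ, ∃ A, ∀ z, (1 + ‖z‖) ^ N * ‖u (shift z h)‖ ≤ A) :
    ∃ F : 𝓢(Rn ι, ℂ), (∀ g, u g = ∫ x, g x * F x) ∧
      ∀ N, snorm N F ≤ ∫ z, snorm N (u (shift z h) • shift (refl z) k) := by
  obtain ⟨F, -, h2, h3⟩ := exists_shift_integral k (V := fun z => u (shift z h))
    (u.continuous.comp (continuous_shift h)) hdec continuous_refl (fun z => (norm_refl z).le)
  refine ⟨F, fun g => ?_, h3⟩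
  have h4 := functional_eq_integral k h g u
  rw [hk, one_mul] at h4
  have h5 := h2 (embF g)
  rw [embF_apply] at h5
  rw [h5, ← h4]
  refine integral_congr_ae (Filter.Eventually.of_forall fun z => ?_)
  simp only [stft_eq_emb]
  ring

/-- The seminorms of a Schwartz function are controlled by weighted suprema of its pairings with
phase-space shifts of a window. -/
theorem snorm_le_of_decay {k h : 𝓢(Rn ι, ℂ)} (hk : ∫ x, h x * k x = 1) (N : ℕ) :
    ∃ (N' : ℕ) (C : ℝ), 0 ≤ C ∧ ∀ (F : 𝓢(Rn ι, ℂ)) (A : ℝ),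
      (∀ z, (1 + ‖z‖) ^ N' * ‖∫ x, shift z h x * F x‖ ≤ A) → snorm N F ≤ C * A := by
  obtain ⟨N', C, hC, hb⟩ := snorm_smul_shift_bound k N
  refine ⟨N', decayConst (ι ⊕ ι) * C, mul_nonneg decayConst_nonneg hC, fun F A hA => ?_⟩
  have e1 : ∀ z, ∫ x, shift z h x * F x = embF F (shift z h) := fun z => by
    rw [embF_apply]; simp only [mul_comm]
  have hdec : ∀ M : ℕ, ∃ A, ∀ z, (1 + ‖z‖) ^ M * ‖embF F (shift z h)‖ ≤ A := fun M => by
    obtain ⟨M', B, -, hB⟩ := stft_decay h M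
    refine ⟨B * snorm M' F, fun z => ?_⟩
    have := hB F (refl z)
    rw [norm_refl, stft_eq_emb] at this
    simpa [refl] using this
  obtain ⟨F', h1, h2⟩ := exists_schwartz_of_decay hk (embF F) hdec
  have hF : F' = F := emb_injective fun φ => by
    rw [← h1, embF_apply]
    simp only [mul_comm]
  rw [← hF]
  refine (h2 N).trans ?_
  have h3 := integral_norm_le_of_weighted (ι := ι ⊕ ι)
    (f := fun z => snorm N (embF F (shift z h) • shift (refl z) k)) (A := C * A) fun z => by
      rw [Real.norm_of_nonneg (apply_nonneg _ _)]
      exact hb (fun z => embF F (shift z h)) A (fun z => by rw [← e1]; exact hA z) refl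
        (fun z => (norm_refl z).le) z
  simp only [Real.norm_of_nonneg (apply_nonneg (snorm N) _)] at h3
  rw [mul_assoc]
  exact h3

end STFT

/-! ### The partial Fourier transform -/

section PartialFourier

theorem continuous_join_right (x : Rn ι) : Continuous fun y : Rn κ => join x y :=
  continuous_join.comp (by fun_prop : Continuous fun y : Rn κ => (x, y))

theorem norm_le_norm_join_right (x : Rn ι) (y : Rn κ) : ‖y‖ ≤ ‖join x y‖ := by
  simpa using norm_rightPart_le (join x y)

theorem slice_decay (Φ : 𝓢(Rn (ι ⊕ κ), ℂ)) (x : Rn ι) (N : ℕ) (y : Rn κ) :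
    (1 + ‖y‖) ^ N * ‖Φ (join x y)‖ ≤ 2 ^ N * snorm N Φ := by
  have h := one_add_pow_mul_le_snorm (le_refl N) (Nat.zero_le N) Φ (join x y)
  rw [norm_iteratedFDeriv_zero] at h
  refine le_trans ?_ h
  gcongr
  exact norm_le_norm_join_right x y

theorem integrable_slice (Φ : 𝓢(Rn (ι ⊕ κ), ℂ)) (x : Rn ι) : Integrable fun y => Φ (join x y) :=
  integrable_of_weighted (Φ.continuous.comp (continuous_join_right x)).aestronglyMeasurable
    (slice_decay Φ x _)

/-- The functional `Φ ↦ ∫ e^{-2πi y·η} Φ(x, y) dy`. -/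
noncomputable def partialFourierAt (x : Rn ι) (η : Rn κ) : 𝓢(Rn (ι ⊕ κ), ℂ) →L[ℂ] ℂ :=
  have hint : ∀ Φ : 𝓢(Rn (ι ⊕ κ), ℂ), Integrable fun y => cis (-⟪y, η⟫) * Φ (join x y) := fun Φ =>
    (integrable_slice Φ x).bdd_mul (c := 1)
      (continuous_cis.comp (by fun_prop : Continuous fun y : Rn κ => -⟪y, η⟫)).aestronglyMeasurable
      (Filter.Eventually.of_forall fun y => (norm_cis _).le)
  let T : 𝓢(Rn (ι ⊕ κ), ℂ) →ₗ[ℂ] ℂ :=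
    { toFun := fun Φ => ∫ y : Rn κ, cis (-⟪y, η⟫) * Φ (join x y)
      map_add' := fun Φ Ψ => by
        rw [← integral_add (hint Φ) (hint Ψ)]
        simp only [add_apply, mul_add]
      map_smul' := fun c Φ => by
        rw [RingHom.id_apply, smul_eq_mul, ← integral_const_mul]
        simp only [smul_apply, smul_eq_mul]
        refine integral_congr_ae (Filter.Eventually.of_forall fun y => ?_)
        ring_nf }
  ⟨T, continuous_functional_of_snorm_le T ⟨Fintype.card κ + 1,
    decayConst κ * 2 ^ (Fintype.card κ + 1), mul_nonneg decayConst_nonneg (by positivity),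
    fun Φ => by
      refine (norm_integral_le_integral_norm _).trans ?_
      simp only [norm_mul, norm_cis, one_mul]
      rw [mul_assoc]
      exact integral_norm_le_of_weighted (slice_decay Φ x _)⟩⟩

theorem partialFourierAt_apply (x : Rn ι) (η : Rn κ) (Φ : 𝓢(Rn (ι ⊕ κ), ℂ)) :
    partialFourierAt x η Φ = ∫ y : Rn κ, cis (-⟪y, η⟫) * Φ (join x y) := rfl

theorem fourier_eq_cis (f : 𝓢(Rn κ, ℂ)) (η : Rn κ) : 𝓕 f η = ∫ y, cis (-⟪y, η⟫) * f y := by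
  rw [fourier_coe, Real.fourier_eq]
  simp only [Circle.smul_def, smul_eq_mul, cis_eq_fourierChar]

/-- The symplectic map induced on phase space by the partial Fourier transform. -/
noncomputable def partialRot (z : Rn ((ι ⊕ κ) ⊕ (ι ⊕ κ))) : Rn ((ι ⊕ κ) ⊕ (ι ⊕ κ)) :=
  join (join (leftPart (leftPart z)) (rightPart (rightPart z)))
    (join (leftPart (rightPart z)) (-rightPart (leftPart z)))

theorem norm_partialRot (z : Rn ((ι ⊕ κ) ⊕ (ι ⊕ κ))) : ‖partialRot z‖ = ‖z‖ := by
  refine (sq_eq_sq₀ (norm_nonneg _) (norm_nonneg _)).1 ?_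
  have h : ‖z‖ ^ 2 = ‖leftPart z‖ ^ 2 + ‖rightPart z‖ ^ 2 := by
    rw [← norm_join_sq, join_left_right]
  have h1 : ‖leftPart z‖ ^ 2 = ‖leftPart (leftPart z)‖ ^ 2 + ‖rightPart (leftPart z)‖ ^ 2 := by
    rw [← norm_join_sq, join_left_right]
  have h2 : ‖rightPart z‖ ^ 2 = ‖leftPart (rightPart z)‖ ^ 2 + ‖rightPart (rightPart z)‖ ^ 2 := by
    rw [← norm_join_sq, join_left_right]
  rw [partialRot, norm_join_sq, norm_join_sq, norm_join_sq, norm_neg, h, h1, h2]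
  ring

theorem continuous_leftPart : Continuous (leftPart : Rn (ι ⊕ κ) → Rn ι) := leftCLM.continuous

theorem continuous_rightPart : Continuous (rightPart : Rn (ι ⊕ κ) → Rn κ) := rightCLM.continuous

theorem continuous_join_comp {X : Type*} [TopologicalSpace X] {f : X → Rn ι} {g : X → Rn κ}
    (hf : Continuous f) (hg : Continuous g) : Continuous fun x => join (f x) (g x) :=
  continuous_join.comp (hf.prodMk hg)

theorem continuous_partialRot :
    Continuous (partialRot : Rn ((ι ⊕ κ) ⊕ (ι ⊕ κ)) → Rn ((ι ⊕ κ) ⊕ (ι ⊕ κ))) :=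
  continuous_join_comp
    (continuous_join_comp (continuous_leftPart.comp continuous_leftPart)
      (continuous_rightPart.comp continuous_rightPart))
    (continuous_join_comp (continuous_leftPart.comp continuous_rightPart)
      (continuous_rightPart.comp continuous_leftPart).neg)

/-- On a shifted tensor window the partial Fourier transform acts, up to a phase, by rotating the
shift and transforming the second factor of the window. -/
theorem partialFourierAt_shift (z : Rn ((ι ⊕ κ) ⊕ (ι ⊕ κ))) (h₁ : 𝓢(Rn ι, ℂ)) (h₂ : 𝓢(Rn κ, ℂ))
    (w : Rn (ι ⊕ κ)) :
    partialFourierAt (leftPart w) (rightPart w) (shift z (stensor h₁ h₂)) =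
      cis ⟪rightPart (leftPart z), rightPart (rightPart z)⟫ *
        shift (partialRot z) (stensor h₁ (𝓕 h₂)) w := by
  set x := leftPart w
  set η := rightPart w
  set p₁ := leftPart (leftPart z) with hp₁
  set p₂ := rightPart (leftPart z) with hp₂
  set q₁ := leftPart (rightPart z) with hq₁
  set q₂ := rightPart (rightPart z) with hq₂
  have hsub : ∀ (u v : Rn (ι ⊕ κ)), leftPart (u - v) = leftPart u - leftPart v ∧
      rightPart (u - v) = rightPart u - rightPart v := fun u v => ⟨rfl, rfl⟩
  have hL : ∀ y : Rn κ, shift z (stensor h₁ h₂) (join x y) =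
      cis (⟪q₁, x⟫ + ⟪q₂, y⟫) * (h₁ (x - p₁) * h₂ (y - p₂)) := fun y => by
    rw [shift_apply, stensor_apply, (hsub _ _).1, (hsub _ _).2]
    congr 2
    rw [← inner_join, hq₁, hq₂, join_left_right]
  have hR : shift (partialRot z) (stensor h₁ (𝓕 h₂)) w =
      cis (⟪q₁, x⟫ - ⟪p₂, η⟫) * (h₁ (x - p₁) * 𝓕 h₂ (η - q₂)) := by
    rw [shift_apply, stensor_apply, (hsub _ _).1, (hsub _ _).2]
    congr 2
    have : w = join x η := (join_left_right w).symm
    rw [this, partialRot, rightPart_join, inner_join, inner_neg_left, sub_eq_add_neg]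
  rw [partialFourierAt_apply, hR, fourier_eq_cis]
  have h1 : ∀ y : Rn κ, cis (-⟪y, η⟫) * shift z (stensor h₁ h₂) (join x y) =
      (fun y => (cis (⟪q₁, x⟫ + ⟪p₂, q₂⟫ - ⟪p₂, η⟫) * h₁ (x - p₁)) *
        (cis (-⟪y, η - q₂⟫) * h₂ y)) (y - p₂) := fun y => by
    rw [hL]
    simp only
    have e : -⟪y, η⟫ + (⟪q₁, x⟫ + ⟪q₂, y⟫) =
        (⟪q₁, x⟫ + ⟪p₂, q₂⟫ - ⟪p₂, η⟫) + -⟪y - p₂, η - q₂⟫ := by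
      simp only [inner_sub_left, inner_sub_right, real_inner_comm y q₂]
      ring
    calc _ = cis (-⟪y, η⟫ + (⟪q₁, x⟫ + ⟪q₂, y⟫)) * (h₁ (x - p₁) * h₂ (y - p₂)) := by
          rw [cis_add (-⟪y, η⟫)]; ring
      _ = _ := by rw [e, cis_add]; ring
  simp only [h1]
  rw [integral_sub_right_eq_self (fun y => (cis (⟪q₁, x⟫ + ⟪p₂, q₂⟫ - ⟪p₂, η⟫) * h₁ (x - p₁)) *
        (cis (-⟪y, η - q₂⟫) * h₂ y)) p₂, integral_const_mul]
  rw [show ⟪q₁, x⟫ + ⟪p₂, q₂⟫ - ⟪p₂, η⟫ = ⟪p₂, q₂⟫ + (⟪q₁, x⟫ - ⟪p₂, η⟫) by ring, cis_add]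
  ring

theorem exists_tensor_window (ι κ : Type) [Fintype ι] [Fintype κ] :
    ∃ (h₁ : 𝓢(Rn ι, ℂ)) (h₂ : 𝓢(Rn κ, ℂ)) (K : 𝓢(Rn (ι ⊕ κ), ℂ)),
      ∫ z, stensor h₁ h₂ z * K z = 1 := by
  obtain ⟨h₁, hh₁⟩ := exists_schwartz_ne_zero ι
  obtain ⟨h₂, hh₂⟩ := exists_schwartz_ne_zero κ
  obtain ⟨K, hK⟩ := exists_dual_window (h := stensor h₁ h₂) (fun h0 => by
    have := DFunLike.congr_fun h0 0
    have h1 : stensor h₁ h₂ 0 = h₁ 0 * h₂ 0 := rfl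
    rw [h1] at this
    exact mul_ne_zero hh₁ hh₂ this)
  exact ⟨h₁, h₂, K, hK⟩

/-- The partial Fourier transform preserves the Schwartz space: expanding `Φ` into phase-space
shifts of a tensor window, it acts on each of them by a rotation of phase space. -/
theorem exists_partialFourier : ∃ P : 𝓢(Rn (ι ⊕ κ), ℂ) →L[ℂ] 𝓢(Rn (ι ⊕ κ), ℂ),
    ∀ Φ w, P Φ w = partialFourierAt (leftPart w) (rightPart w) Φ := by
  obtain ⟨h₁, h₂, K, hK⟩ := exists_tensor_window ι κ
  let c : Rn ((ι ⊕ κ) ⊕ (ι ⊕ κ)) → ℂ := fun z =>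
    cis ⟪rightPart (leftPart z), rightPart (rightPart z)⟫
  have hc : Continuous c := continuous_cis.comp
    ((continuous_rightPart.comp continuous_leftPart).inner
      (continuous_rightPart.comp continuous_rightPart))
  have hdec : ∀ N : ℕ, ∃ (N' : ℕ) (C : ℝ), 0 ≤ C ∧ ∀ (Φ : 𝓢(Rn (ι ⊕ κ), ℂ)) z,
      (1 + ‖z‖) ^ N * ‖stft K Φ z * c z‖ ≤ C * snorm N' Φ := fun N => by
    obtain ⟨N', C, hC, h⟩ := stft_decay K N
    refine ⟨N', C, hC, fun Φ z => ?_⟩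
    rw [norm_mul, norm_cis, mul_one]
    exact h Φ z
  have hex : ∀ Φ : 𝓢(Rn (ι ⊕ κ), ℂ), ∃ Ψ : 𝓢(Rn (ι ⊕ κ), ℂ),
      (∀ w, Ψ w = partialFourierAt (leftPart w) (rightPart w) Φ) ∧
      ∀ N, snorm N Ψ ≤ ∫ z, snorm N ((stft K Φ z * c z) •
        shift (partialRot z) (stensor h₁ (𝓕 h₂))) := fun Φ => by
    obtain ⟨Ψ, h1, -, h3⟩ := exists_shift_integral (stensor h₁ (𝓕 h₂))
      (V := fun z => stft K Φ z * c z) ((continuous_stft K Φ).mul hc) (fun N => by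
        obtain ⟨N', C, -, h⟩ := hdec N
        exact ⟨_, h Φ⟩) continuous_partialRot (fun z => (norm_partialRot z).le)
    refine ⟨Ψ, fun w => ?_, h3⟩
    have h4 := functional_eq_integral K (stensor h₁ h₂) Φ
      (partialFourierAt (leftPart w) (rightPart w))
    rw [hK, one_mul] at h4
    rw [h1, ← h4]
    refine integral_congr_ae (Filter.Eventually.of_forall fun z => ?_)
    simp only [partialFourierAt_shift, c]
    ring
  choose P hP hPb using hex
  let T : 𝓢(Rn (ι ⊕ κ), ℂ) →ₗ[ℂ] 𝓢(Rn (ι ⊕ κ), ℂ) :=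
    { toFun := P
      map_add' := fun Φ Ψ => by ext w; simp only [hP, map_add, add_apply]
      map_smul' := fun a Φ => by
        ext w; simp only [hP, map_smul, smul_apply, RingHom.id_apply] }
  refine ⟨⟨T, continuous_of_snorm_le T fun N => ?_⟩, hP⟩
  obtain ⟨N₁, C₁, hC₁, h₁'⟩ := snorm_smul_shift_bound (stensor h₁ (𝓕 h₂)) N
  obtain ⟨N₂, C₂, hC₂, h₂'⟩ := hdec N₁
  refine ⟨N₂, decayConst ((ι ⊕ κ) ⊕ (ι ⊕ κ)) * (C₁ * C₂),
    mul_nonneg decayConst_nonneg (by positivity), fun Φ => (hPb Φ N).trans ?_⟩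
  have h5 := integral_norm_le_of_weighted (ι := (ι ⊕ κ) ⊕ (ι ⊕ κ))
    (f := fun z => snorm N ((stft K Φ z * c z) • shift (partialRot z) (stensor h₁ (𝓕 h₂))))
    (A := C₁ * (C₂ * snorm N₂ Φ)) fun z => by
      rw [Real.norm_of_nonneg (apply_nonneg _ _)]
      exact h₁' (fun z => stft K Φ z * c z) _ (h₂' Φ) partialRot
        (fun z => (norm_partialRot z).le) z
  simp only [Real.norm_of_nonneg (apply_nonneg (snorm N) _)] at h5
  refine h5.trans (le_of_eq (by ring))

/-- The Fourier transform in the second variable. -/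
noncomputable def partialFourier : 𝓢(Rn (ι ⊕ κ), ℂ) →L[ℂ] 𝓢(Rn (ι ⊕ κ), ℂ) :=
  exists_partialFourier.choose

theorem partialFourier_apply (Φ : 𝓢(Rn (ι ⊕ κ), ℂ)) (x : Rn ι) (η : Rn κ) :
    partialFourier Φ (join x η) = ∫ y : Rn κ, cis (-⟪y, η⟫) * Φ (join x y) :=
  exists_partialFourier.choose_spec Φ (join x η)

end PartialFourier

/-! ### The cross-Wigner transform on the Schwartz space -/

section Wigner

/-- The map `(x, y) ↦ (x + y/2, x - y/2)`. -/
noncomputable def midL : Rn (ι ⊕ ι) ≃L[ℝ] Rn (ι ⊕ ι) :=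
  LinearEquiv.toContinuousLinearEquiv
    { toFun := fun z => join (leftPart z + (1 / 2 : ℝ) • rightPart z)
        (leftPart z - (1 / 2 : ℝ) • rightPart z)
      invFun := fun z => join ((1 / 2 : ℝ) • (leftPart z + rightPart z)) (leftPart z - rightPart z)
      map_add' := fun z w => by
        ext i; cases i <;> (simp [join, leftPart, rightPart]; ring)
      map_smul' := fun c z => by
        ext i; cases i <;> (simp [join, leftPart, rightPart]; ring)
      left_inv := fun z => by
        ext i; cases i <;> (simp [join, leftPart, rightPart]; ring)
      right_inv := fun z => by
        ext i; cases i <;> (simp [join, leftPart, rightPart]; ring) }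

theorem midL_join (x y : Rn ι) :
    midL (join x y) = join (x + (1 / 2 : ℝ) • y) (x - (1 / 2 : ℝ) • y) := rfl

/-- The map `(x, ξ) ↦ (x, ξ / 2π)`. -/
noncomputable def scaleL : Rn (ι ⊕ ι) ≃L[ℝ] Rn (ι ⊕ ι) :=
  LinearEquiv.toContinuousLinearEquiv
    { toFun := fun z => join (leftPart z) ((2 * Real.pi)⁻¹ • rightPart z)
      invFun := fun z => join (leftPart z) ((2 * Real.pi) • rightPart z)
      map_add' := fun z w => by
        ext i; cases i <;> simp [join, leftPart, rightPart]; ring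
      map_smul' := fun c z => by
        ext i; cases i <;> simp [join, leftPart, rightPart]; ring
      left_inv := fun z => by
        ext i; cases i <;> simp [join, leftPart, rightPart]; field_simp
      right_inv := fun z => by
        ext i; cases i <;> simp [join, leftPart, rightPart]; field_simp }

theorem scaleL_apply (z : Rn (ι ⊕ ι)) :
    scaleL z = join (leftPart z) ((2 * Real.pi)⁻¹ • rightPart z) := rfl

/-- The Wigner transform of a Schwartz function `F` on `ℝⁿ × ℝⁿ`,
`(x, ξ) ↦ (2π)^{-n} ∫ e^{-i ξ·y} F(x + y/2, x - y/2) dy`. -/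
noncomputable def wignerCLM : 𝓢(Rn (ι ⊕ ι), ℂ) →L[ℂ] 𝓢(Rn (ι ⊕ ι), ℂ) :=
  (((2 * Real.pi : ℝ) : ℂ)⁻¹ ^ Fintype.card ι) •
    ((compCLMOfContinuousLinearEquiv ℂ scaleL) ∘L partialFourier ∘L
      (compCLMOfContinuousLinearEquiv ℂ midL))

/-- The bilinear cross-Wigner transform of Schwartz functions, `W(f, conj g)`. -/
noncomputable def cw (f g : 𝓢(Rn ι, ℂ)) : 𝓢(Rn (ι ⊕ ι), ℂ) := wignerCLM (stensor f g)

theorem cis_two_pi_inv_mul (s : ℝ) : cis ((2 * Real.pi)⁻¹ * s) = Complex.exp (s * Complex.I) := by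
  rw [cis, ← mul_assoc, mul_inv_cancel₀ (by positivity), one_mul]

theorem wignerCLM_apply (F : 𝓢(Rn (ι ⊕ ι), ℂ)) (z : Rn (ι ⊕ ι)) :
    wignerCLM F z = ((2 * Real.pi : ℝ) : ℂ)⁻¹ ^ Fintype.card ι *
      ∫ y : Rn ι, Complex.exp ((-⟪rightPart z, y⟫ : ℝ) * Complex.I) *
        F (join (leftPart z + (1 / 2 : ℝ) • y) (leftPart z - (1 / 2 : ℝ) • y)) := by
  rw [wignerCLM]
  change (((2 * Real.pi : ℝ) : ℂ)⁻¹ ^ Fintype.card ι) •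
    partialFourier (compCLMOfContinuousLinearEquiv ℂ midL F) (scaleL z) = _
  rw [smul_eq_mul, scaleL_apply, partialFourier_apply]
  congr 1
  refine integral_congr_ae (Filter.Eventually.of_forall fun y => ?_)
  simp only
  rw [inner_smul_right, ← mul_neg, cis_two_pi_inv_mul, real_inner_comm]
  rfl

theorem cw_apply (f g : 𝓢(Rn ι, ℂ)) (z : Rn (ι ⊕ ι)) :
    cw f g z = ((2 * Real.pi : ℝ) : ℂ)⁻¹ ^ Fintype.card ι *
      ∫ y : Rn ι, Complex.exp ((-⟪rightPart z, y⟫ : ℝ) * Complex.I) *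
        (f (leftPart z + (1 / 2 : ℝ) • y) * g (leftPart z - (1 / 2 : ℝ) • y)) :=
  wignerCLM_apply (stensor f g) z

theorem cw_eq_crossWigner (f g : 𝓢(Rn ι, ℂ)) (z : Rn (ι ⊕ ι)) :
    cw f g z = crossWigner f (fun x => conj (g x)) z := by
  rw [cw_apply, crossWigner]
  congr 1
  refine integral_congr_ae (Filter.Eventually.of_forall fun y => ?_)
  simp only [Complex.conj_conj, mul_assoc]
  congr 2
  push_cast
  ring

/-- Covariance of the Wigner transform under a phase-space shift of its first argument. -/
theorem cw_shift_left (z : Rn (ι ⊕ ι)) (h g : 𝓢(Rn ι, ℂ)) (w : Rn (ι ⊕ ι)) :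
    cw (shift z h) g w =
      cis (⟪rightPart z, leftPart w⟫ + (1 / 2) * ⟪rightPart z, leftPart z⟫ -
        (2 * Real.pi)⁻¹ * ⟪rightPart w, leftPart z⟫) *
      cw h g (w - join ((1 / 2 : ℝ) • leftPart z) (Real.pi • rightPart z)) := by
  rw [cw_apply, cw_apply]
  set p := leftPart z
  set q := rightPart z
  set x := leftPart w
  set ξ := rightPart w
  have e1 : leftPart (w - join ((1 / 2 : ℝ) • p) (Real.pi • q)) = x - (1 / 2 : ℝ) • p := rfl
  have e2 : rightPart (w - join ((1 / 2 : ℝ) • p) (Real.pi • q)) = ξ - Real.pi • q := rfl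
  rw [e1, e2, mul_left_comm]
  congr 1
  rw [← integral_const_mul]
  conv_rhs => rw [← integral_sub_right_eq_self _ p]
  refine integral_congr_ae (Filter.Eventually.of_forall fun y => ?_)
  simp only [shift_apply]
  change _ * (cis ⟪q, x + (1 / 2 : ℝ) • y⟫ * h (x + (1 / 2 : ℝ) • y - p) * _) = _
  have a1 : x - (1 / 2 : ℝ) • p + (1 / 2 : ℝ) • (y - p) = x + (1 / 2 : ℝ) • y - p := by module
  have a2 : x - (1 / 2 : ℝ) • p - (1 / 2 : ℝ) • (y - p) = x - (1 / 2 : ℝ) • y := by module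
  rw [a1, a2, ← cis_two_pi_inv_mul, ← cis_two_pi_inv_mul]
  have a3 : (2 * Real.pi)⁻¹ * -⟪ξ, y⟫ + ⟪q, x + (1 / 2 : ℝ) • y⟫ =
      (⟪q, x⟫ + 1 / 2 * ⟪q, p⟫ - (2 * Real.pi)⁻¹ * ⟪ξ, p⟫) +
        (2 * Real.pi)⁻¹ * -⟪ξ - Real.pi • q, y - p⟫ := by
    simp only [inner_sub_left, inner_sub_right, inner_add_right, inner_smul_left, inner_smul_right,
      conj_trivial]
    field_simp
    ring
  calc _ = cis ((2 * Real.pi)⁻¹ * -⟪ξ, y⟫ + ⟪q, x + (1 / 2 : ℝ) • y⟫) *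
        (h (x + (1 / 2 : ℝ) • y - p) * g (x - (1 / 2 : ℝ) • y)) := by rw [cis_add]; ring
    _ = _ := by rw [a3, cis_add]; ring

end Wigner

/-! ### The transpose of a Weyl operator -/

section Symbols

variable {E : Type*} [NormedAddCommGroup E] [NormedSpace ℝ E]

/-- Smooth functions all of whose derivatives are `O((1 + |z|)^M)`. That `M` is the same for all
orders is essential in `weyl_decay`, where the number of derivatives used depends on `M`. -/
structure IsSymbol (M : ℕ) (a : E → ℂ) : Prop where
  smooth : ContDiff ℝ ∞ a
  bound : ∀ j : ℕ, ∃ C, ∀ z, ‖iteratedFDeriv ℝ j a z‖ ≤ C * (1 + ‖z‖) ^ M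

theorem IsSymbol.hasTemperateGrowth {M : ℕ} {a : E → ℂ} (ha : IsSymbol M a) :
    Function.HasTemperateGrowth a :=
  ⟨ha.smooth, fun j => ⟨M, ha.bound j⟩⟩

theorem IsSymbol.exists_uniform_bound {M : ℕ} {a : E → ℂ} (ha : IsSymbol M a) (L : ℕ) :
    ∃ K, ∀ j ≤ L, ∀ z, ‖iteratedFDeriv ℝ j a z‖ ≤ K * (1 + ‖z‖) ^ M := by
  choose C hC using ha.bound
  refine ⟨∑ j ∈ Finset.range (L + 1), |C j|, fun j hj z => (hC j z).trans ?_⟩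
  gcongr
  exact (le_abs_self _).trans (Finset.single_le_sum (f := fun j => |C j|)
    (fun i _ => abs_nonneg _) (Finset.mem_range.2 (by omega)))

theorem norm_iteratedFDeriv_translate (a : E → ℂ) (j : ℕ) (z ζ : E) :
    ‖iteratedFDeriv ℝ j (fun w => a (w + ζ)) z‖ = ‖iteratedFDeriv ℝ j a (z + ζ)‖ := by
  rw [iteratedFDeriv_comp_add_right]

theorem IsSymbol.translate_bound {M : ℕ} {a : E → ℂ} {K : ℝ} {j : ℕ} (hK0 : 0 ≤ K)
    (hK : ∀ z, ‖iteratedFDeriv ℝ j a z‖ ≤ K * (1 + ‖z‖) ^ M) (z ζ : E) :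
    ‖iteratedFDeriv ℝ j (fun w => a (w + ζ)) z‖ ≤ K * (1 + ‖ζ‖) ^ M * (1 + ‖z‖) ^ M := by
  rw [norm_iteratedFDeriv_translate]
  refine (hK _).trans ?_
  rw [mul_assoc, ← mul_pow]
  gcongr
  nlinarith [norm_add_le z ζ, norm_nonneg z, norm_nonneg ζ]

theorem IsSymbol.translate {M : ℕ} {a : E → ℂ} (ha : IsSymbol M a) (ζ : E) :
    IsSymbol M fun w => a (w + ζ) where
  smooth := ha.smooth.comp (contDiff_id.add contDiff_const)
  bound j := by
    obtain ⟨C, hC⟩ := ha.bound j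
    have h0 : 0 ≤ C := by simpa using (norm_nonneg _).trans (hC 0)
    exact ⟨C * (1 + ‖ζ‖) ^ M, fun z => IsSymbol.translate_bound h0 hC z ζ⟩

/-- Multiplication by a translated symbol costs a factor `(1 + |ζ|)^M` in every Schwartz seminorm. -/
theorem snorm_translate_mul_le {M N : ℕ} {a : E → ℂ} (ha : IsSymbol M a) {K : ℝ}
    (hK : ∀ j ≤ N, ∀ z, ‖iteratedFDeriv ℝ j a z‖ ≤ K * (1 + ‖z‖) ^ M) (f : 𝓢(E, ℂ)) (ζ : E) :
    snorm N (smulLeftCLM ℂ (fun w => a (w + ζ)) f) ≤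
      4 ^ (N + M) * K * (1 + ‖ζ‖) ^ M * snorm (N + M) f := by
  have hK0 : 0 ≤ K := by simpa using (norm_nonneg _).trans (hK 0 (Nat.zero_le _) 0)
  refine snorm_le (by positivity) fun k hk l hl x => ?_
  have hx : 0 < 1 + ‖x‖ := by positivity
  have e : ⇑(smulLeftCLM ℂ (fun w => a (w + ζ)) f) = fun y => a (y + ζ) * f y := by
    funext y
    rw [smulLeftCLM_apply_apply (ha.translate ζ).hasTemperateGrowth, smul_eq_mul]
  rw [e]
  have h1 := norm_iteratedFDeriv_mul_le_of_le (ha.translate ζ).smooth (f.smooth ⊤) x (n := l)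
    (A := K * (1 + ‖ζ‖) ^ M * (1 + ‖x‖) ^ M)
    (B := 2 ^ (N + M) * snorm (N + M) f / (1 + ‖x‖) ^ (k + M)) (by positivity)
    (fun i hi => IsSymbol.translate_bound hK0 (hK i (hi.trans hl)) x ζ) (fun i hi => by
      rw [le_div_iff₀ (by positivity), mul_comm]
      exact one_add_pow_mul_le_snorm (by omega) (by omega) f x)
  have h2 : ‖x‖ ^ k ≤ (1 + ‖x‖) ^ k := by gcongr; linarith
  calc _ ≤ (1 + ‖x‖) ^ k * (2 ^ l * (K * (1 + ‖ζ‖) ^ M * (1 + ‖x‖) ^ M *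
        (2 ^ (N + M) * snorm (N + M) f / (1 + ‖x‖) ^ (k + M)))) := by gcongr
    _ = 2 ^ l * 2 ^ (N + M) * K * (1 + ‖ζ‖) ^ M * snorm (N + M) f := by
        rw [pow_add (1 + ‖x‖)]
        field_simp
    _ ≤ 2 ^ (N + M) * 2 ^ (N + M) * K * (1 + ‖ζ‖) ^ M * snorm (N + M) f := by
        gcongr
        · norm_num
        · omega
    _ = _ := by rw [← mul_pow]; norm_num

end Symbols

section Transpose

/-- The displacement of the symbol caused by a phase-space shift; the frequency variable of `shift`
carries a factor `2π`. -/
noncomputable def halfScale (z : Rn (ι ⊕ ι)) : Rn (ι ⊕ ι) :=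
  join ((1 / 2 : ℝ) • leftPart z) (Real.pi • rightPart z)

theorem norm_halfScale_le (z : Rn (ι ⊕ ι)) : ‖halfScale z‖ ≤ 4 * ‖z‖ := by
  refine (norm_le_add _).trans ?_
  rw [halfScale, leftPart_join, rightPart_join, norm_smul, norm_smul, Real.norm_of_nonneg (by norm_num),
    Real.norm_of_nonneg Real.pi_pos.le]
  -- with `r = |x|` and `t = |ξ|`, the claim is `(r / 2 + π t)² ≤ 16 (r² + t²)`
  have h : ‖z‖ ^ 2 = ‖leftPart z‖ ^ 2 + ‖rightPart z‖ ^ 2 := by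
    rw [← norm_join_sq, join_left_right]
  have hp := Real.pi_lt_d2
  have h0 := Real.pi_pos
  refine abs_le_of_sq_le_sq' ?_ (by positivity) |>.2
  have h1 : (1 / 2 * ‖leftPart z‖ + Real.pi * ‖rightPart z‖) ^ 2 ≤
      (1 / 2 * ‖leftPart z‖ + 3.15 * ‖rightPart z‖) ^ 2 := by gcongr
  nlinarith [sq_nonneg (‖rightPart z‖ - 3 * ‖leftPart z‖), norm_nonneg (leftPart z),
    norm_nonneg (rightPart z)]

/-- The matrix coefficients of a Weyl operator on phase-space shifts are values of Fourier transforms: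
by the covariance of the Wigner transform the shift becomes a frequency, together with a translation
of the symbol. -/
theorem weyl_shift_eq_fourier {M : ℕ} {a : Rn (ι ⊕ ι) → ℂ} (ha : IsSymbol M a)
    (h g : 𝓢(Rn ι, ℂ)) (z : Rn (ι ⊕ ι)) :
    ∫ w, a w * cw (shift z h) g w = cis (1 / 2 * ⟪rightPart z, leftPart z⟫) *
      𝓕 (smulLeftCLM ℂ (fun w => a (w + halfScale z)) (cw h g))
        (join (-rightPart z) ((2 * Real.pi)⁻¹ • leftPart z)) := by
  rw [fourier_eq_cis, ← integral_const_mul, ← integral_add_right_eq_self _ (halfScale z)]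
  refine integral_congr_ae (Filter.Eventually.of_forall fun w => ?_)
  simp only
  rw [cw_shift_left, smulLeftCLM_apply_apply (ha.translate _).hasTemperateGrowth, smul_eq_mul,
    ← halfScale, add_sub_cancel_right]
  have e1 : leftPart (w + halfScale z) = leftPart w + (1 / 2 : ℝ) • leftPart z := rfl
  have e2 : rightPart (w + halfScale z) = rightPart w + Real.pi • rightPart z := rfl
  have e3 : ⟪w, join (-rightPart z) ((2 * Real.pi)⁻¹ • leftPart z)⟫ =
      -⟪rightPart z, leftPart w⟫ + (2 * Real.pi)⁻¹ * ⟪rightPart w, leftPart z⟫ := by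
    conv_lhs => rw [← join_left_right w]
    rw [inner_join, inner_neg_right, inner_smul_right, real_inner_comm]
  rw [e1, e2, e3, ← mul_assoc (cis _), ← cis_add, mul_left_comm]
  congr 2
  simp only [inner_add_left, inner_add_right, inner_smul_left, inner_smul_right, conj_trivial]
  field_simp
  ring

/-- The map `f ↦ W(f, conj g)`. -/
noncomputable def cwLeft (g : 𝓢(Rn ι, ℂ)) : 𝓢(Rn ι, ℂ) →L[ℂ] 𝓢(Rn (ι ⊕ ι), ℂ) :=
  wignerCLM ∘L stensorLeft g

/-- The map `g ↦ W(f, conj g)`. -/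
noncomputable def cwRight (f : 𝓢(Rn ι, ℂ)) : 𝓢(Rn ι, ℂ) →L[ℂ] 𝓢(Rn (ι ⊕ ι), ℂ) :=
  wignerCLM ∘L stensorRight f

theorem cwLeft_apply (f g : 𝓢(Rn ι, ℂ)) : cwLeft g f = cw f g := rfl

theorem cwRight_apply (f g : 𝓢(Rn ι, ℂ)) : cwRight f g = cw f g := rfl

/-- The functional `f ↦ ∫ a W(f, conj g)`. -/
noncomputable def weylFunctional (a : Rn (ι ⊕ ι) → ℂ) (g : 𝓢(Rn ι, ℂ)) : 𝓢(Rn ι, ℂ) →L[ℂ] ℂ :=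
  (integralCLM ℂ volume) ∘L (smulLeftCLM ℂ a) ∘L cwLeft g

theorem weylFunctional_apply {a : Rn (ι ⊕ ι) → ℂ} (ha : Function.HasTemperateGrowth a)
    (f g : 𝓢(Rn ι, ℂ)) : weylFunctional a g f = ∫ w, a w * cw f g w := by
  change integralCLM ℂ volume (smulLeftCLM ℂ a (cw f g)) = _
  rw [integralCLM_apply]
  refine integral_congr_ae (Filter.Eventually.of_forall fun w => ?_)
  simp only [smulLeftCLM_apply_apply ha, smul_eq_mul]

/-- Rapid decay of `∫ a W(shift z h, conj g)` in `z`. The translation of the symbol by `halfScale z`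
loses a factor `(1 + |z|)^M`, which is regained from `M` additional powers of the Fourier decay; the
bound is linear in the constants of finitely many derivatives of `a`. -/
theorem weyl_decay (h : 𝓢(Rn ι, ℂ)) (M N : ℕ) : ∃ (L N' : ℕ) (C : ℝ), 0 ≤ C ∧
    ∀ (a : Rn (ι ⊕ ι) → ℂ), IsSymbol M a → ∀ K : ℝ,
      (∀ j ≤ L, ∀ z, ‖iteratedFDeriv ℝ j a z‖ ≤ K * (1 + ‖z‖) ^ M) → ∀ g z,
      (1 + ‖z‖) ^ N * ‖∫ w, a w * cw (shift z h) g w‖ ≤ C * K * snorm N' g := by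
  obtain ⟨L, C₁, hC₁, h₁⟩ := exists_fourier_decay (ι := ι ⊕ ι) (N + M)
  obtain ⟨N', C₂, hC₂, h₂⟩ := exists_map_snorm_le (cwRight h) (L + M)
  refine ⟨L, N', (2 * Real.pi) ^ (N + M) * C₁ * 4 ^ (L + M) * 4 ^ M * C₂, by positivity,
    fun a ha K hK g z => ?_⟩
  have hK0 : 0 ≤ K := by simpa using (norm_nonneg _).trans (hK 0 (Nat.zero_le _) 0)
  rw [weyl_shift_eq_fourier ha, norm_mul, norm_cis, one_mul]
  set J := join (-rightPart z) ((2 * Real.pi)⁻¹ • leftPart z)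
  set Θ := smulLeftCLM ℂ (fun w => a (w + halfScale z)) (cw h g)
  have hz0 : 0 < 1 + ‖z‖ := by positivity
  have hpi : 1 ≤ 2 * Real.pi := by linarith [Real.pi_gt_three]
  have hJ : 1 + ‖z‖ ≤ (2 * Real.pi) * (1 + ‖J‖) := by
    have e : ‖z‖ ^ 2 ≤ (2 * Real.pi * ‖J‖) ^ 2 := by
      have e1 : ‖z‖ ^ 2 = ‖leftPart z‖ ^ 2 + ‖rightPart z‖ ^ 2 := by
        rw [← norm_join_sq, join_left_right]
      have e2 : (2 * Real.pi * ‖J‖) ^ 2 = (2 * Real.pi) ^ 2 * ‖rightPart z‖ ^ 2 + ‖leftPart z‖ ^ 2 := by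
        rw [mul_pow, norm_join_sq, norm_neg, norm_smul, Real.norm_of_nonneg (by positivity)]
        field_simp
      rw [e1, e2]
      nlinarith [sq_nonneg ‖rightPart z‖, one_le_pow₀ (n := 2) hpi]
    have := abs_le_of_sq_le_sq' e (by positivity) |>.2
    nlinarith
  have hh : (1 + ‖halfScale z‖) ^ M ≤ 4 ^ M * (1 + ‖z‖) ^ M := by
    rw [← mul_pow]
    gcongr
    linarith [norm_halfScale_le z]
  have hΘ : snorm L Θ ≤ 4 ^ (L + M) * K * (4 ^ M * (1 + ‖z‖) ^ M) * (C₂ * snorm N' g) := by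
    refine (snorm_translate_mul_le ha hK (cw h g) (halfScale z)).trans ?_
    gcongr
    exact h₂ g
  have key : (1 + ‖z‖) ^ (N + M) * ‖𝓕 Θ J‖ ≤ (2 * Real.pi) ^ (N + M) *
      (C₁ * (4 ^ (L + M) * K * (4 ^ M * (1 + ‖z‖) ^ M) * (C₂ * snorm N' g))) := by
    calc _ ≤ ((2 * Real.pi) * (1 + ‖J‖)) ^ (N + M) * ‖𝓕 Θ J‖ := by gcongr
      _ = (2 * Real.pi) ^ (N + M) * ((1 + ‖J‖) ^ (N + M) * ‖𝓕 Θ J‖) := by rw [mul_pow]; ring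
      _ ≤ (2 * Real.pi) ^ (N + M) * (C₁ * snorm L Θ) := by
          exact mul_le_mul_of_nonneg_left (h₁ Θ J) (by positivity)
      _ ≤ _ := by gcongr
  rw [pow_add] at key
  refine le_of_mul_le_mul_right (a := (1 + ‖z‖) ^ M) ?_ (by positivity)
  calc _ = (1 + ‖z‖) ^ N * (1 + ‖z‖) ^ M * ‖𝓕 Θ J‖ := by ring
    _ ≤ _ := key
    _ = _ := by ring

/-- `T` is the transpose, for the bilinear pairing `∫ f g`, of the Weyl operator with symbol `a`: an
operator on the Schwartz space with `∫ f (T g) = ∫ a W(f, conj g)`. -/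
def IsTranspose (a : Rn (ι ⊕ ι) → ℂ) (T : 𝓢(Rn ι, ℂ) →L[ℂ] 𝓢(Rn ι, ℂ)) : Prop :=
  ∀ f g, ∫ x, f x * T g x = ∫ w, a w * cw f g w

/-- The transpose maps into the Schwartz space: `f ↦ ∫ a W(f, conj g)` is a tempered distribution whose
short-time Fourier transform decays rapidly. -/
theorem exists_transpose_aux (ι : Type) [Fintype ι] (M : ℕ) (a : Rn (ι ⊕ ι) → ℂ)
    (ha : IsSymbol M a) : ∃ T : 𝓢(Rn ι, ℂ) →ₗ[ℂ] 𝓢(Rn ι, ℂ),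
      ∀ f g, ∫ x, f x * T g x = ∫ w, a w * cw f g w := by
  obtain ⟨h, hh⟩ := exists_schwartz_ne_zero ι
  obtain ⟨k, hk⟩ := exists_dual_window (h := h) (fun h0 => hh (by rw [h0]; rfl))
  have hex : ∀ g : 𝓢(Rn ι, ℂ), ∃ F : 𝓢(Rn ι, ℂ), ∀ f,
      ∫ x, f x * F x = ∫ w, a w * cw f g w := fun g => by
    obtain ⟨F, hF, -⟩ := exists_schwartz_of_decay hk (weylFunctional a g) fun N => by
      obtain ⟨L, N', C, hC, hb⟩ := weyl_decay h M N
      obtain ⟨K, hK⟩ := ha.exists_uniform_bound L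
      refine ⟨C * K * snorm N' g, fun z => ?_⟩
      rw [weylFunctional_apply ha.hasTemperateGrowth]
      exact hb a ha K hK g z
    exact ⟨F, fun f => by rw [← hF, weylFunctional_apply ha.hasTemperateGrowth]⟩
  choose T hT using hex
  have hi : ∀ f g : 𝓢(Rn ι, ℂ), Integrable fun x => f x * g x := fun f g =>
    (SchwartzMap.pairing (ContinuousLinearMap.mul ℂ ℂ) f g).integrable
  have hi' : ∀ f g : 𝓢(Rn ι, ℂ), Integrable fun w => a w * cw f g w := fun f g => by
    have := (smulLeftCLM ℂ a (cw f g)).integrable (μ := volume)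
    refine this.congr (Filter.Eventually.of_forall fun w => ?_)
    simp only [smulLeftCLM_apply_apply ha.hasTemperateGrowth, smul_eq_mul]
  refine ⟨{ toFun := T, map_add' := fun g₁ g₂ => ?_, map_smul' := fun c g => ?_ },
    fun f g => hT g f⟩
  · refine emb_injective fun φ => ?_
    simp only [add_apply, mul_add]
    rw [integral_add (hi _ _) (hi _ _), hT, hT, hT, ← integral_add (hi' _ _) (hi' _ _)]
    simp only [← cwRight_apply, map_add, add_apply, mul_add]
  · refine emb_injective fun φ => ?_
    simp only [smul_apply, RingHom.id_apply, smul_eq_mul, mul_left_comm _ c]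
    rw [integral_const_mul, hT, hT, ← integral_const_mul]
    simp only [← cwRight_apply, map_smul, smul_apply, smul_eq_mul, mul_left_comm _ c]

/-- The transpose depends continuously on its symbol: its seminorm bounds are linear in the constant `K`
of the symbol. Applied to the relative variation of a symbol, this makes the error term of the
hypoellipticity argument small. -/
theorem transpose_bound (ι : Type) [Fintype ι] (M N : ℕ) : ∃ (L N' : ℕ) (C : ℝ), 0 ≤ C ∧
    ∀ (a : Rn (ι ⊕ ι) → ℂ), IsSymbol M a → ∀ K : ℝ,
      (∀ j ≤ L, ∀ z, ‖iteratedFDeriv ℝ j a z‖ ≤ K * (1 + ‖z‖) ^ M) →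
      ∀ F g : 𝓢(Rn ι, ℂ), (∀ f : 𝓢(Rn ι, ℂ), ∫ x, f x * F x = ∫ w, a w * cw f g w) →
        snorm N F ≤ C * K * snorm N' g := by
  obtain ⟨h, hh⟩ := exists_schwartz_ne_zero ι
  obtain ⟨k, hk⟩ := exists_dual_window (h := h) (fun h0 => hh (by rw [h0]; rfl))
  obtain ⟨N₁, C₁, hC₁, h₁⟩ := snorm_le_of_decay hk N
  obtain ⟨L, N', C₂, hC₂, h₂⟩ := weyl_decay h M N₁
  refine ⟨L, N', C₁ * C₂, by positivity, fun a ha K hK F g hF => ?_⟩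
  refine (h₁ F (C₂ * K * snorm N' g) fun z => ?_).trans (le_of_eq (by ring))
  rw [hF]
  exact h₂ a ha K hK g z

/-- Weyl operators with symbols of polynomial growth have transposes that are continuous on the Schwartz
space. -/
theorem exists_transpose {M : ℕ} {a : Rn (ι ⊕ ι) → ℂ} (ha : IsSymbol M a) :
    ∃ T, IsTranspose a T := by
  obtain ⟨T, hT⟩ := exists_transpose_aux ι M a ha
  refine ⟨⟨T, continuous_of_snorm_le T fun N => ?_⟩, hT⟩
  obtain ⟨L, N', C, hC, h⟩ := transpose_bound ι M N
  obtain ⟨K, hK⟩ := ha.exists_uniform_bound L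
  have hK0 : 0 ≤ K := by simpa using (norm_nonneg _).trans (hK 0 (Nat.zero_le _) 0)
  exact ⟨N', C * K, by positivity, fun g => h a ha K hK _ g fun f => hT f g⟩

end Transpose

/-! ### Dual extensions -/

section DualExtension

/-- A weak-* continuous functional on `𝓢'` is the evaluation at a Schwartz function. -/
theorem exists_eq_eval (ℓ : 𝓢'(Rn ι, ℂ) →L[ℂ] ℂ) : ∃ g : 𝓢(Rn ι, ℂ), ∀ u, ℓ u = u g := by
  obtain ⟨g, hg⟩ := LinearMap.dualEmbedding_surjective (topDualPairing ℂ 𝓢(Rn ι, ℂ))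
    (ℓ.comp (PointwiseConvergenceCLM.equivWeakDual ℂ 𝓢(Rn ι, ℂ)).symm.toContinuousLinearMap)
  exact ⟨g, fun u => (DFunLike.congr_fun hg (PointwiseConvergenceCLM.equivWeakDual ℂ _ u)).symm⟩

/-- A weak-* continuous functional on `𝓢'` is determined by its restriction to `𝓢`. -/
theorem eq_of_eq_on_emb {ℓ ℓ' : 𝓢'(Rn ι, ℂ) →L[ℂ] ℂ} (h : ∀ f, ℓ (emb f) = ℓ' (emb f)) :
    ℓ = ℓ' := by
  obtain ⟨g, hg⟩ := exists_eq_eval ℓ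
  obtain ⟨g', hg'⟩ := exists_eq_eval ℓ'
  have : g = g' := emb_injective fun φ => by
    rw [← emb_apply, ← emb_apply, ← hg, ← hg', h]
  ext u
  rw [hg, hg', this]

variable {a : Rn (ι ⊕ ι) → ℂ} {T : 𝓢(Rn ι, ℂ) →L[ℂ] 𝓢(Rn ι, ℂ)}
  {A : 𝓢(Rn ι, ℂ) →L[ℂ] 𝓢'(Rn ι, ℂ)}

theorem IsTranspose.weyl_apply (hT : IsTranspose a T) (hA : HasWeylSymbol A a)
    (f g : 𝓢(Rn ι, ℂ)) : A f g = ∫ x, f x * T g x := by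
  rw [hA, hT]
  simp only [cw_eq_crossWigner]

theorem IsTranspose.dualExtension_apply (hT : IsTranspose a T) (hA : HasWeylSymbol A a)
    {B : 𝓢'(Rn ι, ℂ) →L[ℂ] 𝓢'(Rn ι, ℂ)} (hB : IsDualExtension A B) (u : 𝓢'(Rn ι, ℂ))
    (g : 𝓢(Rn ι, ℂ)) : B u g = u (T g) := by
  have := eq_of_eq_on_emb (ℓ := (PointwiseConvergenceCLM.evalCLM (RingHom.id ℂ) ℂ g) ∘L B)
    (ℓ' := PointwiseConvergenceCLM.evalCLM (RingHom.id ℂ) ℂ (T g)) fun f => by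
      change B (emb f) g = emb f (T g)
      rw [hB, hT.weyl_apply hA, emb_apply]
  exact DFunLike.congr_fun this u

/-- The dual extension of a Weyl operator is the dual of its transpose. -/
theorem IsTranspose.existsUnique_dualExtension (hT : IsTranspose a T) (hA : HasWeylSymbol A a) :
    ∃! B : 𝓢'(Rn ι, ℂ) →L[ℂ] 𝓢'(Rn ι, ℂ), IsDualExtension A B := by
  refine ⟨PointwiseConvergenceCLM.precomp ℂ T, fun f => ?_, fun B hB => ?_⟩
  · ext g
    change emb f (T g) = _
    rw [hT.weyl_apply hA, emb_apply]
  · ext u g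
    exact hT.dualExtension_apply hA hB u g

end DualExtension

/-! ### Slices and marginals -/

section Slices

/-- The restriction of a Schwartz function on `ℝ^ι × ℝ^κ` to `{x} × ℝ^κ`. -/
noncomputable def slice (x : Rn ι) : 𝓢(Rn (ι ⊕ κ), ℂ) →L[ℂ] 𝓢(Rn κ, ℂ) :=
  (compCLMOfAntilipschitz ℂ (inclCLM (ι := ι) (κ := κ)).hasTemperateGrowth
    (inclCLM_antilipschitz (ι := ι) (κ := κ))) ∘L (compSubConstCLM ℂ (join (-x) 0))

theorem slice_apply (x : Rn ι) (Φ : 𝓢(Rn (ι ⊕ κ), ℂ)) (y : Rn κ) : slice x Φ y = Φ (join x y) := by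
  change Φ (join 0 y - join (-x) 0) = _
  congr 1
  ext i
  cases i <;> simp [join]

theorem partialFourier_eq_fourier_slice (Φ : 𝓢(Rn (ι ⊕ κ), ℂ)) (x : Rn ι) (η : Rn κ) :
    partialFourier Φ (join x η) = 𝓕 (slice x Φ) η := by
  rw [partialFourier_apply, fourier_eq_cis]
  simp only [slice_apply]

theorem integral_fourier_eq (f : 𝓢(Rn κ, ℂ)) : ∫ η, 𝓕 f η = f 0 := by
  have h : (𝓕⁻ (𝓕 f)) 0 = f 0 := by rw [FourierTransform.fourierInv_fourier_eq]
  rw [← h, fourierInv_coe, Real.fourierInv_eq]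
  simp

/-- Fourier inversion: integrating out the frequency variable restricts to `y = 0`. -/
theorem integral_partialFourier (Φ : 𝓢(Rn (ι ⊕ κ), ℂ)) (x : Rn ι) :
    ∫ η : Rn κ, partialFourier Φ (join x η) = Φ (join x 0) := by
  simp only [partialFourier_eq_fourier_slice]
  rw [integral_fourier_eq, slice_apply]

/-- The position marginal of the Wigner transform. -/
theorem integral_wigner_right (F : 𝓢(Rn (ι ⊕ ι), ℂ)) (x : Rn ι) :
    ∫ ξ : Rn ι, wignerCLM F (join x ξ) = F (join x x) := by
  have h := integral_partialFourier (compCLMOfContinuousLinearEquiv ℂ midL F) x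
  have h0 : compCLMOfContinuousLinearEquiv ℂ midL F (join x 0) = F (join x x) := by
    change F (midL (join x 0)) = _
    rw [midL_join]; simp
  rw [h0] at h
  rw [← h]
  have e : ∀ ξ : Rn ι, wignerCLM F (join x ξ) = (((2 * Real.pi : ℝ) : ℂ)⁻¹ ^ Fintype.card ι) *
      partialFourier (compCLMOfContinuousLinearEquiv ℂ midL F) (join x ((2 * Real.pi)⁻¹ • ξ)) :=
    fun ξ => rfl
  simp only [e]
  rw [integral_const_mul, Measure.integral_comp_smul volume
    (fun ξ => partialFourier (compCLMOfContinuousLinearEquiv ℂ midL F) (join x ξ)),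
    finrank_euclideanSpace, abs_of_pos (by positivity), Complex.real_smul, ← mul_assoc, inv_pow, inv_pow, inv_inv]
  push_cast
  rw [inv_mul_cancel₀ (by simp [Real.pi_ne_zero]), one_mul]

/-- The Wigner transform preserves integrals: `∫ W(f, conj g) = ∫ f g`. -/
theorem integral_cw (f g : 𝓢(Rn ι, ℂ)) : ∫ z, cw f g z = ∫ x, f x * g x := by
  rw [integral_join (cw f g).integrable]
  simp only [cw, integral_wigner_right, stensor_apply, leftPart_join, rightPart_join]

end Slices

/-! ### Slowly varying symbols -/

section SlowlyVarying

variable {ρ m₁ m₀ : ℝ} {a : Rn (ι ⊕ ι) → ℂ}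

theorem ShubinSymbol.exists_radius (ha : ShubinSymbol ρ m₁ m₀ a) : ∃ R : ℝ, 1 ≤ R ∧
    (∃ c > 0, ∀ z, R ≤ ‖z‖ → c * ‖z‖ ^ m₀ ≤ ‖a z‖) ∧
    (∃ C > 0, ∀ z, R ≤ ‖z‖ → ‖a z‖ ≤ C * ‖z‖ ^ m₁) ∧
    ∀ j : ℕ, ∃ C ≥ 0, ∀ z, R ≤ ‖z‖ → ‖iteratedFDeriv ℝ j a z‖ ≤ C * ‖a z‖ * ‖z‖ ^ (-ρ * j) := by
  obtain ⟨R₁, -, C₀, hC₀, C₁, hC₁, h⟩ := ha.growth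
  obtain ⟨R₂, -, h'⟩ := ha.deriv_bound
  refine ⟨max 1 (max R₁ R₂), le_max_left _ _,
    ⟨C₀, hC₀, fun z hz => (h z ?_).1⟩, ⟨C₁, hC₁, fun z hz => (h z ?_).2⟩, fun j => ?_⟩
  · exact ((le_max_left _ _).trans (le_max_right _ _)).trans hz
  · exact ((le_max_left _ _).trans (le_max_right _ _)).trans hz
  · obtain ⟨C, hC, hb⟩ := h' j
    exact ⟨C, hC, fun z hz => hb z (((le_max_right _ _).trans (le_max_right _ _)).trans hz)⟩

/-- The upper bound on `a` and the derivative bounds give polynomial growth of one order for all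
derivatives; the order is `⌈m₁⌉₊`, which is `0` for negative `m₁`. -/
theorem ShubinSymbol.exists_isSymbol (ha : ShubinSymbol ρ m₁ m₀ a) (hρ : 0 < ρ) :
    ∃ M, IsSymbol M a := by
  obtain ⟨R, hR, -, ⟨C₁, hC₁, h1⟩, h2⟩ := ha.exists_radius
  refine ⟨⌈m₁⌉₊, ha.smooth, fun j => ?_⟩
  obtain ⟨C, hC, hb⟩ := h2 j
  obtain ⟨B, hB⟩ := (isCompact_closedBall (0 : Rn (ι ⊕ ι)) R).exists_bound_of_continuousOn
    (ha.smooth.continuous_iteratedFDeriv (m := j) (by exact_mod_cast le_top)).continuousOn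
  have hB0 : 0 ≤ B := (norm_nonneg _).trans (hB 0 (by simp; linarith))
  refine ⟨max (C * C₁) B, fun z => ?_⟩
  have hz1 : 1 ≤ (1 + ‖z‖) ^ ⌈m₁⌉₊ := one_le_pow₀ (by linarith [norm_nonneg z])
  rcases le_total R ‖z‖ with hz | hz
  · have hz0 : 1 ≤ ‖z‖ := hR.trans hz
    have e1 : ‖z‖ ^ (-ρ * j) ≤ 1 := Real.rpow_le_one_of_one_le_of_nonpos hz0 (by
      have : 0 ≤ ρ * j := by positivity
      linarith)
    have e2 : ‖z‖ ^ m₁ ≤ (1 + ‖z‖) ^ ⌈m₁⌉₊ := by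
      calc ‖z‖ ^ m₁ ≤ ‖z‖ ^ (⌈m₁⌉₊ : ℝ) :=
            Real.rpow_le_rpow_of_exponent_le hz0 (Nat.le_ceil _)
        _ = ‖z‖ ^ ⌈m₁⌉₊ := Real.rpow_natCast _ _
        _ ≤ _ := by gcongr; linarith
    calc _ ≤ C * ‖a z‖ * ‖z‖ ^ (-ρ * j) := hb z hz
      _ ≤ C * (C₁ * ‖z‖ ^ m₁) * 1 := by gcongr; exact h1 z hz
      _ = C * C₁ * ‖z‖ ^ m₁ := by ring
      _ ≤ max (C * C₁) B * (1 + ‖z‖) ^ ⌈m₁⌉₊ := by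
        gcongr
        exact le_max_left _ _
  · calc _ ≤ B := hB z (by simpa using hz)
      _ ≤ max (C * C₁) B * 1 := by rw [mul_one]; exact le_max_right _ _
      _ ≤ _ := by gcongr

/-- On the ball of radius `|z|^ρ / 2` about `z` the derivatives of the symbol are `O(|a z| |z|^{-ρ})`.
By Gronwall's inequality `|a|` is `O(|a z|)` on that ball, since there `|∇a| = O(|a| |z|^{-ρ})`. -/
theorem ShubinSymbol.exists_near (ha : ShubinSymbol ρ m₁ m₀ a) (hρ : 0 < ρ) (hρ1 : ρ ≤ 1) :
    ∃ R : ℝ, 1 ≤ R ∧ ∀ j : ℕ, 1 ≤ j → ∃ C, 0 ≤ C ∧ ∀ z w, R ≤ ‖z‖ → ‖w‖ ≤ ‖z‖ ^ ρ / 2 →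
      ‖iteratedFDeriv ℝ j a (z + w)‖ ≤ C * ‖a z‖ * ‖z‖ ^ (-ρ) := by
  obtain ⟨R, hR, -, -, h2⟩ := ha.exists_radius
  have hgeo : ∀ z w : Rn (ι ⊕ ι), 2 * R ≤ ‖z‖ → ‖w‖ ≤ ‖z‖ ^ ρ / 2 →
      R ≤ ‖z + w‖ ∧ ‖z + w‖ ^ (-ρ) ≤ 2 * ‖z‖ ^ (-ρ) := fun z w hz hw => by
    have hz1 : 1 ≤ ‖z‖ := by linarith
    have h3 : ‖z‖ ^ ρ ≤ ‖z‖ := by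
      simpa using Real.rpow_le_rpow_of_exponent_le hz1 hρ1
    have h4 : ‖z‖ / 2 ≤ ‖z + w‖ := by
      have := norm_sub_norm_le z (-w)
      rw [norm_neg, sub_neg_eq_add] at this
      linarith
    refine ⟨by linarith, ?_⟩
    calc ‖z + w‖ ^ (-ρ) ≤ (‖z‖ / 2) ^ (-ρ) :=
          Real.rpow_le_rpow_of_nonpos (by linarith) h4 (by linarith)
      _ = 2 ^ ρ * ‖z‖ ^ (-ρ) := by
          rw [Real.div_rpow (by linarith) (by norm_num), Real.rpow_neg (by norm_num : (0:ℝ) ≤ 2)]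
          field_simp
      _ ≤ 2 * ‖z‖ ^ (-ρ) := by
          gcongr
          simpa using Real.rpow_le_rpow_of_exponent_le one_le_two hρ1
  obtain ⟨C₁, hC₁, hb₁⟩ := h2 1
  -- Gronwall's inequality along the segment from `z` to `z + w`
  have hcmp : ∀ z w : Rn (ι ⊕ ι), 2 * R ≤ ‖z‖ → ‖w‖ ≤ ‖z‖ ^ ρ / 2 →
      ‖a (z + w)‖ ≤ ‖a z‖ * Real.exp C₁ := fun z w hz hw => by
    have hz1 : 1 ≤ ‖z‖ := by linarith
    have hda : Differentiable ℝ a := ha.smooth.differentiable (by simp)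
    have hder : ∀ t : ℝ, HasDerivAt (fun t : ℝ => a (z + t • w)) (fderiv ℝ a (z + t • w) w) t :=
      fun t => by
        have h1 : HasDerivAt (fun t : ℝ => z + t • w) w t := by
          simpa using ((hasDerivAt_id t).smul_const w).const_add z
        exact (hda _).hasFDerivAt.comp_hasDerivAt t h1
    have h3 := norm_le_gronwallBound_of_norm_deriv_right_le (f := fun t : ℝ => a (z + t • w))
      (f' := fun t => fderiv ℝ a (z + t • w) w) (δ := ‖a z‖) (K := C₁) (ε := 0) (a := 0) (b := 1)
      (fun t _ => (hder t).continuousAt.continuousWithinAt)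
      (fun t _ => (hder t).hasDerivWithinAt) (by simp) (fun t ht => by
        have htw : ‖t • w‖ ≤ ‖z‖ ^ ρ / 2 := by
          rw [norm_smul, Real.norm_of_nonneg ht.1]
          exact (mul_le_of_le_one_left (norm_nonneg _) ht.2.le).trans hw
        obtain ⟨h5, h6⟩ := hgeo z (t • w) hz htw
        have h7 := hb₁ _ h5
        rw [norm_iteratedFDeriv_one, Nat.cast_one, mul_one] at h7
        have h8 : ‖z‖ ^ (-ρ) * ‖z‖ ^ ρ = 1 := by
          rw [← Real.rpow_add (by linarith), neg_add_cancel, Real.rpow_zero]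
        calc ‖fderiv ℝ a (z + t • w) w‖ ≤ ‖fderiv ℝ a (z + t • w)‖ * ‖w‖ :=
              ContinuousLinearMap.le_opNorm _ _
          _ ≤ (C₁ * ‖a (z + t • w)‖ * (2 * ‖z‖ ^ (-ρ))) * (‖z‖ ^ ρ / 2) := by
              gcongr
              exact h7.trans (by gcongr)
          _ = C₁ * ‖a (z + t • w)‖ * (‖z‖ ^ (-ρ) * ‖z‖ ^ ρ) := by ring
          _ = C₁ * ‖a (z + t • w)‖ + 0 := by rw [h8]; ring) 1 (by simp)
    simpa [gronwallBound_ε0] using h3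
  refine ⟨2 * R, by linarith, fun j hj => ?_⟩
  obtain ⟨C, hC, hb⟩ := h2 j
  refine ⟨C * Real.exp C₁ * 2, by positivity, fun z w hz hw => ?_⟩
  obtain ⟨h5, h6⟩ := hgeo z w hz hw
  have h9 : ‖z + w‖ ^ (-ρ * j) ≤ ‖z + w‖ ^ (-ρ) :=
    Real.rpow_le_rpow_of_exponent_le (hR.trans h5) (by
      have : (1 : ℝ) ≤ j := by exact_mod_cast hj
      nlinarith)
  calc _ ≤ C * ‖a (z + w)‖ * ‖z + w‖ ^ (-ρ * j) := hb _ h5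
    _ ≤ C * (‖a z‖ * Real.exp C₁) * (2 * ‖z‖ ^ (-ρ)) := by
      gcongr
      · exact hcmp z w hz hw
      · exact h9.trans h6
    _ = _ := by ring

/-- The relative variation `w ↦ a(w + z) / a(z) - 1` of a symbol about `z`. -/
noncomputable def relVar (a : Rn (ι ⊕ ι) → ℂ) (z w : Rn (ι ⊕ ι)) : ℂ := (a z)⁻¹ * a (w + z) - 1

theorem contDiff_relVar (ha : ContDiff ℝ ∞ a) (z : Rn (ι ⊕ ι)) : ContDiff ℝ ∞ (relVar a z) :=
  (contDiff_const.mul (ha.comp (contDiff_id.add contDiff_const))).sub contDiff_const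

theorem iteratedFDeriv_relVar (ha : ContDiff ℝ ∞ a) (j : ℕ) (z w : Rn (ι ⊕ ι)) :
    iteratedFDeriv ℝ j (relVar a z) w = (a z)⁻¹ • iteratedFDeriv ℝ j a (w + z) -
      iteratedFDeriv ℝ j (fun _ => (1 : ℂ)) w := by
  have hs : ContDiff ℝ j fun w => a (w + z) :=
    (ha.comp (contDiff_id.add contDiff_const)).of_le (by exact_mod_cast le_top)
  have e : relVar a z = (fun w => (a z)⁻¹ • a (w + z)) - fun _ => (1 : ℂ) := rfl
  rw [e, iteratedFDeriv_sub_apply (f := fun w => (a z)⁻¹ • a (w + z)) (g := fun _ => (1 : ℂ))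
    (hs.const_smul _).contDiffAt contDiff_const.contDiffAt]
  have h1 := iteratedFDeriv_const_smul_apply (a := (a z)⁻¹) hs.contDiffAt (x := w)
  rw [iteratedFDeriv_comp_add_right] at h1
  rw [← h1]
  rfl

theorem norm_iteratedFDeriv_relVar_le (ha : ContDiff ℝ ∞ a) (j : ℕ) (z w : Rn (ι ⊕ ι)) :
    ‖iteratedFDeriv ℝ j (relVar a z) w‖ ≤ ‖a z‖⁻¹ * ‖iteratedFDeriv ℝ j a (w + z)‖ + 1 := by
  rw [iteratedFDeriv_relVar ha]
  refine (norm_sub_le _ _).trans ?_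
  rw [norm_smul, norm_inv]
  gcongr
  rcases Nat.eq_zero_or_pos j with rfl | hj
  · simp
  · rw [iteratedFDeriv_const_of_ne hj.ne']
    simp

theorem norm_iteratedFDeriv_relVar_of_pos (ha : ContDiff ℝ ∞ a) {j : ℕ} (hj : 1 ≤ j)
    (z w : Rn (ι ⊕ ι)) :
    ‖iteratedFDeriv ℝ j (relVar a z) w‖ = ‖a z‖⁻¹ * ‖iteratedFDeriv ℝ j a (w + z)‖ := by
  rw [iteratedFDeriv_relVar ha, iteratedFDeriv_const_of_ne (by omega), ← norm_inv, ← norm_smul]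
  simp

/-- Near `z` the relative variation is small, by the mean value inequality. -/
theorem ShubinSymbol.relVar_near (ha : ShubinSymbol ρ m₁ m₀ a) (hρ : 0 < ρ) (hρ1 : ρ ≤ 1) :
    ∃ R : ℝ, 1 ≤ R ∧ ∀ j : ℕ, ∃ C, 0 ≤ C ∧ ∀ z w, R ≤ ‖z‖ → a z ≠ 0 → ‖w‖ ≤ ‖z‖ ^ ρ / 2 →
      ‖iteratedFDeriv ℝ j (relVar a z) w‖ ≤ C * ‖z‖ ^ (-ρ) * (1 + ‖w‖) := by
  obtain ⟨R, hR, h⟩ := ha.exists_near hρ hρ1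
  refine ⟨R, hR, fun j => ?_⟩
  rcases Nat.eq_zero_or_pos j with rfl | hj
  · obtain ⟨C, hC, hb⟩ := h 1 le_rfl
    refine ⟨C, hC, fun z w hz haz hw => ?_⟩
    have ha0 : 0 < ‖a z‖ := norm_pos_iff.2 haz
    rw [norm_iteratedFDeriv_zero]
    have h1 := (convex_closedBall z (‖z‖ ^ ρ / 2)).norm_image_sub_le_of_norm_fderiv_le
      (𝕜 := ℝ) (f := a) (C := C * ‖a z‖ * ‖z‖ ^ (-ρ)) (x := z) (y := z + w)
      (fun x _ => (ha.smooth.differentiable (by simp)) x) (fun x hx => by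
        have := hb z (x - z) hz (by simpa [dist_eq_norm] using hx)
        rwa [add_sub_cancel, norm_iteratedFDeriv_one] at this)
      (Metric.mem_closedBall_self (by positivity)) (by simpa [dist_eq_norm] using hw)
    rw [add_sub_cancel_left] at h1
    have e : relVar a z w = (a z)⁻¹ * (a (z + w) - a z) := by
      rw [relVar, mul_sub, inv_mul_cancel₀ haz, add_comm]
    rw [e, norm_mul, norm_inv]
    calc _ ≤ ‖a z‖⁻¹ * (C * ‖a z‖ * ‖z‖ ^ (-ρ) * ‖w‖) := by gcongr
      _ = C * ‖z‖ ^ (-ρ) * ‖w‖ := by field_simp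
      _ ≤ _ := by gcongr; linarith
  · obtain ⟨C, hC, hb⟩ := h j hj
    refine ⟨C, hC, fun z w hz haz hw => ?_⟩
    have ha0 : 0 < ‖a z‖ := norm_pos_iff.2 haz
    rw [norm_iteratedFDeriv_relVar_of_pos ha.smooth hj, add_comm w z]
    calc _ ≤ ‖a z‖⁻¹ * (C * ‖a z‖ * ‖z‖ ^ (-ρ)) := by gcongr; exact hb z w hz hw
      _ = C * ‖z‖ ^ (-ρ) * 1 := by field_simp
      _ ≤ _ := by gcongr; linarith [norm_nonneg w]

/-- Far from `z` the polynomial bounds on the symbol suffice, since there `|w| ≥ |z|^ρ / 2`. -/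
theorem ShubinSymbol.relVar_far (ha : ShubinSymbol ρ m₁ m₀ a) (hρ : 0 < ρ) :
    ∃ (R : ℝ) (K : ℕ), 1 ≤ R ∧ (∀ z, R ≤ ‖z‖ → a z ≠ 0) ∧ ∀ j : ℕ, ∃ C, 0 ≤ C ∧
      ∀ z w, R ≤ ‖z‖ → ‖z‖ ^ ρ / 2 < ‖w‖ →
      ‖iteratedFDeriv ℝ j (relVar a z) w‖ ≤ C * ‖z‖ ^ (-ρ) * (1 + ‖w‖) ^ (K + 1) := by
  obtain ⟨M, haM⟩ := ha.exists_isSymbol hρ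
  obtain ⟨R, hR, ⟨c, hc, hlow⟩, -, -⟩ := ha.exists_radius
  set Q := ⌈1 / ρ⌉₊ with hQdef
  have hQ : 1 / ρ ≤ Q := Nat.le_ceil _
  set P := ⌈-m₀⌉₊
  have hP : -m₀ ≤ P := Nat.le_ceil _
  refine ⟨R, Q * M + Q * P, hR, fun z hz h0 => ?_, fun j => ?_⟩
  · have := hlow z hz
    rw [h0, norm_zero] at this
    have : 0 < c * ‖z‖ ^ m₀ := mul_pos hc (Real.rpow_pos_of_pos (by linarith) _)
    linarith
  obtain ⟨C, hb⟩ := haM.bound j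
  have hC : 0 ≤ C := by simpa using (norm_nonneg _).trans (hb 0)
  refine ⟨(C * 2 ^ M * c⁻¹ + 1) * 2 ^ (Q * M + Q * P + 1), by positivity, fun z w hz hw => ?_⟩
  have hz1 : 1 ≤ ‖z‖ := hR.trans hz
  -- a power of `W` dominates `|z|`, hence also `|a z|⁻¹` and the derivatives of `a` at `w + z`
  set W := 2 * (1 + ‖w‖) with hW
  have hW1 : 1 ≤ W := by linarith [norm_nonneg w]
  have hzW : ‖z‖ ^ ρ ≤ W := by linarith
  have hzQ : ‖z‖ ≤ W ^ Q := by
    have h1 : ‖z‖ = (‖z‖ ^ ρ) ^ (1 / ρ) := by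
      rw [← Real.rpow_mul (by linarith), mul_one_div_cancel hρ.ne', Real.rpow_one]
    calc ‖z‖ = (‖z‖ ^ ρ) ^ (1 / ρ) := h1
      _ ≤ W ^ (1 / ρ) := Real.rpow_le_rpow (by positivity) hzW (by positivity)
      _ ≤ W ^ (Q : ℝ) := Real.rpow_le_rpow_of_exponent_le hW1 hQ
      _ = W ^ Q := Real.rpow_natCast _ _
  have hQ0 : Q ≠ 0 := by
    have : 0 < 1 / ρ := by positivity
    exact (Nat.ceil_pos.2 this).ne'
  have hWQ : W ≤ W ^ Q := le_self_pow₀ hW1 hQ0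
  have h1 : 1 + ‖w + z‖ ≤ 2 * W ^ Q := by
    have := norm_add_le w z
    linarith [norm_nonneg w]
  have h2 : ‖a z‖⁻¹ ≤ c⁻¹ * W ^ (Q * P) := by
    have h3 : c * ‖z‖ ^ m₀ ≤ ‖a z‖ := hlow z hz
    have h4 : 0 < c * ‖z‖ ^ m₀ := mul_pos hc (Real.rpow_pos_of_pos (by linarith) _)
    calc ‖a z‖⁻¹ ≤ (c * ‖z‖ ^ m₀)⁻¹ := inv_anti₀ h4 h3
      _ = c⁻¹ * ‖z‖ ^ (-m₀) := by rw [mul_inv, Real.rpow_neg (by linarith)]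
      _ ≤ c⁻¹ * ‖z‖ ^ (P : ℝ) := by
          gcongr
      _ ≤ c⁻¹ * W ^ (Q * P) := by
          rw [Real.rpow_natCast, pow_mul]
          gcongr
  have h5 : ‖iteratedFDeriv ℝ j a (w + z)‖ ≤ C * 2 ^ M * W ^ (Q * M) := by
    refine (hb _).trans ?_
    rw [mul_assoc, pow_mul, ← mul_pow]
    gcongr
  have hzr : 0 < ‖z‖ ^ ρ := Real.rpow_pos_of_pos (by linarith) _
  have h6 : 1 ≤ ‖z‖ ^ (-ρ) * W := by
    rw [Real.rpow_neg (by linarith), inv_mul_eq_div, le_div_iff₀ hzr, one_mul]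
    exact hzW
  have hWK : 1 ≤ W ^ (Q * M + Q * P) := one_le_pow₀ hW1
  have hzn : 0 ≤ ‖z‖ ^ (-ρ) := by positivity
  calc _ ≤ ‖a z‖⁻¹ * ‖iteratedFDeriv ℝ j a (w + z)‖ + 1 :=
        norm_iteratedFDeriv_relVar_le ha.smooth j z w
    _ ≤ (c⁻¹ * W ^ (Q * P)) * (C * 2 ^ M * W ^ (Q * M)) + 1 * W ^ (Q * M + Q * P) := by
        rw [one_mul]; gcongr
    _ = (C * 2 ^ M * c⁻¹ + 1) * W ^ (Q * M + Q * P) * 1 := by rw [pow_add]; ring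
    _ ≤ (C * 2 ^ M * c⁻¹ + 1) * W ^ (Q * M + Q * P) * (‖z‖ ^ (-ρ) * W) := by gcongr
    _ = (C * 2 ^ M * c⁻¹ + 1) * ‖z‖ ^ (-ρ) * W ^ (Q * M + Q * P + 1) := by rw [pow_succ]; ring
    _ = _ := by rw [hW, mul_pow]; ring

/-- The symbols `relVar a z` are `O(|z|^{-ρ})` in a fixed space of symbols of polynomial growth. -/
theorem ShubinSymbol.exists_relVar_bound (ha : ShubinSymbol ρ m₁ m₀ a) (hρ : 0 < ρ) (hρ1 : ρ ≤ 1) :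
    ∃ (R : ℝ) (K : ℕ), 1 ≤ R ∧ (∀ z, R ≤ ‖z‖ → a z ≠ 0) ∧ ∀ j : ℕ, ∃ C, 0 ≤ C ∧
      ∀ z, R ≤ ‖z‖ → ∀ w,
      ‖iteratedFDeriv ℝ j (relVar a z) w‖ ≤ C * ‖z‖ ^ (-ρ) * (1 + ‖w‖) ^ K := by
  obtain ⟨R₁, hR₁, h₁⟩ := ha.relVar_near hρ hρ1
  obtain ⟨R₂, K, hR₂, h0, h₂⟩ := ha.relVar_far hρ
  refine ⟨max R₁ R₂, K + 1, hR₁.trans (le_max_left _ _),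
    fun z hz => h0 z ((le_max_right _ _).trans hz), fun j => ?_⟩
  obtain ⟨C₁, hC₁, hb₁⟩ := h₁ j
  obtain ⟨C₂, hC₂, hb₂⟩ := h₂ j
  refine ⟨max C₁ C₂, hC₁.trans (le_max_left _ _), fun z hz w => ?_⟩
  have hz₁ := (le_max_left _ _).trans hz
  have hz₂ := (le_max_right _ _).trans hz
  rcases le_or_gt ‖w‖ (‖z‖ ^ ρ / 2) with hw | hw
  · refine (hb₁ z w hz₁ (h0 z hz₂) hw).trans ?_
    gcongr
    · exact le_max_left _ _
    · exact le_self_pow₀ (by linarith [norm_nonneg w]) (Nat.succ_ne_zero _)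
  · refine (hb₂ z w hz₂ hw).trans ?_
    gcongr
    exact le_max_right _ _

end SlowlyVarying

/-! ### Hypoellipticity -/

section Hypoelliptic

/-- The displacement of the symbol under conjugation with a phase-space shift. -/
noncomputable def fullScale (z : Rn (ι ⊕ ι)) : Rn (ι ⊕ ι) :=
  join (leftPart z) ((2 * Real.pi) • rightPart z)

theorem norm_le_norm_fullScale (z : Rn (ι ⊕ ι)) : ‖z‖ ≤ ‖fullScale z‖ := by
  refine abs_le_of_sq_le_sq' ?_ (norm_nonneg _) |>.2
  have e1 : ‖z‖ ^ 2 = ‖leftPart z‖ ^ 2 + ‖rightPart z‖ ^ 2 := by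
    rw [← norm_join_sq, join_left_right]
  have hpi : 1 ≤ 2 * Real.pi := by linarith [Real.pi_gt_three]
  rw [e1, fullScale, norm_join_sq, norm_smul, Real.norm_of_nonneg (by positivity), mul_pow]
  nlinarith [sq_nonneg ‖rightPart z‖, one_le_pow₀ (n := 2) hpi]

/-- Covariance of the Wigner transform under phase-space shifts. -/
theorem cw_shift_shift (z : Rn (ι ⊕ ι)) (f g : 𝓢(Rn ι, ℂ)) (w : Rn (ι ⊕ ι)) :
    cw (shift z f) (shift (refl z) g) w = cw f g (w - fullScale z) := by
  rw [cw_apply, cw_apply]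
  congr 1
  refine integral_congr_ae (Filter.Eventually.of_forall fun y => ?_)
  simp only [shift_apply, leftPart_refl, rightPart_refl]
  set p := leftPart z
  set q := rightPart z
  have e1 : leftPart (w - fullScale z) = leftPart w - p := rfl
  have e2 : rightPart (w - fullScale z) = rightPart w - (2 * Real.pi) • q := rfl
  rw [e1, e2, ← cis_two_pi_inv_mul, ← cis_two_pi_inv_mul]
  have a1 : leftPart w - p + (1 / 2 : ℝ) • y = leftPart w + (1 / 2 : ℝ) • y - p := by module
  have a2 : leftPart w - p - (1 / 2 : ℝ) • y = leftPart w - (1 / 2 : ℝ) • y - p := by module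
  rw [a1, a2]
  have a3 : (2 * Real.pi)⁻¹ * -⟪rightPart w - (2 * Real.pi) • q, y⟫ =
      (2 * Real.pi)⁻¹ * -⟪rightPart w, y⟫ + ⟪q, leftPart w + (1 / 2 : ℝ) • y⟫ +
        ⟪-q, leftPart w - (1 / 2 : ℝ) • y⟫ := by
    simp only [inner_sub_left, inner_sub_right, inner_add_right, inner_smul_left, inner_smul_right,
      inner_neg_left, conj_trivial]
    field_simp
    ring
  rw [a3, cis_add, cis_add]
  ring

/-- The transpose of `shift z` is inverse to `shift (refl z)`. -/
theorem integral_shift_mul_shift_refl (z : Rn (ι ⊕ ι)) (f g : 𝓢(Rn ι, ℂ)) :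
    ∫ t, shift z f t * shift (refl z) g t = ∫ t, f t * g t := by
  rw [← integral_sub_right_eq_self (fun t => f t * g t) (leftPart z)]
  refine integral_congr_ae (Filter.Eventually.of_forall fun t => ?_)
  simp only [shift_apply, leftPart_refl, rightPart_refl]
  have : cis ⟪rightPart z, t⟫ * cis ⟪-rightPart z, t⟫ = 1 := by
    rw [← cis_add, inner_neg_left, add_neg_cancel, cis_zero]
  linear_combination f (t - leftPart z) * g (t - leftPart z) * this

theorem exists_shift_eq (z : Rn (ι ⊕ ι)) (φ : 𝓢(Rn ι, ℂ)) : ∃ f, shift z f = φ := by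
  refine ⟨cis (-⟪rightPart z, leftPart z⟫) • shift (-z) φ, ?_⟩
  ext t
  rw [shift_apply, smul_apply, shift_apply, smul_eq_mul]
  have e1 : leftPart (-z) = -leftPart z := rfl
  have e2 : rightPart (-z) = -rightPart z := rfl
  rw [e1, e2, sub_neg_eq_add, sub_add_cancel, ← mul_assoc, ← mul_assoc, ← cis_add, ← cis_add]
  have : ⟪rightPart z, t⟫ + -⟪rightPart z, leftPart z⟫ + ⟪-rightPart z, t - leftPart z⟫ = 0 := by
    rw [inner_neg_left, inner_sub_right]; ring
  rw [this, cis_zero, one_mul]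

/-- Conjugation of a Weyl operator with a phase-space shift translates its symbol; the constant part
of the translated symbol is split off. -/
theorem IsTranspose.apply_shift {K : ℕ} {a : Rn (ι ⊕ ι) → ℂ}
    {T : 𝓢(Rn ι, ℂ) →L[ℂ] 𝓢(Rn ι, ℂ)} (hT : IsTranspose a T) {z : Rn (ι ⊕ ι)}
    (haz : a (fullScale z) ≠ 0) (hr : IsSymbol K (relVar a (fullScale z)))
    {T' : 𝓢(Rn ι, ℂ) →L[ℂ] 𝓢(Rn ι, ℂ)} (hT' : IsTranspose (relVar a (fullScale z)) T')
    (g : 𝓢(Rn ι, ℂ)) :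
    T (shift (refl z) g) = a (fullScale z) • shift (refl z) (g + T' g) := by
  refine emb_injective fun φ => ?_
  obtain ⟨f, rfl⟩ := exists_shift_eq z φ
  simp only [smul_apply, smul_eq_mul, mul_left_comm _ (a (fullScale z))]
  rw [hT, integral_const_mul, integral_shift_mul_shift_refl]
  simp only [cw_shift_shift, add_apply, mul_add]
  have hi : ∀ f g : 𝓢(Rn ι, ℂ), Integrable fun x => f x * g x := fun f g =>
    (SchwartzMap.pairing (ContinuousLinearMap.mul ℂ ℂ) f g).integrable
  have hi' : Integrable fun w => relVar a (fullScale z) w * cw f g w := by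
    have := (smulLeftCLM ℂ (relVar a (fullScale z)) (cw f g)).integrable (μ := volume)
    refine this.congr (Filter.Eventually.of_forall fun w => ?_)
    simp only [smulLeftCLM_apply_apply hr.hasTemperateGrowth, smul_eq_mul]
  rw [integral_add (hi _ _) (hi _ _), hT', ← integral_cw, ← integral_add (cw f g).integrable hi',
    ← integral_const_mul, ← integral_add_right_eq_self _ (fullScale z)]
  refine integral_congr_ae (Filter.Eventually.of_forall fun w => ?_)
  simp only [add_sub_cancel_right, relVar]
  field_simp
  ring

/-- A tempered distribution in the kernel of the dual extension of a Weyl operator with symbol in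
the class `HΓ` is a Schwartz function. The decay of `u(shift z g)` in `z` improves by `|z|^{-ρ}`
each time the equation is used. -/
theorem ShubinSymbol.exists_schwartz_of_ker {ρ m₁ m₀ : ℝ} {a : Rn (ι ⊕ ι) → ℂ}
    (ha : ShubinSymbol ρ m₁ m₀ a) (hρ : 0 < ρ) (hρ1 : ρ ≤ 1)
    {T : 𝓢(Rn ι, ℂ) →L[ℂ] 𝓢(Rn ι, ℂ)} (hT : IsTranspose a T) (u : 𝓢(Rn ι, ℂ) →L[ℂ] ℂ)
    (hu : ∀ g, u (T g) = 0) : ∃ F : 𝓢(Rn ι, ℂ), ∀ g, u g = ∫ x, g x * F x := by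
  obtain ⟨R, K, hR, h0, hb⟩ := ha.exists_relVar_bound hρ hρ1
  choose C hC hb using hb
  have hsym : ∀ z, R ≤ ‖z‖ → IsSymbol K (relVar a z) := fun z hz =>
    ⟨contDiff_relVar ha.smooth z, fun j => ⟨_, hb j z hz⟩⟩
  -- one application of the equation, lowering the order of growth from `t` to `t - ρ`
  have hstep : ∀ t : ℝ, (∃ (N : ℕ) (A : ℝ), 0 ≤ A ∧ ∀ g z,
      ‖u (shift (refl z) g)‖ ≤ A * (1 + ‖z‖) ^ t * snorm N g) →
      ∃ (N : ℕ) (A : ℝ), 0 ≤ A ∧ ∀ g z,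
        ‖u (shift (refl z) g)‖ ≤ A * (1 + ‖z‖) ^ (t - ρ) * snorm N g := by
    rintro t ⟨N, A, hA, h⟩
    obtain ⟨L, N', D, hD, hTb⟩ := transpose_bound ι K N
    set S := ∑ j ∈ Finset.range (L + 1), C j
    have hS : ∀ j ≤ L, C j ≤ S := fun j hj =>
      Finset.single_le_sum (fun i _ => hC i) (Finset.mem_range.2 (by omega))
    have hS0 : 0 ≤ S := Finset.sum_nonneg fun i _ => hC i
    refine ⟨max N N', A * max ((1 + R) ^ ρ) (D * S * 2 ^ ρ), by positivity, fun g z => ?_⟩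
    have hz0 : 0 < 1 + ‖z‖ := by positivity
    have e0 : (1 + ‖z‖) ^ t = (1 + ‖z‖) ^ (t - ρ) * (1 + ‖z‖) ^ ρ := by
      rw [← Real.rpow_add hz0, sub_add_cancel]
    rcases le_total ‖z‖ R with hz | hz
    · refine (h g z).trans ?_
      calc A * (1 + ‖z‖) ^ t * snorm N g
          = A * (1 + ‖z‖) ^ ρ * (1 + ‖z‖) ^ (t - ρ) * snorm N g := by rw [e0]; ring
        _ ≤ A * max ((1 + R) ^ ρ) (D * S * 2 ^ ρ) * (1 + ‖z‖) ^ (t - ρ) * snorm (max N N') g := by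
          gcongr
          · refine le_trans ?_ (le_max_left _ _)
            gcongr
          · exact snorm_mono (le_max_left _ _) g
    · have hz' : R ≤ ‖fullScale z‖ := hz.trans (norm_le_norm_fullScale z)
      have hr := hsym _ hz'
      obtain ⟨T', hT'⟩ := exists_transpose hr
      -- `0 = u (T (shift (refl z) g)) = a (fullScale z) * u (shift (refl z) (g + T' g))`
      have h1 : u (shift (refl z) g) = -u (shift (refl z) (T' g)) := by
        have h2 := hu (shift (refl z) g)
        rw [hT.apply_shift (h0 _ hz') hr hT', map_smul, smul_eq_mul, map_add, map_add] at h2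
        have h3 := (mul_eq_zero.1 h2).resolve_left (h0 _ hz')
        exact eq_neg_of_add_eq_zero_left h3
      have h4 : snorm N (T' g) ≤ D * (S * ‖fullScale z‖ ^ (-ρ)) * snorm N' g :=
        hTb _ hr _ (fun j hj w => (hb j _ hz' w).trans (by
          gcongr
          exact hS j hj)) _ g fun f => hT' f g
      have h5 : ‖fullScale z‖ ^ (-ρ) ≤ 2 ^ ρ * (1 + ‖z‖) ^ (-ρ) := by
        have hz1 : 1 ≤ ‖z‖ := hR.trans hz
        calc ‖fullScale z‖ ^ (-ρ) ≤ ((1 + ‖z‖) / 2) ^ (-ρ) :=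
              Real.rpow_le_rpow_of_nonpos (by positivity)
                (by linarith [norm_le_norm_fullScale z]) (by linarith)
          _ = 2 ^ ρ * (1 + ‖z‖) ^ (-ρ) := by
              rw [Real.div_rpow (by positivity) (by norm_num),
                Real.rpow_neg (by norm_num : (0:ℝ) ≤ 2)]
              field_simp
      have e1 : (1 + ‖z‖) ^ t * (1 + ‖z‖) ^ (-ρ) = (1 + ‖z‖) ^ (t - ρ) := by
        rw [← Real.rpow_add hz0, sub_eq_add_neg]
      rw [h1, norm_neg]
      calc _ ≤ A * (1 + ‖z‖) ^ t * snorm N (T' g) := h _ z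
        _ ≤ A * (1 + ‖z‖) ^ t * (D * (S * (2 ^ ρ * (1 + ‖z‖) ^ (-ρ))) * snorm N' g) := by
          gcongr
          exact h4.trans (by gcongr)
        _ = A * (D * S * 2 ^ ρ) * ((1 + ‖z‖) ^ t * (1 + ‖z‖) ^ (-ρ)) * snorm N' g := by ring
        _ ≤ A * max ((1 + R) ^ ρ) (D * S * 2 ^ ρ) * (1 + ‖z‖) ^ (t - ρ) * snorm (max N N') g := by
          rw [e1]
          gcongr
          · exact le_max_right _ _
          · exact snorm_mono (le_max_right _ _) g
  obtain ⟨N₀, C₀, hC₀, hu₀⟩ := exists_functional_le_snorm u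
  obtain ⟨N₁, C₁, hC₁, hs₁⟩ := snorm_shift_le (ι := ι) N₀
  -- the iteration starts from the polynomial growth given by the continuity of `u`
  have hiter : ∀ i : ℕ, ∃ (N : ℕ) (A : ℝ), 0 ≤ A ∧ ∀ g z,
      ‖u (shift (refl z) g)‖ ≤ A * (1 + ‖z‖) ^ ((N₁ : ℝ) - i * ρ) * snorm N g := fun i => by
    induction i with
    | zero =>
      refine ⟨N₁, C₀ * C₁, by positivity, fun g z => (hu₀ _).trans ?_⟩
      have := hs₁ g (refl z)
      rw [norm_refl] at this
      simp only [Nat.cast_zero, zero_mul, sub_zero, Real.rpow_natCast]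
      calc _ ≤ C₀ * (C₁ * (1 + ‖z‖) ^ N₁ * snorm N₁ g) := by gcongr
        _ = _ := by ring
    | succ i ih =>
      have := hstep _ ih
      rwa [sub_sub, ← add_one_mul, ← Nat.cast_succ] at this
  obtain ⟨h, hh⟩ := exists_schwartz_ne_zero ι
  obtain ⟨k, hk⟩ := exists_dual_window (h := h) (fun h0 => hh (by rw [h0]; rfl))
  obtain ⟨F, hF, -⟩ := exists_schwartz_of_decay hk u fun N => by
    obtain ⟨i, hi⟩ := exists_nat_ge (((N₁ : ℝ) + N) / ρ)
    rw [div_le_iff₀ hρ] at hi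
    obtain ⟨N', A, hA, hb⟩ := hiter i
    refine ⟨A * snorm N' h, fun z => ?_⟩
    have h1 := hb h (refl z)
    have h2 : refl (refl z) = z := by simp [refl]
    rw [norm_refl, h2] at h1
    have hz1 : 1 ≤ 1 + ‖z‖ := by linarith [norm_nonneg z]
    have h3 : (1 + ‖z‖) ^ ((N₁ : ℝ) - i * ρ) ≤ (1 + ‖z‖) ^ (-(N : ℝ)) :=
      Real.rpow_le_rpow_of_exponent_le hz1 (by linarith)
    have h4 : (1 + ‖z‖) ^ N * (1 + ‖z‖) ^ (-(N : ℝ)) = 1 := by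
      rw [Real.rpow_neg (by positivity), Real.rpow_natCast, mul_inv_cancel₀ (by positivity)]
    calc _ ≤ (1 + ‖z‖) ^ N * (A * (1 + ‖z‖) ^ (-(N : ℝ)) * snorm N' h) := by
          gcongr
          exact h1.trans (by gcongr)
      _ = A * snorm N' h * ((1 + ‖z‖) ^ N * (1 + ‖z‖) ^ (-(N : ℝ))) := by ring
      _ = _ := by rw [h4, mul_one]
  exact ⟨F, hF⟩

end Hypoelliptic

/-! ### Tensor products -/

section Tensor

theorem integral_tensor (f : Rn ι → ℂ) (g : Rn κ → ℂ) :
    ∫ z : Rn (ι ⊕ κ), f (leftPart z) * g (rightPart z) = (∫ x, f x) * ∫ y, g y := by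
  rw [← measurePreserving_join.integral_comp measurableEmbedding_join, ← integral_prod_mul]
  rfl

/-- The regrouping `(x, y; ξ, η) ↦ (x, ξ; y, η)` of phase space coordinates. -/
noncomputable def regroup : Rn ((ι ⊕ κ) ⊕ (ι ⊕ κ)) ≃ₗᵢ[ℝ] Rn ((ι ⊕ ι) ⊕ (κ ⊕ κ)) :=
  LinearIsometryEquiv.piLpCongrLeft 2 ℝ ℝ (Equiv.sumSumSumComm ι κ ι κ)

theorem leftPart_regroup (z : Rn ((ι ⊕ κ) ⊕ (ι ⊕ κ))) :
    leftPart (regroup z) = join (leftPart (leftPart z)) (leftPart (rightPart z)) := by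
  ext i
  cases i <;> rfl

theorem rightPart_regroup (z : Rn ((ι ⊕ κ) ⊕ (ι ⊕ κ))) :
    rightPart (regroup z) = join (rightPart (leftPart z)) (rightPart (rightPart z)) := by
  ext i
  cases i <;> rfl

/-- The Wigner transform of tensor products is a tensor product, after regrouping phase space. -/
theorem cw_stensor (f f' : 𝓢(Rn ι, ℂ)) (g g' : 𝓢(Rn κ, ℂ)) (z : Rn ((ι ⊕ κ) ⊕ (ι ⊕ κ))) :
    cw (stensor f g) (stensor f' g') z =
      cw f f' (leftPart (regroup z)) * cw g g' (rightPart (regroup z)) := by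
  simp only [cw_apply, stensor_apply, leftPart_regroup, rightPart_regroup, leftPart_join,
    rightPart_join]
  rw [Fintype.card_sum, pow_add, mul_mul_mul_comm, ← integral_tensor]
  congr 1
  refine integral_congr_ae (Filter.Eventually.of_forall fun y => ?_)
  simp only
  have e : ⟪rightPart z, y⟫ = ⟪leftPart (rightPart z), leftPart y⟫ +
      ⟪rightPart (rightPart z), rightPart y⟫ := by
    rw [← inner_join, join_left_right, join_left_right]
  have e' : ∀ (u v : Rn (ι ⊕ κ)) (c : ℝ), leftPart (u + c • v) = leftPart u + c • leftPart v ∧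
    rightPart (u + c • v) = rightPart u + c • rightPart v ∧
    leftPart (u - c • v) = leftPart u - c • leftPart v ∧
    rightPart (u - c • v) = rightPart u - c • rightPart v := fun _ _ _ => ⟨rfl, rfl, rfl, rfl⟩
  rw [(e' _ _ _).1, (e' _ _ _).2.1, (e' _ _ _).2.2.1, (e' _ _ _).2.2.2, e, neg_add,
    Complex.ofReal_add, add_mul, Complex.exp_add]
  ring

theorem shift_stensor (z : Rn ((ι ⊕ κ) ⊕ (ι ⊕ κ))) (f : 𝓢(Rn ι, ℂ)) (g : 𝓢(Rn κ, ℂ)) :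
    shift z (stensor f g) =
      stensor (shift (leftPart (regroup z)) f) (shift (rightPart (regroup z)) g) := by
  ext t
  simp only [shift_apply, stensor_apply, leftPart_regroup, rightPart_regroup, leftPart_join,
    rightPart_join]
  have e : ⟪rightPart z, t⟫ = ⟪leftPart (rightPart z), leftPart t⟫ +
      ⟪rightPart (rightPart z), rightPart t⟫ := by
    rw [← inner_join, join_left_right, join_left_right]
  have e1 : leftPart (t - leftPart z) = leftPart t - leftPart (leftPart z) := rfl
  have e2 : rightPart (t - leftPart z) = rightPart t - rightPart (leftPart z) := rfl
  rw [e, cis_add, e1, e2]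
  ring

/-- Tensor products are total in the Schwartz space: all phase-space shifts of a tensor window are
tensor products. -/
theorem functional_eq_zero_of_tensor {u : 𝓢(Rn (ι ⊕ κ), ℂ) →L[ℂ] ℂ}
    (h : ∀ f g, u (stensor f g) = 0) : u = 0 := by
  obtain ⟨h₁, h₂, K, hK⟩ := exists_tensor_window ι κ
  ext g
  have h1 := functional_eq_integral K (stensor h₁ h₂) g u
  rw [hK, one_mul] at h1
  rw [← h1]
  simp [shift_stensor, h]

theorem functional_eq_of_tensor {u v : 𝓢(Rn (ι ⊕ κ), ℂ) →L[ℂ] ℂ}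
    (h : ∀ f g, u (stensor f g) = v (stensor f g)) : u = v :=
  sub_eq_zero.1 (functional_eq_zero_of_tensor fun f g => by
    change u _ - v _ = 0
    rw [h, sub_self])

/-- The symbol `(a ⊗ 1)(x, y; ξ, η) = a(x, ξ)`. -/
def symbolTensorOne (a : Rn (ι ⊕ ι) → ℂ) (z : Rn ((ι ⊕ κ) ⊕ (ι ⊕ κ))) : ℂ :=
  a (join (leftPart (leftPart z)) (leftPart (rightPart z)))

theorem IsSymbol.comp_clm {E F : Type*} [NormedAddCommGroup E] [NormedSpace ℝ E]
    [NormedAddCommGroup F] [NormedSpace ℝ F] {M : ℕ} {a : F → ℂ} (ha : IsSymbol M a)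
    (l : E →L[ℝ] F) : IsSymbol M fun z => a (l z) where
  smooth := ha.smooth.comp l.contDiff
  bound j := by
    obtain ⟨C, hC⟩ := ha.bound j
    have h0 : 0 ≤ C := by simpa using (norm_nonneg _).trans (hC 0)
    refine ⟨‖l‖ ^ j * (C * (1 + ‖l‖) ^ M), fun z => ?_⟩
    refine (norm_iteratedFDeriv_comp_clm_le ha.smooth l j z).trans ?_
    rw [mul_assoc, mul_assoc, ← mul_pow]
    gcongr
    refine (hC _).trans ?_
    gcongr
    nlinarith [l.le_opNorm z, norm_nonneg l, norm_nonneg z]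

/-- The regrouping followed by the projection to the first factor. -/
noncomputable def leftRegroup : Rn ((ι ⊕ κ) ⊕ (ι ⊕ κ)) →L[ℝ] Rn (ι ⊕ ι) :=
  (leftCLM (ι := ι ⊕ ι) (κ := κ ⊕ κ)) ∘L
    (regroup (ι := ι) (κ := κ)).toContinuousLinearEquiv.toContinuousLinearMap

theorem leftRegroup_apply (z : Rn ((ι ⊕ κ) ⊕ (ι ⊕ κ))) :
    leftRegroup z = join (leftPart (leftPart z)) (leftPart (rightPart z)) := leftPart_regroup z

theorem IsSymbol.tensorOne {M : ℕ} {a : Rn (ι ⊕ ι) → ℂ} (ha : IsSymbol M a) :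
    IsSymbol M (symbolTensorOne (κ := κ) a) := by
  have h := ha.comp_clm (leftRegroup (ι := ι) (κ := κ))
  simp only [leftRegroup_apply] at h
  exact h

variable {M : ℕ} {a : Rn (ι ⊕ ι) → ℂ} {T : 𝓢(Rn ι, ℂ) →L[ℂ] 𝓢(Rn ι, ℂ)}
  {T₁ : 𝓢(Rn (ι ⊕ κ), ℂ) →L[ℂ] 𝓢(Rn (ι ⊕ κ), ℂ)}

/-- The operator with symbol `a ⊗ 1` acts on the first variable only. -/
theorem IsTranspose.apply_stensor (ha : IsSymbol M a) (hT : IsTranspose a T)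
    (hT₁ : IsTranspose (symbolTensorOne (κ := κ) a) T₁) (ψ : 𝓢(Rn ι, ℂ)) (χ : 𝓢(Rn κ, ℂ)) :
    T₁ (stensor ψ χ) = stensor (T ψ) χ := by
  refine emb_injective fun f => ?_
  have h := functional_eq_of_tensor (u := weylFunctional (symbolTensorOne a) (stensor ψ χ))
    (v := embF (stensor (T ψ) χ)) fun ψ' χ' => by
      rw [weylFunctional_apply ha.tensorOne.hasTemperateGrowth, embF_apply]
      have e1 : ∀ z : Rn ((ι ⊕ κ) ⊕ (ι ⊕ κ)),
          symbolTensorOne a z * cw (stensor ψ' χ') (stensor ψ χ) z =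
          (fun z => (a (leftPart z) * cw ψ' ψ (leftPart z)) * cw χ' χ (rightPart z))
            (regroup z) := fun z => by
        rw [cw_stensor, symbolTensorOne, ← leftPart_regroup, ← mul_assoc]
      simp only [e1]
      rw [(regroup (ι := ι) (κ := κ)).measurePreserving.integral_comp
        (regroup (ι := ι) (κ := κ)).toHomeomorph.measurableEmbedding (fun z => (a (leftPart z) * cw ψ' ψ (leftPart z)) * cw χ' χ (rightPart z)),
        integral_tensor (fun z => a z * cw ψ' ψ z) (fun z => cw χ' χ z), integral_cw, ← hT,
        ← integral_tensor]
      refine integral_congr_ae (Filter.Eventually.of_forall fun y => ?_)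
      simp only [stensor_apply]
      ring
  have h1 := DFunLike.congr_fun h f
  rw [weylFunctional_apply ha.tensorOne.hasTemperateGrowth, embF_apply] at h1
  rw [hT₁, h1]
  simp only [mul_comm]

/-- If `φ` lies in the kernel of the operator with symbol `a`, then all `φ ⊗ χ` lie in the kernel of the
operator with symbol `a ⊗ 1`; stated for transposes. -/
theorem partialPairing_transpose_eq_zero (ha : IsSymbol M a) (hT : IsTranspose a T)
    (hT₁ : IsTranspose (symbolTensorOne (κ := κ) a) T₁) {φ : 𝓢(Rn ι, ℂ)}
    (hφ : ∀ ψ, ∫ x, φ x * T ψ x = 0) (Φ : 𝓢(Rn (ι ⊕ κ), ℂ)) :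
    partialPairing φ (T₁ Φ) = 0 := by
  ext y
  have h := functional_eq_zero_of_tensor
    (u := (toFunctional (TemperedDistribution.delta y)) ∘L (partialPairing φ) ∘L T₁)
    fun ψ χ => by
      change partialPairing φ (T₁ (stensor ψ χ)) y = 0
      rw [hT.apply_stensor ha hT₁, partialPairing_apply]
      simp only [stensor_apply, leftPart_join, rightPart_join, ← mul_assoc]
      rw [integral_mul_const, hφ, zero_mul]
  exact DFunLike.congr_fun h Φ

/-- If the operator with symbol `a ⊗ 1` has a nontrivial kernel on tempered distributions, then so
has the operator with symbol `a` on Schwartz functions. A distribution `v` in the first kernel is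
nonzero on some `ψ ⊗ χ`, and `v(· ⊗ χ)` lies in the second kernel, hence is a Schwartz function. -/
theorem exists_ker_of_ker_tensorOne {ρ m₁ m₀ : ℝ} (ha : ShubinSymbol ρ m₁ m₀ a) (hρ : 0 < ρ)
    (hρ1 : ρ ≤ 1) (hT : IsTranspose a T) (hT₁ : IsTranspose (symbolTensorOne (κ := κ) a) T₁)
    {v : 𝓢(Rn (ι ⊕ κ), ℂ) →L[ℂ] ℂ} (hv : v ≠ 0) (hv0 : ∀ Φ, v (T₁ Φ) = 0) :
    ∃ φ : 𝓢(Rn ι, ℂ), φ ≠ 0 ∧ ∀ ψ, ∫ x, φ x * T ψ x = 0 := by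
  obtain ⟨M, haM⟩ := ha.exists_isSymbol hρ
  obtain ⟨ψ, χ, hne⟩ : ∃ ψ χ, v (stensor ψ χ) ≠ 0 := by
    by_contra! hcon
    exact hv (functional_eq_zero_of_tensor hcon)
  have hker : ∀ g, (v ∘L stensorLeft χ) (T g) = 0 := fun g => by
    change v (stensor (T g) χ) = 0
    rw [← hT.apply_stensor haM hT₁, hv0]
  obtain ⟨F, hF⟩ := ha.exists_schwartz_of_ker hρ hρ1 hT (v ∘L stensorLeft χ) hker
  refine ⟨F, fun h0 => hne ?_, fun g => ?_⟩
  · change (v ∘L stensorLeft χ) ψ = 0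
    rw [hF, h0]
    simp
  · rw [← hker g, hF]
    simp only [mul_comm]

end Tensor

/-! ### Symplectic covariance of the Wigner transform -/

section Covariance

theorem exists_integral_comp_linearEquiv (s : Rn ι ≃ₗ[ℝ] Rn ι) :
    ∃ c : ℂ, c ≠ 0 ∧ ∀ F : Rn ι → ℂ, ∫ z, F (s z) = c * ∫ z, F z := by
  have hdet : LinearMap.det (s : Rn ι →ₗ[ℝ] Rn ι) ≠ 0 := (LinearEquiv.isUnit_det' s).ne_zero
  refine ⟨((|(LinearMap.det (s : Rn ι →ₗ[ℝ] Rn ι))⁻¹| : ℝ) : ℂ), ?_, fun F => ?_⟩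
  · simp [hdet]
  have h := Measure.map_linearMap_addHaar_eq_smul_addHaar (volume : Measure (Rn ι)) hdet
  have he : MeasurableEmbedding (s : Rn ι →ₗ[ℝ] Rn ι) :=
    s.toContinuousLinearEquiv.toHomeomorph.measurableEmbedding
  have h1 := he.integral_map (μ := volume) F
  rw [h, integral_smul_measure, ENNReal.toReal_ofReal (abs_nonneg _), Complex.real_smul] at h1
  exact h1.symm

/-- The pair `(S, U)` intertwines the Wigner transform with the phase space map `σ`, up to a
nonzero constant. For metaplectic `S` and `U f = conj (S (conj f))` the constant is `1`; only its
being nonzero matters. -/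
def WignerCovariant (S U : 𝓢(Rn ι, ℂ) →L[ℂ] 𝓢(Rn ι, ℂ)) (σ : Rn (ι ⊕ ι) → Rn (ι ⊕ ι)) : Prop :=
  ∃ c : ℂ, c ≠ 0 ∧ ∀ f g z, cw (S f) (U g) (σ z) = c * cw f g z

theorem WignerCovariant.comp {S S' U U' : 𝓢(Rn ι, ℂ) →L[ℂ] 𝓢(Rn ι, ℂ)}
    {σ σ' : Rn (ι ⊕ ι) → Rn (ι ⊕ ι)} (h : WignerCovariant S U σ) (h' : WignerCovariant S' U' σ') :
    WignerCovariant (S ∘L S') (U ∘L U') (σ ∘ σ') := by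
  obtain ⟨c, hc, h⟩ := h
  obtain ⟨c', hc', h'⟩ := h'
  refine ⟨c * c', mul_ne_zero hc hc', fun f g z => ?_⟩
  change cw (S (S' f)) (U (U' g)) (σ (σ' z)) = _
  rw [h, h', mul_assoc]

theorem cw_smul_smul (b c : ℂ) (f g : 𝓢(Rn ι, ℂ)) (z : Rn (ι ⊕ ι)) :
    cw (b • f) (c • g) z = b * c * cw f g z := by
  rw [← cwLeft_apply, map_smul, smul_apply, cwLeft_apply, ← cwRight_apply, map_smul, smul_apply,
    cwRight_apply, smul_eq_mul, smul_eq_mul, mul_assoc]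

theorem WignerCovariant.smul {S U : 𝓢(Rn ι, ℂ) →L[ℂ] 𝓢(Rn ι, ℂ)}
    {σ : Rn (ι ⊕ ι) → Rn (ι ⊕ ι)} (h : WignerCovariant S U σ) {b b' : ℂ} (hb : b ≠ 0)
    (hb' : b' ≠ 0) : WignerCovariant (b • S) (b' • U) σ := by
  obtain ⟨c, hc, h⟩ := h
  refine ⟨b * b' * c, mul_ne_zero (mul_ne_zero hb hb') hc, fun f g z => ?_⟩
  change cw (b • S f) (b' • U g) (σ z) = _
  rw [cw_smul_smul, h, ← mul_assoc]

/-! #### Chirps -/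

theorem hasTemperateGrowth_chirp (P : Rn ι →ₗ[ℝ] Rn ι) : Function.HasTemperateGrowth
    fun x : Rn ι => Complex.exp ((1 / 2 * ⟪P x, x⟫ : ℝ) * Complex.I) := by
  refine hasTemperateGrowth_cexp_mul_I.comp (f := fun x : Rn ι => 1 / 2 * ⟪P x, x⟫) ?_
  have h := (innerSL ℝ (E := Rn ι)).bilinear_hasTemperateGrowth
    (f := fun x : Rn ι => LinearMap.toContinuousLinearMap P x) (g := fun x => x)
    (LinearMap.toContinuousLinearMap P).hasTemperateGrowth
    (ContinuousLinearMap.id ℝ (Rn ι)).hasTemperateGrowth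
  exact (Function.HasTemperateGrowth.const (1 / 2 : ℝ)).mul h

/-- Multiplication by `exp (i/2 ⟨P x, x⟩)`. -/
noncomputable def chirp (P : Rn ι →ₗ[ℝ] Rn ι) : 𝓢(Rn ι, ℂ) →L[ℂ] 𝓢(Rn ι, ℂ) :=
  smulLeftCLM ℂ fun x => Complex.exp ((1 / 2 * ⟪P x, x⟫ : ℝ) * Complex.I)

theorem chirp_apply (P : Rn ι →ₗ[ℝ] Rn ι) (f : 𝓢(Rn ι, ℂ)) (x : Rn ι) :
    chirp P f x = Complex.exp ((1 / 2 * ⟪P x, x⟫ : ℝ) * Complex.I) * f x := by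
  rw [chirp, smulLeftCLM_apply_apply (hasTemperateGrowth_chirp P), smul_eq_mul]

theorem chirp_neg_chirp (P : Rn ι →ₗ[ℝ] Rn ι) (f : 𝓢(Rn ι, ℂ)) : chirp (-P) (chirp P f) = f := by
  ext x
  rw [chirp_apply, chirp_apply, ← mul_assoc, ← Complex.exp_add]
  simp

theorem chirp_chirp_neg (P : Rn ι →ₗ[ℝ] Rn ι) (f : 𝓢(Rn ι, ℂ)) : chirp P (chirp (-P) f) = f := by
  simpa using chirp_neg_chirp (-P) f

theorem wignerCovariant_chirp {P : Rn ι →ₗ[ℝ] Rn ι} (hP : P.IsSymmetric) :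
    WignerCovariant (chirp P) (chirp (-P))
      fun z => join (leftPart z) (rightPart z + P (leftPart z)) := by
  refine ⟨1, one_ne_zero, fun f g z => ?_⟩
  rw [one_mul, cw_apply, cw_apply]
  congr 1
  refine integral_congr_ae (Filter.Eventually.of_forall fun y => ?_)
  simp only [leftPart_join, rightPart_join, chirp_apply]
  set x := leftPart z
  set ξ := rightPart z
  have e : (-⟪ξ, y⟫ : ℝ) = -⟪ξ + P x, y⟫ + 1 / 2 * ⟪P (x + (1 / 2 : ℝ) • y), x + (1 / 2 : ℝ) • y⟫ +
      1 / 2 * ⟪(-P) (x - (1 / 2 : ℝ) • y), x - (1 / 2 : ℝ) • y⟫ := by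
    have h1 : ⟪P y, x⟫ = ⟪P x, y⟫ := by rw [hP y x, real_inner_comm]
    simp only [LinearMap.neg_apply, map_add, map_sub, map_smul, inner_add_left, inner_sub_left,
      inner_add_right, inner_sub_right, inner_smul_left, inner_smul_right, inner_neg_left,
      conj_trivial, h1]
    ring
  rw [e, Complex.ofReal_add, Complex.ofReal_add, add_mul, add_mul, Complex.exp_add,
    Complex.exp_add]
  ring

/-! #### Dilations -/

/-- Composition with a linear equivalence. -/
noncomputable def dilation (A : Rn ι ≃L[ℝ] Rn ι) : 𝓢(Rn ι, ℂ) →L[ℂ] 𝓢(Rn ι, ℂ) :=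
  compCLMOfContinuousLinearEquiv ℂ A

theorem dilation_apply (A : Rn ι ≃L[ℝ] Rn ι) (f : 𝓢(Rn ι, ℂ)) (x : Rn ι) :
    dilation A f x = f (A x) := rfl

theorem wignerCovariant_dilation (A : Rn ι ≃L[ℝ] Rn ι) :
    WignerCovariant (dilation A) (dilation A) fun z => join (A.symm (leftPart z))
      (LinearMap.adjoint (A : Rn ι →ₗ[ℝ] Rn ι) (rightPart z)) := by
  obtain ⟨c, hc, h⟩ := exists_integral_comp_linearEquiv A.toLinearEquiv
  refine ⟨c, hc, fun f g z => ?_⟩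
  rw [cw_apply, cw_apply, mul_left_comm, ← h]
  congr 1
  refine integral_congr_ae (Filter.Eventually.of_forall fun y => ?_)
  simp only [leftPart_join, rightPart_join, dilation_apply, map_add, map_sub, map_smul,
    ContinuousLinearEquiv.apply_symm_apply, LinearMap.adjoint_inner_left]
  rfl

/-! #### The Fourier transform -/

/-- The phase space map `(p, q) ↦ (q, -p)`. -/
noncomputable def quarterTurn (z : Rn (ι ⊕ ι)) : Rn (ι ⊕ ι) := join (rightPart z) (-leftPart z)

theorem fourier_shift (z : Rn (ι ⊕ ι)) (f : 𝓢(Rn ι, ℂ)) :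
    𝓕 (shift z f) = cis ⟪leftPart z, rightPart z⟫ • shift (quarterTurn z) (𝓕 f) := by
  ext η
  rw [smul_apply, shift_apply, smul_eq_mul, fourier_eq_cis, fourier_eq_cis]
  simp only [quarterTurn, leftPart_join, rightPart_join]
  rw [← mul_assoc, ← cis_add, ← integral_const_mul]
  conv_rhs => rw [← integral_sub_right_eq_self _ (leftPart z)]
  refine integral_congr_ae (Filter.Eventually.of_forall fun y => ?_)
  simp only [shift_apply]
  rw [← mul_assoc, ← mul_assoc, ← cis_add, ← cis_add]
  congr 2
  simp only [inner_sub_left, inner_sub_right, inner_neg_left, real_inner_comm y (rightPart z)]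
  ring

theorem fourierInv_eq_fourier_neg (f : 𝓢(Rn ι, ℂ)) (x : Rn ι) : 𝓕⁻ f x = 𝓕 f (-x) := by
  rw [fourierInv_coe, fourier_coe, Real.fourierInv_eq_fourier_neg]

theorem fourierInv_shift_refl (z : Rn (ι ⊕ ι)) (g : 𝓢(Rn ι, ℂ)) :
    𝓕⁻ (shift (refl z) g) =
      cis (-⟪leftPart z, rightPart z⟫) • shift (refl (quarterTurn z)) (𝓕⁻ g) := by
  ext η
  rw [fourierInv_eq_fourier_neg, fourier_shift, smul_apply, smul_apply, shift_apply, shift_apply,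
    fourierInv_eq_fourier_neg]
  simp [quarterTurn, inner_neg_right, neg_add_eq_sub]

theorem fourier_fourier (g : 𝓢(Rn ι, ℂ)) (x : Rn ι) : 𝓕 (𝓕 g) x = g (-x) := by
  have h := fourierInv_eq_fourier_neg (𝓕 g) (-x)
  rw [neg_neg] at h
  rw [← h, FourierTransform.fourierInv_fourier_eq]

/-- At the origin the Wigner transform is a parity pairing, and its invariance under the Fourier
transform is Parseval's identity. -/
theorem cw_fourier_zero (f g : 𝓢(Rn ι, ℂ)) : cw (𝓕 f) (𝓕⁻ g) 0 = cw f g 0 := by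
  rw [cw_apply, cw_apply]
  congr 1
  have e1 : leftPart (0 : Rn (ι ⊕ ι)) = 0 := rfl
  have e2 : rightPart (0 : Rn (ι ⊕ ι)) = 0 := rfl
  simp only [e1, e2, inner_zero_left, neg_zero, Complex.ofReal_zero, zero_mul, Complex.exp_zero,
    one_mul, zero_add, zero_sub, fourierInv_eq_fourier_neg, neg_neg]
  rw [Measure.integral_comp_smul volume (fun y => 𝓕 f y * 𝓕 g y),
    Measure.integral_comp_smul volume (fun y => f y * g (-y)), integral_fourier_mul_eq]
  simp only [fourier_fourier]

theorem fullScale_scaleL (w : Rn (ι ⊕ ι)) : fullScale (scaleL w) = w := by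
  rw [scaleL_apply, fullScale, leftPart_join, rightPart_join, smul_smul,
    mul_inv_cancel₀ (by positivity), one_smul, join_left_right]

/-- Every point of phase space is moved to the origin by shifting both arguments of the Wigner transform,
which reduces the claim to `cw_fourier_zero`. -/
theorem wignerCovariant_fourier :
    WignerCovariant (FourierTransform.fourierCLM ℂ 𝓢(Rn ι, ℂ))
      (FourierTransform.fourierInvCLM ℂ 𝓢(Rn ι, ℂ))
      fun z => join ((2 * Real.pi)⁻¹ • rightPart z) (-((2 * Real.pi) • leftPart z)) := by
  refine ⟨1, one_ne_zero, fun f g w => ?_⟩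
  change cw (𝓕 f) (𝓕⁻ g) (join ((2 * Real.pi)⁻¹ • rightPart w) (-((2 * Real.pi) • leftPart w))) = _
  obtain ⟨f₀, rfl⟩ := exists_shift_eq (scaleL w) f
  obtain ⟨g₀, rfl⟩ := exists_shift_eq (refl (scaleL w)) g
  rw [one_mul, fourier_shift, fourierInv_shift_refl, cw_smul_smul, ← cis_add, add_neg_cancel,
    cis_zero, one_mul, cw_shift_shift, cw_shift_shift, fullScale_scaleL, sub_self]
  have e : join ((2 * Real.pi)⁻¹ • rightPart w) (-((2 * Real.pi) • leftPart w)) =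
      fullScale (quarterTurn (scaleL w)) := by
    rw [scaleL_apply, quarterTurn, fullScale]
    simp only [leftPart_join, rightPart_join, smul_neg]
  rw [e, sub_self, cw_fourier_zero]

end Covariance

/-! ### Metaplectic operators -/

section Metaplectic

theorem conjOp_apply (V : 𝓢(Rn ι, ℂ) →L[ℂ] 𝓢(Rn ι, ℂ)) (f : 𝓢(Rn ι, ℂ)) (x : Rn ι) :
    conjOp V f x = conj (V (conjSchwartz f) x) := rfl

theorem conjSchwartz_conjSchwartz (f : 𝓢(Rn ι, ℂ)) : conjSchwartz (conjSchwartz f) = f := by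
  ext x
  simp [conjSchwartz_apply]

theorem conjOp_comp (V W : 𝓢(Rn ι, ℂ) →L[ℂ] 𝓢(Rn ι, ℂ)) :
    conjOp (V ∘L W) = conjOp V ∘L conjOp W := by
  ext f x
  change conj (V (W _) x) = conj (V (conjSchwartz (conjSchwartz (W (conjSchwartz f)))) x)
  rw [conjSchwartz_conjSchwartz]

theorem conjOp_smul (c : ℂ) (V : 𝓢(Rn ι, ℂ) →L[ℂ] 𝓢(Rn ι, ℂ)) :
    conjOp (c • V) = conj c • conjOp V := by
  ext f x
  change conj (c * V _ x) = conj c * conj (V _ x)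
  rw [map_mul]

theorem conjOp_chirp (P : Rn ι →ₗ[ℝ] Rn ι) : conjOp (chirp P) = chirp (-P) := by
  ext f x
  rw [conjOp_apply, chirp_apply, chirp_apply, conjSchwartz_apply, map_mul, Complex.conj_conj,
    ← Complex.exp_conj, map_mul, Complex.conj_I, Complex.conj_ofReal]
  simp

theorem conjOp_dilation (A : Rn ι ≃L[ℝ] Rn ι) : conjOp (dilation A) = dilation A := by
  ext f x
  rw [conjOp_apply, dilation_apply, dilation_apply, conjSchwartz_apply, Complex.conj_conj]

theorem conj_cis (s : ℝ) : conj (cis s) = cis (-s) := by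
  rw [cis, cis, ← Complex.exp_conj, map_mul, Complex.conj_I, Complex.conj_ofReal]
  simp

theorem conjOp_fourier : conjOp (FourierTransform.fourierCLM ℂ 𝓢(Rn ι, ℂ)) =
    FourierTransform.fourierInvCLM ℂ 𝓢(Rn ι, ℂ) := by
  ext f x
  rw [conjOp_apply]
  change conj (𝓕 (conjSchwartz f) x) = 𝓕⁻ f x
  rw [fourierInv_eq_fourier_neg, fourier_eq_cis, fourier_eq_cis, ← integral_conj]
  simp only [map_mul, conj_cis, conjSchwartz_apply, Complex.conj_conj, inner_neg_right]

/-- The operator `f ↦ (x ↦ ∫ exp (i W(x, x')) f(x') dx')` attached to the quadratic form `W`,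
factored into chirps, the Fourier transform and the dilation by `A = L / 2π`. -/
noncomputable def quadraticFourier (P Q : Rn ι →ₗ[ℝ] Rn ι) (A : Rn ι ≃L[ℝ] Rn ι) :
    𝓢(Rn ι, ℂ) →L[ℂ] 𝓢(Rn ι, ℂ) :=
  chirp P ∘L dilation A ∘L (FourierTransform.fourierCLM ℂ 𝓢(Rn ι, ℂ)) ∘L chirp Q

theorem quadraticFourier_apply (P L Q : Rn ι →ₗ[ℝ] Rn ι) (A : Rn ι ≃L[ℝ] Rn ι)
    (hA : ∀ x, (2 * Real.pi) • A x = L x) (f : 𝓢(Rn ι, ℂ)) (x : Rn ι) :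
    quadraticFourier P Q A f x =
      ∫ x' : Rn ι, Complex.exp (Complex.I * (genFun P L Q x x' : ℝ)) * f x' := by
  change chirp P (dilation A (𝓕 (chirp Q f))) x = _
  rw [chirp_apply, dilation_apply, fourier_eq_cis, ← integral_const_mul]
  refine integral_congr_ae (Filter.Eventually.of_forall fun x' => ?_)
  simp only [chirp_apply, cis]
  rw [← mul_assoc, ← mul_assoc, ← Complex.exp_add, ← Complex.exp_add, genFun, ← hA]
  congr 2
  rw [inner_smul_left, real_inner_comm x' (A x), conj_trivial]
  push_cast
  ring

theorem wignerCovariant_quadraticFourier {P Q : Rn ι →ₗ[ℝ] Rn ι} (hP : P.IsSymmetric)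
    (hQ : Q.IsSymmetric) (A : Rn ι ≃L[ℝ] Rn ι) :
    WignerCovariant (quadraticFourier P Q A) (conjOp (quadraticFourier P Q A))
      ((fun z => join (leftPart z) (rightPart z + P (leftPart z))) ∘
        (fun z => join (A.symm (leftPart z))
          (LinearMap.adjoint (A : Rn ι →ₗ[ℝ] Rn ι) (rightPart z))) ∘
        (fun z => join ((2 * Real.pi)⁻¹ • rightPart z) (-((2 * Real.pi) • leftPart z))) ∘
        (fun z => join (leftPart z) (rightPart z + Q (leftPart z)))) := by
  rw [quadraticFourier, conjOp_comp, conjOp_comp, conjOp_comp, conjOp_chirp, conjOp_chirp,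
    conjOp_dilation, conjOp_fourier]
  exact (wignerCovariant_chirp hP).comp ((wignerCovariant_dilation A).comp
    (wignerCovariant_fourier.comp (wignerCovariant_chirp hQ)))

/-- The normalization constant of the generators of the metaplectic group. -/
noncomputable def genConst (m : ℤ) (L : Rn ι →ₗ[ℝ] Rn ι) : ℂ :=
  (1 / (2 * Real.pi * Complex.I) : ℂ) ^ ((Fintype.card ι : ℂ) / 2) *
    (Complex.I ^ m * (Real.sqrt |LinearMap.det L| : ℝ))

theorem genConst_ne_zero (m : ℤ) {L : Rn ι →ₗ[ℝ] Rn ι} (hL : LinearMap.det L ≠ 0) :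
    genConst m L ≠ 0 := by
  have h1 : (1 / (2 * Real.pi * Complex.I) : ℂ) ≠ 0 := by simp [Real.pi_ne_zero]
  refine mul_ne_zero ?_ (mul_ne_zero (zpow_ne_zero _ Complex.I_ne_zero) ?_)
  · rw [Complex.cpow_def_of_ne_zero h1]
    exact Complex.exp_ne_zero _
  · exact_mod_cast (Real.sqrt_pos.2 (abs_pos.2 hL)).ne'

/-- The dilation `L / 2π`. -/
noncomputable def scaledEquiv (L : Rn ι ≃ₗ[ℝ] Rn ι) : Rn ι ≃L[ℝ] Rn ι :=
  (L.trans (LinearEquiv.smulOfNeZero ℝ (Rn ι) (2 * Real.pi)⁻¹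
    (by positivity))).toContinuousLinearEquiv

theorem scaledEquiv_apply (L : Rn ι ≃ₗ[ℝ] Rn ι) (x : Rn ι) :
    scaledEquiv L x = (2 * Real.pi)⁻¹ • L x := rfl

theorem smul_scaledEquiv (L : Rn ι ≃ₗ[ℝ] Rn ι) (x : Rn ι) :
    (2 * Real.pi) • scaledEquiv L x = L x := by
  rw [scaledEquiv_apply, smul_smul, mul_inv_cancel₀ (by positivity), one_smul]

/-- Metaplectic operators intertwine the Wigner transform with their projections. -/
theorem IsMetaplectic.wignerCovariant {S : 𝓢(Rn ι, ℂ) ≃L[ℂ] 𝓢(Rn ι, ℂ)}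
    {s : Rn (ι ⊕ ι) ≃ₗ[ℝ] Rn (ι ⊕ ι)} (h : IsMetaplectic S s) :
    WignerCovariant (S : 𝓢(Rn ι, ℂ) →L[ℂ] 𝓢(Rn ι, ℂ))
      (conjOp (S : 𝓢(Rn ι, ℂ) →L[ℂ] 𝓢(Rn ι, ℂ))) s := by
  induction h with
  | generator P L Q m hP hQ hL S s hS hs =>
    have hdet : LinearMap.det L ≠ 0 := fun h0 => by simp [h0] at hL
    let Le := L.equivOfDetNeZero hdet
    let A := scaledEquiv Le
    have hA : ∀ x, (2 * Real.pi) • A x = L x := smul_scaledEquiv Le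
    have hc := genConst_ne_zero m hdet
    have e1 : (S : 𝓢(Rn ι, ℂ) →L[ℂ] 𝓢(Rn ι, ℂ)) = genConst m L • quadraticFourier P Q A := by
      ext f x
      change S f x = genConst m L * quadraticFourier P Q A f x
      rw [hS, quadraticFourier_apply P L Q A hA]
      rfl
    rw [e1, conjOp_smul]
    have h2 := (wignerCovariant_quadraticFourier hP hQ A).smul hc
      (b' := conj (genConst m L)) ((map_ne_zero _).2 hc)
    convert h2 using 1
    funext z
    simp only [Function.comp_apply, leftPart_join, rightPart_join]
    conv_lhs => rw [← join_left_right z]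
    refine ((hs _ _ _ _).2 ⟨?_, ?_⟩).symm
    · rw [map_neg, map_smul, add_comm, sub_eq_add_neg]
      congr 2
      refine ext_inner_right ℝ fun v => ?_
      rw [inner_smul_left, LinearMap.adjoint_inner_left, LinearMap.adjoint_inner_left, ← hA,
        inner_smul_right]
      rfl
    · rw [← hA, ContinuousLinearEquiv.apply_symm_apply, smul_smul,
        mul_inv_cancel₀ (by positivity), one_smul, add_sub_cancel_right]
  | mul h₁ h₂ ih₁ ih₂ =>
    have := ih₁.comp ih₂
    rw [← conjOp_comp] at this
    exact this

end Metaplectic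

/-! ### Existence of metaplectic operators -/

section Existence

theorem quadraticFourier_left_inverse (P Q : Rn ι →ₗ[ℝ] Rn ι) (A : Rn ι ≃L[ℝ] Rn ι)
    (f : 𝓢(Rn ι, ℂ)) :
    chirp (-Q) (𝓕⁻ (dilation A.symm (chirp (-P) (quadraticFourier P Q A f)))) = f := by
  change chirp (-Q) (𝓕⁻ (dilation A.symm (chirp (-P) (chirp P (dilation A (𝓕 (chirp Q f))))))) = f
  rw [chirp_neg_chirp]
  have h : ∀ g, dilation A.symm (dilation A g) = g := fun g => by
    ext x; simp [dilation_apply]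
  rw [h, FourierTransform.fourierInv_fourier_eq, chirp_neg_chirp]

theorem quadraticFourier_right_inverse (P Q : Rn ι →ₗ[ℝ] Rn ι) (A : Rn ι ≃L[ℝ] Rn ι)
    (f : 𝓢(Rn ι, ℂ)) :
    quadraticFourier P Q A (chirp (-Q) (𝓕⁻ (dilation A.symm (chirp (-P) f)))) = f := by
  change chirp P (dilation A (𝓕 (chirp Q (chirp (-Q) (𝓕⁻ (dilation A.symm (chirp (-P) f))))))) = f
  rw [chirp_chirp_neg, FourierTransform.fourier_fourierInv_eq]
  have h : ∀ g, dilation A (dilation A.symm g) = g := fun g => by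
    ext x; simp [dilation_apply]
  rw [h, chirp_chirp_neg]

/-- A generator of the metaplectic group, as an automorphism of the Schwartz space. -/
noncomputable def genEquiv (c : ℂ) (hc : c ≠ 0) (P Q : Rn ι →ₗ[ℝ] Rn ι) (A : Rn ι ≃L[ℝ] Rn ι) :
    𝓢(Rn ι, ℂ) ≃L[ℂ] 𝓢(Rn ι, ℂ) :=
  ContinuousLinearEquiv.equivOfInverse (c • quadraticFourier P Q A)
    (c⁻¹ • (chirp (-Q) ∘L (FourierTransform.fourierInvCLM ℂ 𝓢(Rn ι, ℂ)) ∘L dilation A.symm ∘L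
      chirp (-P)))
    (fun f => by
      change c⁻¹ • (chirp (-Q) (𝓕⁻ (dilation A.symm (chirp (-P)
        (c • quadraticFourier P Q A f))))) = f
      rw [map_smul, map_smul, FourierTransform.fourierInv_smul, map_smul,
        quadraticFourier_left_inverse, smul_smul, inv_mul_cancel₀ hc, one_smul])
    (fun f => by
      change c • quadraticFourier P Q A (c⁻¹ • (chirp (-Q) (𝓕⁻ (dilation A.symm
        (chirp (-P) f))))) = f
      rw [map_smul, quadraticFourier_right_inverse, smul_smul, mul_inv_cancel₀ hc, one_smul])

theorem genEquiv_apply (c : ℂ) (hc : c ≠ 0) (P Q : Rn ι →ₗ[ℝ] Rn ι) (A : Rn ι ≃L[ℝ] Rn ι)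
    (f : 𝓢(Rn ι, ℂ)) (x : Rn ι) : genEquiv c hc P Q A f x = c * quadraticFourier P Q A f x := rfl

/-- The block `ξ' ↦ x` of a linear map `(x', ξ') ↦ (x, ξ)` of phase space. -/
noncomputable def blockB (s : Rn (ι ⊕ ι) ≃ₗ[ℝ] Rn (ι ⊕ ι)) : Rn ι →ₗ[ℝ] Rn ι :=
  (leftCLM (ι := ι) (κ := ι) : Rn (ι ⊕ ι) →ₗ[ℝ] Rn ι) ∘ₗ (s : Rn (ι ⊕ ι) →ₗ[ℝ] Rn (ι ⊕ ι)) ∘ₗ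
    (inclCLM (ι := ι) (κ := ι) : Rn ι →ₗ[ℝ] Rn (ι ⊕ ι))

theorem blockB_apply (s : Rn (ι ⊕ ι) ≃ₗ[ℝ] Rn (ι ⊕ ι)) (ξ : Rn ι) :
    blockB s ξ = leftPart (s (join 0 ξ)) := rfl

/-- The inclusion `x ↦ (x, 0)`. -/
noncomputable def inclLeft : Rn ι →ₗ[ℝ] Rn (ι ⊕ κ) :=
  (joinL (ι := ι) (κ := κ) : (Rn ι × Rn κ) →ₗ[ℝ] Rn (ι ⊕ κ)) ∘ₗ LinearMap.inl ℝ (Rn ι) (Rn κ)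

omit [Fintype ι] [Fintype κ] in
theorem join_eq_add (x : Rn ι) (y : Rn κ) : join x y = join x 0 + join 0 y := by
  ext i
  cases i <;> simp [join]

omit [Fintype ι] [Fintype κ] in
theorem leftPart_add (z w : Rn (ι ⊕ κ)) : leftPart (z + w) = leftPart z + leftPart w := rfl

omit [Fintype ι] [Fintype κ] in
theorem eq_join {z : Rn (ι ⊕ κ)} {x : Rn ι} {y : Rn κ} (hx : leftPart z = x) (hy : rightPart z = y) :
    z = join x y := by
  rw [← hx, ← hy, join_left_right]

/-- A symplectic map whose block `ξ' ↦ x` is invertible has a quadratic generating function, and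
hence lies below a generator of the metaplectic group. -/
theorem exists_isMetaplectic_of_free {s : Rn (ι ⊕ ι) ≃ₗ[ℝ] Rn (ι ⊕ ι)} (hs : IsSymplectic s)
    (hB : Function.Injective (blockB s)) : ∃ S, IsMetaplectic S s := by
  let Be : Rn ι ≃ₗ[ℝ] Rn ι := LinearEquiv.ofInjectiveEndo (blockB s) hB
  have hBe : ∀ x, leftPart (s (join 0 (Be.symm x))) = x := fun x => Be.apply_symm_apply x
  let sl : Rn (ι ⊕ ι) →ₗ[ℝ] Rn (ι ⊕ ι) := s
  let pr : Rn (ι ⊕ ι) →ₗ[ℝ] Rn ι := rightCLM (ι := ι) (κ := ι)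
  let pl : Rn (ι ⊕ ι) →ₗ[ℝ] Rn ι := leftCLM (ι := ι) (κ := ι)
  let il : Rn ι →ₗ[ℝ] Rn (ι ⊕ ι) := inclLeft
  let ir : Rn ι →ₗ[ℝ] Rn (ι ⊕ ι) := (inclCLM (ι := ι) (κ := ι) : Rn ι →ₗ[ℝ] Rn (ι ⊕ ι))
  let L : Rn ι →ₗ[ℝ] Rn ι := Be.symm
  let Q : Rn ι →ₗ[ℝ] Rn ι := L ∘ₗ pl ∘ₗ sl ∘ₗ il
  let P : Rn ι →ₗ[ℝ] Rn ι := pr ∘ₗ sl ∘ₗ ir ∘ₗ L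
  let R : Rn ι →ₗ[ℝ] Rn ι := pr ∘ₗ sl ∘ₗ il - pr ∘ₗ sl ∘ₗ ir ∘ₗ Q
  have hQ : ∀ x', Q x' = Be.symm (leftPart (s (join x' 0))) := fun _ => rfl
  have hP : ∀ x, P x = rightPart (s (join 0 (Be.symm x))) := fun _ => rfl
  have hR : ∀ x', R x' = rightPart (s (join x' 0)) - rightPart (s (join 0 (Q x'))) := fun _ => rfl
  have hLB : ∀ x, leftPart (s (join 0 (L x))) = x := hBe
  have hirL : ∀ x x', (join 0 (L x - Q x') : Rn (ι ⊕ ι)) = join 0 (L x) - join 0 (Q x') :=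
    fun x x' => map_sub ir _ _
  -- the graph of `s`, parametrized by the positions `x'` and `x`
  have graph : ∀ x x', s (join x' (L x - Q x')) = join x (P x + R x') := fun x x' => by
    rw [join_eq_add x', hirL, map_add, map_sub]
    refine eq_join ?_ ?_
    · change leftPart (s (join x' 0)) + (leftPart (s (join 0 (L x))) -
        leftPart (s (join 0 (Q x')))) = x
      rw [hQ, hLB, hBe]
      abel
    · change rightPart (s (join x' 0)) + (rightPart (s (join 0 (L x))) -
        rightPart (s (join 0 (Q x')))) = P x + R x'
      rw [hP, hR]
      change _ + (rightPart (s (join 0 (Be.symm x))) - _) = _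
      abel
  -- the graph is Lagrangian, which makes `P` and `Q` symmetric and `R = -Lᵀ`
  have hsym : ∀ x x' y y', ⟪P x + R x', y⟫ - ⟪P y + R y', x⟫ =
      ⟪L x - Q x', y'⟫ - ⟪L y - Q y', x'⟫ := fun x x' y y' => by
    have h := hs (join x' (L x - Q x')) (join y' (L y - Q y'))
    rw [graph, graph] at h
    simpa only [sympForm, leftPart_join, rightPart_join] using h
  have hPs : P.IsSymmetric := fun x y => by
    have := hsym x 0 y 0
    simp only [map_zero, add_zero, inner_zero_right, sub_zero] at this
    linarith [real_inner_comm x (P y)]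
  have hQs : Q.IsSymmetric := fun x y => by
    have := hsym 0 x 0 y
    simp only [map_zero, zero_add, inner_zero_right, sub_zero, zero_sub, inner_neg_left] at this
    linarith [real_inner_comm x (Q y)]
  have hRL : ∀ x', R x' = -LinearMap.adjoint L x' := fun x' => by
    refine ext_inner_right ℝ fun y => ?_
    have := hsym 0 x' y 0
    simp only [map_zero, zero_add, add_zero, inner_zero_right, sub_zero, zero_sub] at this
    rw [inner_neg_left, LinearMap.adjoint_inner_left, this, real_inner_comm]
  have hdet : LinearMap.det L ≠ 0 := (LinearEquiv.isUnit_det' Be.symm).ne_zero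
  obtain ⟨m, hm⟩ : ∃ m : ℤ, 0 < (-1 : ℝ) ^ m * LinearMap.det L := by
    rcases lt_or_gt_of_ne hdet with h | h
    · exact ⟨1, by simpa using h⟩
    · exact ⟨0, by simpa using h⟩
  refine ⟨genEquiv (genConst m L) (genConst_ne_zero m hdet) P Q (scaledEquiv Be.symm),
    .generator P L Q m hPs hQs hm _ _ (fun f x => ?_) fun x ξ x' ξ' => ?_⟩
  · rw [genEquiv_apply, quadraticFourier_apply P L Q _ (smul_scaledEquiv Be.symm)]
    rfl
  · rw [sub_eq_add_neg, ← hRL]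
    constructor
    · intro h
      have h1 := congrArg leftPart h
      rw [leftPart_join, join_eq_add x', map_add, leftPart_add] at h1
      have h2 : ξ' = L x - Q x' := by
        change _ = Be.symm x - Q x'
        rw [h1, map_add, hQ, add_sub_cancel_left]
        exact (Be.symm_apply_apply ξ').symm
      rw [h2, graph] at h
      exact ⟨congrArg rightPart h, h2⟩
    · rintro ⟨rfl, rfl⟩
      exact (graph x x').symm

theorem IsSymplectic.symm {s : Rn (ι ⊕ ι) ≃ₗ[ℝ] Rn (ι ⊕ ι)} (hs : IsSymplectic s) :
    IsSymplectic s.symm := fun z w => by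
  rw [← hs, s.apply_symm_apply, s.apply_symm_apply]

theorem IsSymplectic.trans {s t : Rn (ι ⊕ ι) ≃ₗ[ℝ] Rn (ι ⊕ ι)} (hs : IsSymplectic s)
    (ht : IsSymplectic t) : IsSymplectic (s.trans t) := fun z w => (ht _ _).trans (hs z w)

/-- The symplectic map `(x, ξ) ↦ (ξ, c ξ - x)`. -/
noncomputable def shearTurn (c : ℝ) : Rn (ι ⊕ ι) ≃ₗ[ℝ] Rn (ι ⊕ ι) where
  toFun z := join (rightPart z) (c • rightPart z - leftPart z)
  invFun z := join (c • leftPart z - rightPart z) (leftPart z)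
  map_add' z w := by
    ext i; cases i
    · simp [join, leftPart, rightPart]
    · simp only [join, leftPart, rightPart, PiLp.add_apply, PiLp.sub_apply, PiLp.smul_apply,
        Sum.elim_inr, smul_eq_mul]
      ring
  map_smul' r z := by
    ext i; cases i
    · simp [join, leftPart, rightPart]
    · simp only [join, leftPart, rightPart, PiLp.sub_apply, PiLp.smul_apply,
        Sum.elim_inr, smul_eq_mul, RingHom.id_apply]
      ring
  left_inv z := by
    ext i; cases i <;> simp [join, leftPart, rightPart]
  right_inv z := by
    ext i; cases i <;> simp [join, leftPart, rightPart]

omit [Fintype ι] in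
theorem shearTurn_apply (c : ℝ) (z : Rn (ι ⊕ ι)) :
    shearTurn c z = join (rightPart z) (c • rightPart z - leftPart z) := rfl

omit [Fintype ι] in
theorem shearTurn_symm_apply (c : ℝ) (z : Rn (ι ⊕ ι)) :
    (shearTurn c).symm z = join (c • leftPart z - rightPart z) (leftPart z) := rfl

theorem isSymplectic_shearTurn (c : ℝ) : IsSymplectic (shearTurn (ι := ι) c) := fun z w => by
  simp only [sympForm, shearTurn_apply, leftPart_join, rightPart_join, inner_sub_left,
    inner_smul_left, conj_trivial]
  rw [real_inner_comm (rightPart w) (rightPart z), real_inner_comm (leftPart z) (rightPart w),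
    real_inner_comm (leftPart w) (rightPart z)]
  ring

/-- For a symplectic map with blocks `A`, `B` in its first row, `A + c B` is invertible for some
real `c`. Otherwise every `c` admits a vector `p ≠ 0` orthogonal to the range of `A + c B`; as
`A Bᵀ` is symmetric, the vectors `Bᵀ p` for distinct `c` are nonzero and orthogonal, and there are
too many. -/
theorem exists_injective_blockB {s : Rn (ι ⊕ ι) ≃ₗ[ℝ] Rn (ι ⊕ ι)} (hs : IsSymplectic s) :
    ∃ c : ℝ, Function.Injective (blockB ((shearTurn c).trans s)) := by
  by_contra! hcon
  -- the components of `s⁻¹ (0, p)` are `-Bᵀ p` and `Aᵀ p`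
  have hex : ∀ c : ℝ, ∃ p : Rn ι, p ≠ 0 ∧
      rightPart (s.symm (join 0 p)) = (-c) • -leftPart (s.symm (join 0 p)) := fun c => by
    have hr : LinearMap.range (blockB ((shearTurn c).trans s)) ≠ ⊤ := fun h =>
      hcon c (LinearMap.injective_iff_surjective.2 (LinearMap.range_eq_top.1 h))
    obtain ⟨p, hp, hp0⟩ := Submodule.exists_mem_ne_zero_of_ne_bot
      (fun h => hr ((Submodule.orthogonal_eq_bot_iff).1 h))
    refine ⟨p, hp0, ?_⟩
    set zp := s.symm (join 0 p)
    refine ext_inner_right ℝ fun ξ => ?_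
    have h1 : ⟪blockB ((shearTurn c).trans s) ξ, p⟫ = 0 :=
      (Submodule.mem_orthogonal _ _).1 hp _ (LinearMap.mem_range_self _ ξ)
    have h2 := hs zp (shearTurn c (join 0 ξ))
    have h3 : s zp = join 0 p := s.apply_symm_apply _
    rw [h3] at h2
    simp only [sympForm, shearTurn_apply, leftPart_join, rightPart_join, sub_zero,
      inner_zero_right] at h2
    have h4 : ⟪p, leftPart (s (join ξ (c • ξ)))⟫ = 0 := by
      rw [real_inner_comm, ← h1, blockB_apply]
      simp [shearTurn_apply]
    rw [h4, inner_smul_left, conj_trivial] at h2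
    rw [inner_smul_left, inner_neg_left, conj_trivial, real_inner_comm ξ (leftPart zp)]
    linarith
  choose p hp0 hp using hex
  let l : ℝ → Rn ι := fun c => leftPart (s.symm (join 0 (p c)))
  have hr : ∀ c, rightPart (s.symm (join 0 (p c))) = c • l c := fun c => by
    rw [hp]; simp [l]
  have hl0 : ∀ c, l c ≠ 0 := fun c h0 => by
    have h1 : s.symm (join 0 (p c)) = 0 := by
      rw [← join_left_right (s.symm (join 0 (p c))), hr]
      change join (l c) _ = _
      rw [h0, smul_zero]
      ext i; cases i <;> simp [join]
    have h2 := (LinearEquiv.map_eq_zero_iff _).1 h1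
    exact hp0 c (congrArg rightPart h2)
  have hort : Pairwise fun c d => ⟪l c, l d⟫ = 0 := fun c d hcd => by
    have h1 := hs.symm (join 0 (p c)) (join 0 (p d))
    simp only [sympForm, leftPart_join, rightPart_join, inner_zero_right, sub_zero] at h1
    rw [hr, hr] at h1
    change ⟪c • l c, l d⟫ - ⟪d • l d, l c⟫ = 0 at h1
    rw [inner_smul_left, inner_smul_left, conj_trivial, conj_trivial, real_inner_comm (l c) (l d),
      ← sub_mul] at h1
    exact (mul_eq_zero.1 h1).resolve_left (sub_ne_zero.2 hcd)
  have hli := linearIndependent_of_ne_zero_of_inner_eq_zero (𝕜 := ℝ) hl0 hort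
  exact not_finite_iff_infinite.2 inferInstance (LinearIndependent.finite hli)

/-- Every symplectic map is the projection of a metaplectic operator, being the product of two maps
with a generating function. -/
theorem IsSymplectic.exists_isMetaplectic {s : Rn (ι ⊕ ι) ≃ₗ[ℝ] Rn (ι ⊕ ι)} (hs : IsSymplectic s) :
    ∃ S, IsMetaplectic S s := by
  obtain ⟨c, hc⟩ := exists_injective_blockB hs
  obtain ⟨S₁, h₁⟩ := exists_isMetaplectic_of_free ((isSymplectic_shearTurn c).trans hs) hc
  obtain ⟨S₂, h₂⟩ := exists_isMetaplectic_of_free (isSymplectic_shearTurn (ι := ι) c).symm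
    (fun x y h => by
      simp only [blockB_apply, shearTurn_symm_apply, leftPart_join, rightPart_join] at h
      simpa [join, leftPart] using h)
  have h := IsMetaplectic.mul h₁ h₂
  have e : (shearTurn c).symm.trans ((shearTurn c).trans s) = s := by
    ext1 z; simp
  rw [e] at h
  exact ⟨_, h⟩

end Existence

/-! ### Intertwining relations -/

section Intertwining

theorem conjOp_id : conjOp (ContinuousLinearMap.id ℂ 𝓢(Rn ι, ℂ)) = ContinuousLinearMap.id ℂ _ := by
  ext f x
  simp [conjOp_apply, conjSchwartz_apply]

theorem conjOp_conjOp_symm (S : 𝓢(Rn ι, ℂ) ≃L[ℂ] 𝓢(Rn ι, ℂ)) (f : 𝓢(Rn ι, ℂ)) :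
    conjOp (S : 𝓢(Rn ι, ℂ) →L[ℂ] 𝓢(Rn ι, ℂ))
      (conjOp (S.symm : 𝓢(Rn ι, ℂ) →L[ℂ] 𝓢(Rn ι, ℂ)) f) = f := by
  have h := conjOp_comp (S : 𝓢(Rn ι, ℂ) →L[ℂ] 𝓢(Rn ι, ℂ)) S.symm
  rw [ContinuousLinearEquiv.coe_comp_coe_symm, conjOp_id] at h
  exact (DFunLike.congr_fun h f).symm

theorem conjOp_symm_conjOp (S : 𝓢(Rn ι, ℂ) ≃L[ℂ] 𝓢(Rn ι, ℂ)) (f : 𝓢(Rn ι, ℂ)) :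
    conjOp (S.symm : 𝓢(Rn ι, ℂ) →L[ℂ] 𝓢(Rn ι, ℂ))
      (conjOp (S : 𝓢(Rn ι, ℂ) →L[ℂ] 𝓢(Rn ι, ℂ)) f) = f :=
  conjOp_conjOp_symm S.symm f

/-- Integrating the covariance relation shows that `U` is, up to a constant, the inverse transpose
of `S`. -/
theorem WignerCovariant.exists_integral_eq {S U : 𝓢(Rn ι, ℂ) →L[ℂ] 𝓢(Rn ι, ℂ)}
    {s : Rn (ι ⊕ ι) ≃ₗ[ℝ] Rn (ι ⊕ ι)} (h : WignerCovariant S U s) :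
    ∃ c : ℂ, c ≠ 0 ∧ (∀ f g, ∫ x, S f x * U g x = c * ∫ x, f x * g x) ∧
      ∀ (b : Rn (ι ⊕ ι) → ℂ) (f g), ∫ z, b z * cw (S f) (U g) z = c * ∫ z, b (s z) * cw f g z := by
  obtain ⟨c, hc, h⟩ := h
  obtain ⟨d, hd, hs⟩ := exists_integral_comp_linearEquiv s
  have key : ∀ (b : Rn (ι ⊕ ι) → ℂ) (f g),
      ∫ z, b z * cw (S f) (U g) z = d⁻¹ * c * ∫ z, b (s z) * cw f g z := fun b f g => by
    have h1 := hs fun z => b z * cw (S f) (U g) z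
    simp only [h, mul_left_comm _ c] at h1
    rw [integral_const_mul] at h1
    rw [mul_assoc, h1, inv_mul_cancel_left₀ hd]
  refine ⟨d⁻¹ * c, mul_ne_zero (inv_ne_zero hd) hc, fun f g => ?_, key⟩
  have h2 := key (fun _ => 1) f g
  simpa only [one_mul, integral_cw] using h2

/-- Covariance of the Weyl calculus, for transposes. -/
theorem WignerCovariant.intertwines {S : 𝓢(Rn ι, ℂ) ≃L[ℂ] 𝓢(Rn ι, ℂ)}
    {U : 𝓢(Rn ι, ℂ) →L[ℂ] 𝓢(Rn ι, ℂ)} {s : Rn (ι ⊕ ι) ≃ₗ[ℝ] Rn (ι ⊕ ι)}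
    (h : WignerCovariant (S : 𝓢(Rn ι, ℂ) →L[ℂ] 𝓢(Rn ι, ℂ)) U s) {b : Rn (ι ⊕ ι) → ℂ}
    {T T' : 𝓢(Rn ι, ℂ) →L[ℂ] 𝓢(Rn ι, ℂ)} (hT : IsTranspose b T)
    (hT' : IsTranspose (fun z => b (s z)) T') (g : 𝓢(Rn ι, ℂ)) : U (T' g) = T (U g) := by
  obtain ⟨c, -, h1, h2⟩ := h.exists_integral_eq
  refine emb_injective fun φ => ?_
  obtain ⟨f, rfl⟩ := S.surjective φ
  have e1 := h1 f (T' g)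
  rw [hT', ← h2] at e1
  rw [hT]
  exact e1

end Intertwining

/-! ### The kernel distributions -/

section Kernel

theorem intertwiner_apply (S : 𝓢(Rn (ι ⊕ κ), ℂ) ≃L[ℂ] 𝓢(Rn (ι ⊕ κ), ℂ)) (χ : 𝓢'(Rn κ, ℂ))
    (φ : 𝓢(Rn ι, ℂ)) (Φ : 𝓢(Rn (ι ⊕ κ), ℂ)) :
    intertwiner S χ φ Φ =
      χ (partialPairing φ (conjOp (S : 𝓢(Rn (ι ⊕ κ), ℂ) →L[ℂ] 𝓢(Rn (ι ⊕ κ), ℂ)) Φ)) := rfl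

theorem integral_mul_stensor (Φ : 𝓢(Rn (ι ⊕ κ), ℂ)) (ψ : 𝓢(Rn ι, ℂ)) (g : 𝓢(Rn κ, ℂ)) :
    ∫ z, Φ z * stensor ψ g z = ∫ y, partialPairing ψ Φ y * g y := by
  have hi : Integrable fun z => Φ z * stensor ψ g z :=
    (SchwartzMap.pairing (ContinuousLinearMap.mul ℂ ℂ) Φ (stensor ψ g)).integrable
  rw [integral_join_symm hi]
  refine integral_congr_ae (Filter.Eventually.of_forall fun y => ?_)
  simp only [stensor_apply, leftPart_join, rightPart_join, partialPairing_apply]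
  rw [← integral_mul_const]
  refine integral_congr_ae (Filter.Eventually.of_forall fun x => ?_)
  simp only
  ring

theorem partialPairing_stensor (φ ψ : 𝓢(Rn ι, ℂ)) (g : 𝓢(Rn κ, ℂ)) :
    partialPairing φ (stensor ψ g) = (∫ x, φ x * ψ x) • g := by
  ext y
  rw [partialPairing_apply, smul_apply, smul_eq_mul, ← integral_mul_const]
  simp only [stensor_apply, leftPart_join, rightPart_join, mul_assoc]

/-- If `S⁻¹(φ ⊗ χ)` is a Schwartz function, then so is `χ`: pair with `ψ ⊗ g` where
`∫ φ ψ = 1`. -/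
theorem isSchwartz_of_intertwiner {S : 𝓢(Rn (ι ⊕ κ), ℂ) ≃L[ℂ] 𝓢(Rn (ι ⊕ κ), ℂ)}
    {s : Rn ((ι ⊕ κ) ⊕ (ι ⊕ κ)) ≃ₗ[ℝ] Rn ((ι ⊕ κ) ⊕ (ι ⊕ κ))} (hS : IsMetaplectic S s)
    {φ : 𝓢(Rn ι, ℂ)} (hφ : φ ≠ 0) {χ : 𝓢'(Rn κ, ℂ)} (h : IsSchwartz (intertwiner S χ φ)) :
    IsSchwartz χ := by
  obtain ⟨F, hF⟩ := h
  obtain ⟨ψ, hψ⟩ := exists_dual_window hφ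
  obtain ⟨c, hc, hu, -⟩ := hS.wignerCovariant.exists_integral_eq
  refine ⟨c⁻¹ • partialPairing ψ (S F), ?_⟩
  ext g
  have h1 := intertwiner_apply S χ φ
    (conjOp (S.symm : 𝓢(Rn (ι ⊕ κ), ℂ) →L[ℂ] 𝓢(Rn (ι ⊕ κ), ℂ)) (stensor ψ g))
  rw [conjOp_conjOp_symm, partialPairing_stensor, hψ, one_smul, hF, emb_apply] at h1
  have h2 := hu F (conjOp (S.symm : 𝓢(Rn (ι ⊕ κ), ℂ) →L[ℂ] 𝓢(Rn (ι ⊕ κ), ℂ)) (stensor ψ g))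
  rw [conjOp_conjOp_symm, h1] at h2
  have h3 := integral_mul_stensor (S F) ψ g
  rw [emb_apply]
  simp only [smul_apply, smul_eq_mul, mul_assoc]
  rw [integral_const_mul, ← h3, eq_inv_mul_iff_mul_eq₀ hc]
  exact h2.symm

/-- The Dirac distribution is not a Schwartz function, in positive dimension. -/
theorem not_isSchwartz_delta [Nonempty κ] :
    ¬ IsSchwartz (TemperedDistribution.delta (0 : Rn κ) : 𝓢'(Rn κ, ℂ)) := by
  rintro ⟨f, hf⟩
  have hf' : ∀ g : 𝓢(Rn κ, ℂ), g 0 = ∫ x, f x * g x := fun g => by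
    rw [← emb_apply, ← hf]; rfl
  obtain ⟨i⟩ := ‹Nonempty κ›
  let l : Rn κ →L[ℝ] ℂ := Complex.ofRealCLM ∘L (EuclideanSpace.proj i : Rn κ →L[ℝ] ℝ)
  have hl : Function.HasTemperateGrowth l := l.hasTemperateGrowth
  -- multiplication by a coordinate annihilates the Dirac distribution
  have h1 : smulLeftCLM ℂ l f = 0 := emb_injective fun φ => by
    have h2 := hf' (smulLeftCLM ℂ l φ)
    rw [smulLeftCLM_apply_apply hl, map_zero, zero_smul] at h2
    simp only [zero_apply, mul_zero, integral_zero]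
    rw [h2]
    refine integral_congr_ae (Filter.Eventually.of_forall fun x => ?_)
    simp only [smulLeftCLM_apply_apply hl, smul_eq_mul]
    ring
  have h3 : ∀ x : Rn κ, x i ≠ 0 → f x = 0 := fun x hx => by
    have h4 := DFunLike.congr_fun h1 x
    rw [smulLeftCLM_apply_apply hl, zero_apply, smul_eq_mul] at h4
    refine (mul_eq_zero.1 h4).resolve_left ?_
    exact Complex.ofReal_ne_zero.2 hx
  have hf0 : f = 0 := by
    ext x
    classical
    have hc : Continuous fun t : ℝ => f (x + t • EuclideanSpace.single i 1) := by fun_prop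
    have h5 : (fun t : ℝ => f (x + t • EuclideanSpace.single i 1)) = fun _ => 0 :=
      Continuous.ext_on (dense_compl_singleton (-(x i))) hc continuous_const fun t ht =>
        h3 _ (by
          simp only [PiLp.add_apply, PiLp.smul_apply, PiLp.single_apply, if_true, smul_eq_mul,
            mul_one]
          intro h0
          exact ht (by simp; linarith))
    simpa using congrFun h5 0
  obtain ⟨g, hg⟩ := exists_schwartz_ne_zero κ
  refine hg ?_
  rw [hf', hf0]
  simp

end Kernel

end SympExt

theorem mainTheorem5 (n k : ℕ) (hn : 1 ≤ n) (hk : 1 ≤ k)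
    (ρ m₁ m₀ : ℝ) (hρ : 0 < ρ) (hρ1 : ρ ≤ 1) (hm : m₀ ≤ m₁)
    (a : Rn (Fin n ⊕ Fin n) → ℂ) (ha : ShubinSymbol ρ m₁ m₀ a)
    (A : 𝓢(Rn (Fin n), ℂ) →L[ℂ] 𝓢'(Rn (Fin n), ℂ)) (hA : HasWeylSymbol A a)
    (s : Rn ((Fin n ⊕ Fin k) ⊕ (Fin n ⊕ Fin k)) ≃ₗ[ℝ] Rn ((Fin n ⊕ Fin k) ⊕ (Fin n ⊕ Fin k)))
    (hs : IsSymplectic s)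
    (At : 𝓢(Rn (Fin n ⊕ Fin k), ℂ) →L[ℂ] 𝓢'(Rn (Fin n ⊕ Fin k), ℂ))
    (hAt : HasWeylSymbol At (extSymbol s a)) :
    (∃! B : 𝓢'(Rn (Fin n ⊕ Fin k), ℂ) →L[ℂ] 𝓢'(Rn (Fin n ⊕ Fin k), ℂ), IsDualExtension At B) ∧
    ∀ B : 𝓢'(Rn (Fin n ⊕ Fin k), ℂ) →L[ℂ] 𝓢'(Rn (Fin n ⊕ Fin k), ℂ), IsDualExtension At B →
      (∃ u, u ≠ 0 ∧ B u = 0) →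
        ¬ GloballyHypoelliptic B ∧
        (∃ S, IsMetaplectic S s) ∧
        (∃ φ : 𝓢(Rn (Fin n), ℂ), φ ≠ 0 ∧ A φ = 0) ∧
        (∃ χ : 𝓢'(Rn (Fin k), ℂ), ¬ IsSchwartz χ) ∧
        ∀ S, IsMetaplectic S s →
          ∀ φ : 𝓢(Rn (Fin n), ℂ), φ ≠ 0 → A φ = 0 →
            ∀ χ : 𝓢'(Rn (Fin k), ℂ), ¬ IsSchwartz χ →
              B (intertwiner S χ φ) = 0 ∧ ¬ IsSchwartz (intertwiner S χ φ) := by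
  obtain ⟨M, haM⟩ := ha.exists_isSymbol hρ
  have hbM : IsSymbol M (symbolTensorOne (κ := Fin k) a) := haM.tensorOne
  have heM : IsSymbol M (extSymbol s a) := by
    have h := hbM.comp_clm s.toContinuousLinearEquiv.toContinuousLinearMap
    exact h
  obtain ⟨T, hT⟩ := exists_transpose haM
  obtain ⟨T₁, hT₁⟩ := exists_transpose hbM
  obtain ⟨Te, hTe⟩ := exists_transpose heM
  have hAker : ∀ φ, A φ = 0 ↔ ∀ ψ, ∫ x, φ x * T ψ x = 0 := fun φ => by
    simp only [← hT.weyl_apply hA]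
    exact ⟨fun h ψ => by rw [h]; rfl, fun h => by ext ψ; exact h ψ⟩
  refine ⟨hTe.existsUnique_dualExtension hAt, fun B hB hker => ?_⟩
  have hBapp := hTe.dualExtension_apply hAt hB
  obtain ⟨S₀, hS₀⟩ := hs.exists_isMetaplectic
  have hint : ∀ S, IsMetaplectic S s → ∀ g,
      conjOp (S : 𝓢(Rn (Fin n ⊕ Fin k), ℂ) →L[ℂ] 𝓢(Rn (Fin n ⊕ Fin k), ℂ)) (Te g) =
        T₁ (conjOp (S : 𝓢(Rn (Fin n ⊕ Fin k), ℂ) →L[ℂ] 𝓢(Rn (Fin n ⊕ Fin k), ℂ)) g) :=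
    fun S hS g => hS.wignerCovariant.intertwines hT₁ hTe g
  have hex : ∃ φ : 𝓢(Rn (Fin n), ℂ), φ ≠ 0 ∧ A φ = 0 := by
    obtain ⟨u, hu, hBu⟩ := hker
    -- the distribution `S₀ u` lies in the kernel of the operator with symbol `a ⊗ 1`
    let v : 𝓢(Rn (Fin n ⊕ Fin k), ℂ) →L[ℂ] ℂ := toFunctional u ∘L
      conjOp (S₀.symm : 𝓢(Rn (Fin n ⊕ Fin k), ℂ) →L[ℂ] 𝓢(Rn (Fin n ⊕ Fin k), ℂ))
    have hv : v ≠ 0 := fun h0 => hu <| by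
      ext g
      have h1 := DFunLike.congr_fun h0
        (conjOp (S₀ : 𝓢(Rn (Fin n ⊕ Fin k), ℂ) →L[ℂ] 𝓢(Rn (Fin n ⊕ Fin k), ℂ)) g)
      change u (conjOp _ (conjOp _ g)) = 0 at h1
      rw [conjOp_symm_conjOp] at h1
      exact h1
    have hv0 : ∀ Φ, v (T₁ Φ) = 0 := fun Φ => by
      change u (conjOp _ (T₁ Φ)) = 0
      have h1 := hint S₀ hS₀
        (conjOp (S₀.symm : 𝓢(Rn (Fin n ⊕ Fin k), ℂ) →L[ℂ] 𝓢(Rn (Fin n ⊕ Fin k), ℂ)) Φ)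
      rw [conjOp_conjOp_symm] at h1
      rw [← h1, conjOp_symm_conjOp, ← hBapp, hBu]
      rfl
    obtain ⟨φ, hφ, hφ0⟩ := exists_ker_of_ker_tensorOne ha hρ hρ1 hT hT₁ hv hv0
    exact ⟨φ, hφ, (hAker φ).2 hφ0⟩
  have hχ : ∃ χ : 𝓢'(Rn (Fin k), ℂ), ¬ IsSchwartz χ :=
    haveI : Nonempty (Fin k) := ⟨⟨0, hk⟩⟩
    ⟨_, not_isSchwartz_delta⟩
  have hall : ∀ S, IsMetaplectic S s → ∀ φ : 𝓢(Rn (Fin n), ℂ), φ ≠ 0 → A φ = 0 →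
      ∀ χ : 𝓢'(Rn (Fin k), ℂ), ¬ IsSchwartz χ →
        B (intertwiner S χ φ) = 0 ∧ ¬ IsSchwartz (intertwiner S χ φ) :=
    fun S hS φ hφ hAφ χ hχ => by
      refine ⟨?_, fun h => hχ (isSchwartz_of_intertwiner hS hφ h)⟩
      ext g
      rw [hBapp, intertwiner_apply, hint S hS,
        partialPairing_transpose_eq_zero haM hT hT₁ ((hAker φ).1 hAφ), map_zero]
      rfl
  refine ⟨fun hyp => ?_, ⟨S₀, hS₀⟩, hex, hχ, hall⟩
  obtain ⟨φ, hφ, hAφ⟩ := hex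
  obtain ⟨χ, hχ⟩ := hχ
  obtain ⟨h1, h2⟩ := hall S₀ hS₀ φ hφ hAφ χ hχ
  refine h2 (hyp _ ⟨0, ?_⟩)
  rw [h1, emb, map_zero]
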